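/- **Setting.** Let $N\ge 1$, let $\Lambda=(\mathbb Z/N)^4$ be the periodic hypercubic lattice, $\hat s=\hat1+\hat2+\hat3+\hat4$, and let $\tilde\Lambda=\Lambda+\tfrac12\hat s$ be the dual lattice, $F(x)=x+\tfrac12\hat s$, $\tilde F(x)=x-\tfrac12\hat s$. Lattice forms are antisymmetric functions on oriented cells $(x,\mu_1\cdots\mu_r)$, with $$(d\alpha)_{x,\mu_1\cdots\mu_{r+1}}=\sum_j(-1)^{j+1}\bigl(\alpha_{x+\hat\mu_j,\cdots\mathring\mu_j\cdots}-\alpha_{x,\cdots\mathring\mu_j\cdots}\bigr),\qquad (\partial\alpha)_{x,\mu_1\cdots\mu_r}=\sum_\nu\bigl(\alpha_{x,\mu_1\cdots\mu_r\nu}-\alpha_{x-\hat\nu,\mu_1\cdots\mu_r\nu}\bigr),$$ $\alpha\cdot\beta=\sum_x\sum_{\mu_1<\cdots<\mu_r}\alpha_{x,\mu_1\cdots\mu_r}\beta_{x,\mu_1\cdots\mu_r}$, $\alpha^2=\alpha\cdot\alpha$, the cup product of a $p$-form and a $q$-form $$(\alpha\cup\beta)_{x,\mu_1\cdots\mu_{p+q}}=\tfrac1{p!\,q!}\sum_{\sigma\in\mathfrak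 S_{p+q}}\epsilon_\sigma\,\alpha_{x,\mu_{\sigma(1)}\cdots\mu_{\sigma(p)}}\,\beta_{x+\sum_{i\le p}\hat\mu_{\sigma(i)},\,\mu_{\sigma(p+1)}\cdots\mu_{\sigma(p+q)}},$$ and $$(\alpha\cup_1\beta)_{x,\mu_1\cdots\mu_{p+q-1}}=(-1)^q\sum_{a}(-1)^aP_{\mu_a}\bigl(P_{\mu_a}\iota_{\mu_a}\alpha\cup P_{\mu_a}\iota_{\mu_a}\beta\bigr)_{x,\mu_1\cdots\mathring\mu_a\cdots\mu_{p+q-1}}\quad(\mu_1<\cdots<\mu_{p+q-1}),$$ where $\iota_\mu$ inserts $\mu$ as first index and $P_\mu$ is the pull-back by the reflection of the coordinates $x_\mu,\dots,x_4$, i.e. $(P_\mu\alpha)_{x,\mu_1\cdots\mu_r}=(-1)^{\#\{i:\mu_i\ge\mu\}}\alpha_{P_\mu x-\sum_{\mu_i\ge\mu}\hat\mu_i,\,\mu_1\cdots\mu_r}$ for $\mu_1<\cdots<\mu_r$. Sums $\sum_x$ of $4$-forms are over the component $1234$. Let $P_\partial$ be the orthogonal projection of real $2$-forms onto $\operatorname{Im}\partial$.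 Let $\beta>0$, $\theta\in\mathbb R$ and $p,q_e,q_m\in\mathbb Z$. For a real $1$-form $A^e$, a real $3$-form $A^m$ and an integer $2$-form $n$ put $F^e=dA^e+2\pi n$, $\mathfrak P(n)=\sum_x(n\cup n+n\cup_1dn)$, $$Q=\sum_x\Bigl(\tfrac1{8\pi^2}F^e\cup F^e+\tfrac1{4\pi}F^e\cup_1dn\Bigr),\quad \tilde Q=\sum_x\Bigl(\tfrac1{8\pi^2}F^e\cup F^e-\tfrac1{4\pi}F^e\cup_1dn\Bigr),\quad Q_0=\tfrac1{8\pi^2}\sum_xF^e\cup F^e .$$ Define $\tilde A^m$ on the links of the dual lattice by $A^m_{x,\mu\nu\rho}=\sum_\sigma\epsilon_{\mu\nu\rho\sigma}\tilde A^m_{F(x)-\hat\sigma,\sigma}$. A contour $\gamma$ is a finite list of oriented links, $\dot\gamma_{x,\mu}$ is the net number of times that it runs through the link from $x$ to $x+\hat\mu$, $W_e^{q}(\gamma)=\prod_{l\in\gamma}e^{iqA^e_l}$ and $W_m^{q}(\tilde\gamma)=\prod_{l\in\tilde\gamma}e^{iq\tilde A^m_l}$ (with $A_{x,-\mu}=-A_{x-\hat\mu,\mu}$).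 The dyonic loop and the dual dyonic loop (opposite framing) are $$W_d^{(q_e,q_m)}(\gamma)=W_e^{q_e}(\gamma)\,W_m^{q_m}(F\gamma),\qquad \tilde W_d^{(q_e,q_m)}(\gamma)=W_e^{q_e}(\gamma)\,W_m^{q_m}(\tilde F\gamma).$$ With $DA=\prod\frac{dA}{2\pi}$ over components in $[-\pi,\pi)$ and $Z[\beta,\theta]=\int DA^e\sum_n e^{-\frac\beta2(F^e)^2-i\theta Q_0}\,\delta_{dn,0}$, set $$\langle W_d^{(q_e,q_m)}(\gamma)\rangle^p_{\beta,\theta}=\frac1{Z[\beta,\theta]}\int DA^e\int DA^m\sum_n e^{-\frac\beta2(F^e)^2-i\theta Q+\frac i{2\pi}\partial A^m\cdot F^e-ip\pi\mathfrak P(n)}\,W_d^{(q_e,q_m)}(\gamma),$$ and define $\langle\tilde W_d^{(q_e,q_m)}(\gamma)\rangle^p_{\beta,\theta}$ in the same way, with $\tilde Q$ in place of $Q$. For the contour $F\gamma$ on $\tilde\Lambda$ the theory is the same theory placed on $\tilde\Lambda$. Let $\gamma$ be a contour on $\Lambda$ and let $l$ be an integer $2$-form with $\sum_{\nu<\rho<\sigma}\epsilon_{\mu\nu\rho\sigma}(dl)_{x+\hat\mu,\nu\rho\sigma}=-\dot\gamma_{x,\mu}$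 for all $x,\mu$ (so $\gamma$ is closed and bounds a surface, to which $l$ is dual). Put $u=\sum_xP_\partial l\cup_1dP_\partial l\in\mathbb R$ and $v=\mathfrak P(l)\in\mathbb Z$. **Lemma (Flipping framings).** (1) $$\langle\tilde W_d^{(q_e,q_m)}(F\gamma)\rangle^p_{\beta,\theta}=\langle W_d^{(q_e,q_m)}(\gamma)\rangle^p_{\beta,\theta}\;\exp\Bigl(2\pi iu\bigl(q_e+\tfrac{\theta}{2\pi}q_m\bigr)q_m\Bigr).$$ (2) This relation is described by alternating Poisson summation $\mathcal P$ and $\mathcal T$ three times, in the following sense. Consider expressions $c\,\langle W_d^{(q_e,q_m)}(\gamma)\rangle^p_{\beta,\theta}$ and $c\,\langle\tilde W_d^{(q_e,q_m)}(F\gamma)\rangle^p_{\beta,\theta}$ with $c\in\mathbb C$. Put $\tilde\beta=\beta/((2\pi\beta)^2+(\frac\theta{2\pi})^2)$, $\tilde\theta=-\theta/((2\pi\beta)^2+(\frac\theta{2\pi})^2)$. Let $\mathcal P$ exchange $W_d(\gamma)$ and $\tilde W_d(F\gamma)$, replace $(q_e,q_m)$ by $(q_m,-q_e)$ and $(\beta,\theta)$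 by $(\tilde\beta,\tilde\theta)$, and multiply $c$ by $\exp(\mp\frac i2\theta uq_m^2\mp\frac i2\tilde\theta uq_e^2-ip\pi v(q_m^2+q_e^2))$ (upper sign if the expression it is applied to contains $W_d$, lower sign if it contains $\tilde W_d$). Let $\mathcal T$ keep the type of the loop and $\beta$, replace $(q_e,q_m)$ by $(q_e-q_m,q_m)$ and $\theta$ by $\theta+2\pi$, and multiply $c$ by $(-1)^{q_m^2v}$. Then, starting from $\langle W_d^{(q_e,q_m)}(\gamma)\rangle^p_{\beta,\theta}$ and applying $\mathcal P,\mathcal T,\mathcal P,\mathcal T,\mathcal P,\mathcal T$ in this order, none of the six steps changes the value of the expression; the result is $\exp\bigl(-2\pi iu(q_e+\frac\theta{2\pi}q_m)q_m\bigr)\,\langle\tilde W_d^{(-q_e,-q_m)}(F\gamma)\rangle^p_{\beta,\theta}$; and $\langle\tilde W_d^{(-q_e,-q_m)}(F\gamma)\rangle^p_{\beta,\theta}=\langle\tilde W_d^{(q_e,q_m)}(F\gamma)\rangle^p_{\beta,\theta}$. -/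

import Mathlib

/-!
# Lattice Maxwell theory in the modified Villain formulation, with dyonic Wilson loops

The primal lattice `Λ` is the periodic hypercubic lattice `(ℤ/N)⁴`; the dual lattice is
`Λ̃ = Λ + ŝ/2` with `ŝ = 1̂ + 2̂ + 3̂ + 4̂`.  Directions are `0, 1, 2, 3 : Fin 4`.
-/

open MeasureTheory

noncomputable section

namespace LatticeMaxwell

/-! ### Lattices and sites -/

/-- The two lattices: the primal lattice `Λ` and the dual lattice `Λ̃ = Λ + ŝ/2`. -/
inductive Lattice where
  | primal
  | dual

/-- Passing to the dual lattice. (The dual of `Λ̃` is `Λ̃ + ŝ/2 = Λ`.) -/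
def Lattice.flip : Lattice → Lattice
  | .primal => .dual
  | .dual => .primal

/-- A site of a lattice. On the primal lattice the site with coordinates `c` is the point `c`,
on the dual lattice it is the point `c + ŝ/2`. -/
@[ext] structure Site (N : ℕ) (L : Lattice) where
  coord : Fin 4 → ZMod N

instance (N : ℕ) (L : Lattice) : DecidableEq (Site N L) := fun x y =>
  decidable_of_iff (x.coord = y.coord) (Site.ext_iff).symm

/-- Sites are described by their coordinates. -/
def Site.equivCoord (N : ℕ) (L : Lattice) : Site N L ≃ (Fin 4 → ZMod N) where
  toFun x := x.coord
  invFun c := ⟨c⟩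
  left_inv _ := rfl
  right_inv _ := rfl

instance (N : ℕ) [NeZero N] (L : Lattice) : Fintype (Site N L) :=
  Fintype.ofEquiv _ (Site.equivCoord N L).symm

/-- The translate `x + v` of a site by an integer vector. -/
def Site.shift {N : ℕ} {L : Lattice} (x : Site N L) (v : Fin 4 → ZMod N) : Site N L :=
  ⟨x.coord + v⟩

/-- The vector `∑_{μ ∈ S} μ̂`. In particular `vec {μ} = μ̂` and `vec univ = ŝ`. -/
def vec {N : ℕ} (S : Finset (Fin 4)) : Fin 4 → ZMod N := fun μ => if μ ∈ S then 1 else 0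

/-- The carry in the coordinates when `ŝ/2` is added to a site: the point `c + ŝ/2` of the dual
lattice has coordinates `c`, and `(c + ŝ/2) + ŝ/2` is the point `c + ŝ` of the primal lattice. -/
def halfCarry (N : ℕ) : Lattice → (Fin 4 → ZMod N)
  | .primal => 0
  | .dual => vec Finset.univ

/-- The map `F x = x + ŝ/2` from a lattice onto its dual lattice. -/
def Site.F {N : ℕ} {L : Lattice} : Site N L ≃ Site N L.flip where
  toFun x := ⟨x.coord + halfCarry N L⟩
  invFun y := ⟨y.coord - halfCarry N L⟩
  left_inv x := by ext; simp
  right_inv y := by ext; simp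

/-- The map `F̃ x = x - ŝ/2 = F (x - ŝ)`. -/
def Site.Ft {N : ℕ} {L : Lattice} (x : Site N L) : Site N L.flip :=
  Site.F (x.shift (-vec Finset.univ))

/-! ### Differential forms -/

/-- An `r`-cell `(x, μ₁ < ⋯ < μᵣ)`; the increasing sequence of directions is given by the set
of its terms. -/
abbrev Cell (N : ℕ) (L : Lattice) (r : ℕ) : Type :=
  Site N L × {S : Finset (Fin 4) // S.card = r}

/-- `K`-valued `r`-forms, given by their independent components `α_{x, μ₁ ⋯ μᵣ}`,
`μ₁ < ⋯ < μᵣ`. -/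
abbrev Form (N : ℕ) (L : Lattice) (r : ℕ) (K : Type) : Type := Cell N L r → K

/-- The sign `ε` of the permutation that sorts the sequence which lists first `S` in increasing
order and then `T` in increasing order (for disjoint `S` and `T`). -/
def shuffleSign (K : Type) [CommRing K] (S T : Finset (Fin 4)) : K :=
  (-1) ^ ((S ×ˢ T).filter fun ab => ab.2 < ab.1).card

section Forms

variable {N : ℕ} {L : Lattice} {r : ℕ} {K : Type} [CommRing K]

/-- The component `α_{x, μ₁ ⋯ μᵣ}` with `S = {μ₁ < ⋯ < μᵣ}` (zero if `S` does not have `r`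
elements). -/
def Form.coeff (α : Form N L r K) (x : Site N L) (S : Finset (Fin 4)) : K :=
  if h : S.card = r then α (x, ⟨S, h⟩) else 0

/-- The exterior derivative
`(dα)_{x, μ₁⋯μᵣ₊₁} = ∑ⱼ (-1)^{j+1} (α_{x+μ̂ⱼ, ⋯μ̊ⱼ⋯} - α_{x, ⋯μ̊ⱼ⋯})`. -/
def extDeriv (α : Form N L r K) : Form N L (r + 1) K := fun c =>
  ∑ μ ∈ c.2.1, shuffleSign K {μ} (c.2.1.erase μ) *
    (α.coeff (c.1.shift (vec {μ})) (c.2.1.erase μ) - α.coeff c.1 (c.2.1.erase μ))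

/-- The boundary operator
`(∂α)_{x, μ₁⋯μᵣ} = ∑_ν (α_{x, μ₁⋯μᵣν} - α_{x-ν̂, μ₁⋯μᵣν})`. -/
def bdry (α : Form N L (r + 1) K) : Form N L r K := fun c =>
  ∑ ν ∈ c.2.1ᶜ, shuffleSign K c.2.1 {ν} *
    (α.coeff c.1 (insert ν c.2.1) - α.coeff (c.1.shift (-vec {ν})) (insert ν c.2.1))

/-- The cup product. The antisymmetrized sum over all permutations, divided by `p! q!`, is the
sum over the ways to split the set of directions into a set `T` of `p` directions (for `α`) and
its complement (for `β`). -/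
def cup {p q : ℕ} (α : Form N L p K) (β : Form N L q K) : Form N L (p + q) K := fun c =>
  ∑ T ∈ c.2.1.powersetCard p, shuffleSign K T (c.2.1 \ T) *
    (α.coeff c.1 T * β.coeff (c.1.shift (vec T)) (c.2.1 \ T))

/-- The interior product `(ι_a α)_{x, μ₁⋯μᵣ} = α_{x, a μ₁⋯μᵣ}` (zero if `a` is one of the
`μᵢ`). -/
def interiorProd (a : Fin 4) (α : Form N L (r + 1) K) : Form N L r K := fun c =>
  shuffleSign K {a} c.2.1 * α.coeff c.1 (insert a c.2.1)

/-- The reflection `x ↦ (x₁, …, x_{a-1}, -x_a, …, -x₄)` of the sites, about the origin of the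
lattice under consideration. -/
def Site.reflect (a : Fin 4) (x : Site N L) : Site N L :=
  ⟨fun μ => if μ < a then x.coord μ else -x.coord μ⟩

/-- The parity transformation `P_a` of forms,
`(P_a α)_{x, μ₁⋯μᵣ} = (-1)^{#{i | a ≤ μᵢ}} α_{P_a x - ∑_{a ≤ μᵢ} μ̂ᵢ, μ₁⋯μᵣ}`. -/
def parity (a : Fin 4) (α : Form N L r K) : Form N L r K := fun c =>
  (-1) ^ (c.2.1.filter fun b => a ≤ b).card *
    α.coeff ((c.1.reflect a).shift (-vec (c.2.1.filter fun b => a ≤ b))) c.2.1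

/-- The higher cup product `∪₁` of a `(p+1)`-form and a `(q+1)`-form:
`(α ∪₁ β)_{x, μ₁⋯} = (-1)^{q+1} ∑ₐ (-1)^a P_{μₐ}(P_{μₐ} ι_{μₐ} α ∪ P_{μₐ} ι_{μₐ} β)_{x, ⋯μ̊ₐ⋯}`,
where `a = 1, 2, …` is the position of `μₐ` among the directions of the cell. -/
def cupOne {p q : ℕ} (α : Form N L (p + 1) K) (β : Form N L (q + 1) K) :
    Form N L (p + q + 1) K := fun c =>
  (-1) ^ (q + 1) * ∑ μ ∈ c.2.1, (-1) ^ ((c.2.1.filter fun b => b < μ).card + 1) *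
    (parity μ (cup (parity μ (interiorProd μ α)) (parity μ (interiorProd μ β)))).coeff c.1
      (c.2.1.erase μ)

variable [NeZero N]

/-- The sum `∑ₓ αₓ` of a `4`-form over the lattice. -/
def total (α : Form N L 4 K) : K := ∑ c, α c

/-- The inner product `α · β` of two `r`-forms. -/
def dot (α β : Form N L r K) : K := ∑ c, α c * β c

/-- The Pontryagin square `𝔓(n) = ∑ₓ (n ∪ n + n ∪₁ dn)`. -/
def pontryagin (n : Form N L 2 K) : K := total (cup n n) + total (cupOne n (extDeriv n))

end Forms

/-- The real form underlying an integer form. -/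
def Form.toReal {N : ℕ} {L : Lattice} {r : ℕ} (n : Form N L r ℤ) : Form N L r ℝ :=
  fun c => (n c : ℝ)

section Theory

variable {N : ℕ} [NeZero N] {L : Lattice}

/-- The projection `P_∂` of real `2`-forms onto `Im ∂⁽³⁾`, orthogonal for the inner product
`α · β`. -/
def projBdry (α : Form N L 2 ℝ) : Form N L 2 ℝ :=
  WithLp.ofLp ((Submodule.span ℝ (Set.range fun β : Form N L 3 ℝ =>
    (WithLp.toLp 2 (bdry β) : EuclideanSpace ℝ (Cell N L 2)))).starProjection (WithLp.toLp 2 α))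

/-- `u = ∑ₓ P_∂ l ∪₁ d P_∂ l`. -/
def uOf (l : Form N L 2 ℤ) : ℝ :=
  total (cupOne (projBdry l.toReal) (extDeriv (projBdry l.toReal)))

/-- `v = 𝔓(l)`. -/
def vOf (l : Form N L 2 ℤ) : ℤ := pontryagin l

/-! ### Action, measures and partition function -/

/-- The field strength `Fᵉ = dAᵉ + 2π n`. -/
def fieldStrength (A : Form N L 1 ℝ) (n : Form N L 2 ℤ) : Form N L 2 ℝ :=
  fun c => extDeriv A c + 2 * Real.pi * n c

/-- `Q₀ = (1/8π²) ∑ₓ F ∪ F`. -/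
def chargeZero (F : Form N L 2 ℝ) : ℝ := 1 / (8 * Real.pi ^ 2) * total (cup F F)

/-- The topological charge `Q = ∑ₓ ((1/8π²) Fᵉ ∪ Fᵉ + (1/4π) Fᵉ ∪₁ dn)`. -/
def charge (A : Form N L 1 ℝ) (n : Form N L 2 ℤ) : ℝ :=
  1 / (8 * Real.pi ^ 2) * total (cup (fieldStrength A n) (fieldStrength A n)) +
    1 / (4 * Real.pi) * total (cupOne (fieldStrength A n) (extDeriv n.toReal))

/-- The topological charge `Q̃ = ∑ₓ ((1/8π²) Fᵉ ∪ Fᵉ - (1/4π) Fᵉ ∪₁ dn)`. -/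
def chargeTilde (A : Form N L 1 ℝ) (n : Form N L 2 ℤ) : ℝ :=
  1 / (8 * Real.pi ^ 2) * total (cup (fieldStrength A n) (fieldStrength A n)) -
    1 / (4 * Real.pi) * total (cupOne (fieldStrength A n) (extDeriv n.toReal))

/-- The measure `DA = ∏ dA_c / 2π` on compact `r`-forms, each component in `[-π, π)`. -/
def gaugeMeasure (N : ℕ) [NeZero N] (L : Lattice) (r : ℕ) : Measure (Form N L r ℝ) :=
  Measure.pi fun _ => (2 * NNReal.pi)⁻¹ • volume.restrict (Set.Ico (-Real.pi) Real.pi)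

open Classical in
/-- The partition function
`Z[β, θ] = ∫ DAᵉ ∑ₙ exp(-(β/2)(Fᵉ)² - iθ Q₀[Fᵉ]) ∏ δ(dn)`. -/
def partitionFunction (N : ℕ) [NeZero N] (L : Lattice) (β θ : ℝ) : ℂ :=
  ∫ A, ∑' n : Form N L 2 ℤ,
    (if extDeriv n = 0 then
      Complex.exp (-(β / 2 : ℝ) * (dot (fieldStrength A n) (fieldStrength A n) : ℝ)
        - Complex.I * θ * (chargeZero (fieldStrength A n) : ℝ))
    else 0) ∂(gaugeMeasure N L 1)

/-- The weight `exp(-(β/2)(Fᵉ)² - iθ Q + (i/2π) ∂Aᵐ·Fᵉ - ipπ 𝔓(n))`, where `Q` is the value of the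
topological charge that is used. -/
def boltzmann (β θ : ℝ) (p : ℤ) (Q : ℝ) (Ae : Form N L 1 ℝ) (Am : Form N L 3 ℝ)
    (n : Form N L 2 ℤ) : ℂ :=
  Complex.exp (-(β / 2 : ℝ) * (dot (fieldStrength Ae n) (fieldStrength Ae n) : ℝ)
    - Complex.I * θ * Q
    + Complex.I / (2 * Real.pi) * (dot (bdry Am) (fieldStrength Ae n) : ℝ)
    - Complex.I * p * Real.pi * (pontryagin n : ℤ))

/-! ### Wilson loops -/

/-- An oriented link: `(x, +μ)` from `x` to `x + μ̂`, or (`positive = false`) `(x, -μ)` from `x`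
to `x - μ̂`. -/
structure OrientedLink (N : ℕ) (L : Lattice) where
  site : Site N L
  dir : Fin 4
  positive : Bool
deriving DecidableEq

/-- A contour, given by the oriented links it consists of. -/
abbrev Contour (N : ℕ) (L : Lattice) : Type := List (OrientedLink N L)

/-- The image `F(γ)` of a contour under `F x = x + ŝ/2`. -/
def Contour.F (γ : Contour N L) : Contour N L.flip :=
  γ.map fun b => ⟨b.site.F, b.dir, b.positive⟩

/-- The image `F̃(γ)` of a contour under `F̃ x = x - ŝ/2`. -/
def Contour.Ft (γ : Contour N L) : Contour N L.flip :=
  γ.map fun b => ⟨b.site.Ft, b.dir, b.positive⟩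

/-- The tangent `γ̇`: the number of times that `γ` runs through the link from `x` to `x + μ̂` in
the positive direction minus the number of times in the negative direction. -/
def Contour.tangent (γ : Contour N L) (x : Site N L) (μ : Fin 4) : ℤ :=
  (γ.count ⟨x, μ, true⟩ : ℤ) - (γ.count ⟨x.shift (vec {μ}), μ, false⟩ : ℤ)

/-- The value of a gauge field on an oriented link; `A_{x,-μ} = -A_{x-μ̂,μ}`. -/
def linkValue (A : Form N L 1 ℝ) (b : OrientedLink N L) : ℝ :=
  if b.positive then A.coeff b.site {b.dir} else -A.coeff (b.site.shift (-vec {b.dir})) {b.dir}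

/-- The Wilson loop `∏_{l ∈ γ} exp(i q A_l)` of charge `q`. -/
def wilson (q : ℤ) (A : Form N L 1 ℝ) (γ : Contour N L) : ℂ :=
  (γ.map fun b => Complex.exp (Complex.I * q * (linkValue A b : ℝ))).prod

/-- The magnetic gauge field `Ãᵐ` on the links of the dual lattice, which is determined by
`Aᵐ_{x, μνρ} = ∑_σ ε_{μνρσ} Ãᵐ_{F(x)-σ̂, σ}`. -/
def magneticField (Am : Form N L 3 ℝ) : Form N L.flip 1 ℝ := fun c =>
  ∑ σ ∈ c.2.1, shuffleSign ℝ {σ}ᶜ {σ} * Am.coeff ((Site.F.symm c.1).shift (vec {σ})) {σ}ᶜ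

/-- The dyonic Wilson loop `W_d(γ) = W_e(γ) W_m(F(γ))`. -/
def dyonicLoop (qe qm : ℤ) (γ : Contour N L) (Ae : Form N L 1 ℝ) (Am : Form N L 3 ℝ) : ℂ :=
  wilson qe Ae γ * wilson qm (magneticField Am) γ.F

/-- The dual dyonic Wilson loop `W̃_d(γ) = W_e(γ) W_m(F̃(γ))`. -/
def dualDyonicLoop (qe qm : ℤ) (γ : Contour N L) (Ae : Form N L 1 ℝ) (Am : Form N L 3 ℝ) : ℂ :=
  wilson qe Ae γ * wilson qm (magneticField Am) γ.Ft

/-- The expectation value `⟨W_d^{(q_e,q_m)}(γ)⟩_{β,θ}^p`, in the theory with the topological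
charge `Q` on the lattice on which `γ` lies. -/
def evDyonic (β θ : ℝ) (p qe qm : ℤ) (γ : Contour N L) : ℂ :=
  (∫ Ae, ∫ Am, ∑' n : Form N L 2 ℤ,
    boltzmann β θ p (charge Ae n) Ae Am n * dyonicLoop qe qm γ Ae Am
      ∂(gaugeMeasure N L 3) ∂(gaugeMeasure N L 1)) / partitionFunction N L β θ

/-- The expectation value `⟨W̃_d^{(q_e,q_m)}(γ)⟩_{β,θ}^p`, in the theory with the topological
charge `Q̃` on the lattice on which `γ` lies. -/
def evDualDyonic (β θ : ℝ) (p qe qm : ℤ) (γ : Contour N L) : ℂ :=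
  (∫ Ae, ∫ Am, ∑' n : Form N L 2 ℤ,
    boltzmann β θ p (chargeTilde Ae n) Ae Am n * dualDyonicLoop qe qm γ Ae Am
      ∂(gaugeMeasure N L 3) ∂(gaugeMeasure N L 1)) / partitionFunction N L β θ

/-- `l` solves the monopole equation `∑_{ν<ρ<σ} ε_{μνρσ} (dl)_{x+μ̂, νρσ} = -γ̇_{x,μ}` for the
contour `γ`, i.e. `l` is dual to a surface with boundary `γ`. -/
def IsSeifert (l : Form N L 2 ℤ) (γ : Contour N L) : Prop :=
  ∀ (x : Site N L) (μ : Fin 4),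
    shuffleSign ℤ {μ} {μ}ᶜ * (extDeriv l).coeff (x.shift (vec {μ})) {μ}ᶜ = -γ.tangent x μ

/-! ### The transformations `𝒫` (Poisson summation) and `𝒯` -/

end Theory

/-- An expression `c · ⟨W_d^{(q_e,q_m)}(γ)⟩_{β,θ}^p` (`framed = true`) or
`c · ⟨W̃_d^{(q_e,q_m)}(Fγ)⟩_{β,θ}^p` (`framed = false`), for fixed `γ` and `p`. -/
@[ext] structure LoopExpr where
  framed : Bool
  qe : ℤ
  qm : ℤ
  β : ℝ
  θ : ℝ
  c : ℂ

/-- The value of an expression; `W̃_d(Fγ)` lives in the theory on the dual lattice. -/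
def LoopExpr.value {N : ℕ} [NeZero N] (γ : Contour N .primal) (p : ℤ) (s : LoopExpr) : ℂ :=
  if s.framed then s.c * evDyonic s.β s.θ p s.qe s.qm γ
  else s.c * evDualDyonic s.β s.θ p s.qe s.qm γ.F

/-- `β̃ = β / ((2πβ)² + (θ/2π)²)`. -/
def dualBeta (β θ : ℝ) : ℝ := β / ((2 * Real.pi * β) ^ 2 + (θ / (2 * Real.pi)) ^ 2)

/-- `θ̃ = -θ / ((2πβ)² + (θ/2π)²)`. -/
def dualTheta (β θ : ℝ) : ℝ := -θ / ((2 * Real.pi * β) ^ 2 + (θ / (2 * Real.pi)) ^ 2)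

/-- The rewriting `𝒫` by Poisson summation: it exchanges `W_d(γ)` and `W̃_d(Fγ)`, replaces
`(q_e, q_m)` by `(q_m, -q_e)` and `(β, θ)` by `(β̃, θ̃)`, and produces the factor
`exp(∓iθu q_m²/2 ∓ iθ̃u q_e²/2 - ipπv(q_m² + q_e²))`, with `-` for `W_d` and `+` for `W̃_d`. -/
def LoopExpr.poisson (u : ℝ) (v p : ℤ) (s : LoopExpr) : LoopExpr where
  framed := !s.framed
  qe := s.qm
  qm := -s.qe
  β := dualBeta s.β s.θ
  θ := dualTheta s.β s.θ
  c := s.c * Complex.exp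
    ((if s.framed then -1 else 1) *
        (Complex.I * s.θ * u * s.qm ^ 2 / 2 + Complex.I * dualTheta s.β s.θ * u * s.qe ^ 2 / 2)
      - Complex.I * p * Real.pi * v * (s.qm ^ 2 + s.qe ^ 2))

/-- The rewriting `𝒯`: it replaces `θ` by `θ + 2π` and `(q_e, q_m)` by `(q_e - q_m, q_m)`, and
produces the sign `(-1)^{q_m² v}`. -/
def LoopExpr.shiftTheta (v : ℤ) (s : LoopExpr) : LoopExpr where
  framed := s.framed
  qe := s.qe - s.qm
  qm := s.qm
  β := s.β
  θ := s.θ + 2 * Real.pi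
  c := s.c * (-1) ^ (s.qm ^ 2 * v)

end LatticeMaxwell

end

open LatticeMaxwell

/-!
Integrating out `Aᵐ` forces `dn = q_m dl`, so that `Fᵉ = 2π q_m P_∂ l + f` with `f` closed. Up to an
integral over the exact part of `f`, a Gaussian with imaginary source in which the compactness of
`Aᵉ` and the sum over fluxless `n` combine to an ordinary translation invariance, only the fluxes of
`f` remain. They are summed to a theta function of three pairs of complementary planes. The Gaussian
integral is the same with and without the loop except for the factor `exp(-E (P_∂ l)²)` with the
self-energy `E = |q_e + q_m τ|² / 2β`, `τ = θ / 2π + 2π i β`.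

Poisson summation over the fluxes is `τ ↦ -1 / τ`, the shift of `θ` is `τ ↦ τ + 1`, both with a
change of charges that preserves `E`, and `τ ↦ 1 - 1 / τ` has order three. The framing enters
through the sign of the `∪₁` term of the topological charge, in a phase `exp(∓iθ q_m² u / 2)`, and
through the order of the factors in `∑ P_∂ l ∪ (l - P_∂ l)`, which is paired with `q_e q_m`; since
`∪₁` measures the failure of `∪` to be commutative, the two orders differ by `u` modulo integers.
-/

noncomputable section

namespace LatticeMaxwell

/-! ### Sites and components -/

section Sites

variable {N : ℕ} {L : Lattice}

@[simp] lemma Site.shift_shift (x : Site N L) (v w : Fin 4 → ZMod N) :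
    (x.shift v).shift w = x.shift (v + w) := by
  ext; simp [Site.shift, add_assoc]

@[simp] lemma Site.shift_zero (x : Site N L) : x.shift 0 = x := by
  ext; simp [Site.shift]

/-- Translation by a vector as a permutation of the sites. -/
def Site.shiftEquiv (v : Fin 4 → ZMod N) : Site N L ≃ Site N L where
  toFun x := x.shift v
  invFun x := x.shift (-v)
  left_inv x := by simp
  right_inv x := by simp

lemma sum_shift [NeZero N] {M : Type*} [AddCommMonoid M] (g : Site N L → M)
    (v : Fin 4 → ZMod N) : ∑ x : Site N L, g (x.shift v) = ∑ x, g x :=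
  (Site.shiftEquiv (L := L) v).sum_comp g

lemma vec_union {S T : Finset (Fin 4)} (h : Disjoint S T) :
    (vec (S ∪ T) : Fin 4 → ZMod N) = vec S + vec T := by
  funext μ
  by_cases hS : μ ∈ S
  · simp [vec, hS, Finset.disjoint_left.mp h hS]
  · simp [vec, hS]

lemma vec_insert {μ : Fin 4} {S : Finset (Fin 4)} (h : μ ∉ S) :
    (vec (insert μ S) : Fin 4 → ZMod N) = vec {μ} + vec S := by
  rw [Finset.insert_eq, vec_union (by simpa using h)]

@[simp] lemma vec_empty : (vec ∅ : Fin 4 → ZMod N) = 0 := by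
  funext μ; simp [vec]

end Sites

section Components

variable {N : ℕ} {L : Lattice} {r : ℕ} {K : Type} [CommRing K]

lemma Form.coeff_of_card (α : Form N L r K) (x : Site N L) (S : Finset (Fin 4))
    (h : S.card = r) : α.coeff x S = α (x, ⟨S, h⟩) := dif_pos h

lemma Form.coeff_of_card_ne (α : Form N L r K) (x : Site N L) (S : Finset (Fin 4))
    (h : S.card ≠ r) : α.coeff x S = 0 := dif_neg h

lemma Form.apply_eq_coeff (α : Form N L r K) (c : Cell N L r) : α c = α.coeff c.1 c.2.1 :=
  (α.coeff_of_card c.1 c.2.1 c.2.2).symm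

lemma Form.ext_coeff {α β : Form N L r K}
    (h : ∀ x S, S.card = r → α.coeff x S = β.coeff x S) : α = β := by
  funext c
  rw [α.apply_eq_coeff, β.apply_eq_coeff, h _ _ c.2.2]

@[simp] lemma Form.coeff_add (α β : Form N L r K) (x : Site N L) (S : Finset (Fin 4)) :
    (α + β : Form N L r K).coeff x S = α.coeff x S + β.coeff x S := by
  unfold Form.coeff; split_ifs <;> simp

@[simp] lemma Form.coeff_sub (α β : Form N L r K) (x : Site N L) (S : Finset (Fin 4)) :
    (α - β : Form N L r K).coeff x S = α.coeff x S - β.coeff x S := by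
  unfold Form.coeff; split_ifs <;> simp

@[simp] lemma Form.coeff_smul (a : K) (α : Form N L r K) (x : Site N L) (S : Finset (Fin 4)) :
    (a • α : Form N L r K).coeff x S = a * α.coeff x S := by
  unfold Form.coeff; split_ifs <;> simp

@[simp] lemma Form.coeff_zero (x : Site N L) (S : Finset (Fin 4)) :
    (0 : Form N L r K).coeff x S = 0 := by
  unfold Form.coeff; split_ifs <;> simp

lemma Form.coeff_toReal (n : Form N L r ℤ) (x : Site N L) (S : Finset (Fin 4)) :
    n.toReal.coeff x S = (n.coeff x S : ℝ) := by
  unfold Form.coeff Form.toReal; split_ifs <;> simp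

lemma coeff_extDeriv (α : Form N L r K) (x : Site N L) {S : Finset (Fin 4)}
    (h : S.card = r + 1) : (extDeriv α).coeff x S =
      ∑ μ ∈ S, shuffleSign K {μ} (S.erase μ) *
        (α.coeff (x.shift (vec {μ})) (S.erase μ) - α.coeff x (S.erase μ)) := by
  rw [Form.coeff_of_card _ _ _ h]; rfl

lemma coeff_bdry (α : Form N L (r + 1) K) (x : Site N L) {S : Finset (Fin 4)}
    (h : S.card = r) : (bdry α).coeff x S =
      ∑ ν ∈ Sᶜ, shuffleSign K S {ν} *
        (α.coeff x (insert ν S) - α.coeff (x.shift (-vec {ν})) (insert ν S)) := by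
  rw [Form.coeff_of_card _ _ _ h]; rfl

lemma coeff_cup {p q : ℕ} (α : Form N L p K) (β : Form N L q K) (x : Site N L)
    {S : Finset (Fin 4)} (h : S.card = p + q) : (cup α β).coeff x S =
      ∑ T ∈ S.powersetCard p, shuffleSign K T (S \ T) *
        (α.coeff x T * β.coeff (x.shift (vec T)) (S \ T)) := by
  rw [Form.coeff_of_card _ _ _ h]; rfl

lemma coeff_interiorProd (a : Fin 4) (α : Form N L (r + 1) K) (x : Site N L)
    {S : Finset (Fin 4)} (h : S.card = r) : (interiorProd a α).coeff x S =
      shuffleSign K {a} S * α.coeff x (insert a S) := by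
  rw [Form.coeff_of_card _ _ _ h]; rfl

lemma coeff_parity (a : Fin 4) (α : Form N L r K) (x : Site N L) {S : Finset (Fin 4)}
    (h : S.card = r) : (parity a α).coeff x S =
      (-1) ^ (S.filter fun b => a ≤ b).card *
        α.coeff ((x.reflect a).shift (-vec (S.filter fun b => a ≤ b))) S := by
  rw [Form.coeff_of_card _ _ _ h]; rfl

variable [NeZero N]

lemma sum_cell {M : Type*} [AddCommMonoid M] (g : Site N L → Finset (Fin 4) → M) :
    ∑ c : Cell N L r, g c.1 c.2.1 = ∑ x, ∑ S ∈ Finset.powersetCard r Finset.univ, g x S := by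
  rw [Fintype.sum_prod_type]
  refine Finset.sum_congr rfl fun x _ => ?_
  exact (Finset.sum_subtype _ (fun S => by simp [Finset.mem_powersetCard]) (g x)).symm

lemma total_eq (α : Form N L 4 K) : total α = ∑ x, α.coeff x Finset.univ := by
  have top_cell : Finset.powersetCard 4 (Finset.univ : Finset (Fin 4)) = {Finset.univ} := by
    decide
  simp only [total, Form.apply_eq_coeff α, sum_cell (fun x S => α.coeff x S), top_cell,
    Finset.sum_singleton]

lemma dot_eq (α β : Form N L r K) : dot α β =
    ∑ x, ∑ S ∈ Finset.powersetCard r Finset.univ, α.coeff x S * β.coeff x S := by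
  rw [← sum_cell (r := r) (fun (x : Site N L) S => α.coeff x S * β.coeff x S)]
  simp only [dot, Form.apply_eq_coeff]

end Components

/-! ### Shuffle signs -/

section ShuffleSign

variable {K : Type} [CommRing K]

lemma shuffleSign_eq_prod (S T : Finset (Fin 4)) :
    shuffleSign K S T = ∏ a ∈ S, ∏ b ∈ T, if b < a then -1 else 1 := by
  rw [← Finset.prod_product', Finset.prod_ite, Finset.prod_const_one, mul_one,
    Finset.prod_const, shuffleSign]

lemma shuffleSign_union_left {S S' : Finset (Fin 4)} (h : Disjoint S S') (T : Finset (Fin 4)) :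
    shuffleSign K (S ∪ S') T = shuffleSign K S T * shuffleSign K S' T := by
  simp only [shuffleSign_eq_prod, Finset.prod_union h]

lemma shuffleSign_union_right (S : Finset (Fin 4)) {T T' : Finset (Fin 4)} (h : Disjoint T T') :
    shuffleSign K S (T ∪ T') = shuffleSign K S T * shuffleSign K S T' := by
  simp only [shuffleSign_eq_prod, Finset.prod_union h, Finset.prod_mul_distrib]

lemma shuffleSign_insert_left {a : Fin 4} {S : Finset (Fin 4)} (h : a ∉ S)
    (T : Finset (Fin 4)) :
    shuffleSign K (insert a S) T = shuffleSign K {a} T * shuffleSign K S T := by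
  rw [Finset.insert_eq, shuffleSign_union_left (by simpa using h)]

lemma shuffleSign_insert_right (S : Finset (Fin 4)) {b : Fin 4} {T : Finset (Fin 4)}
    (h : b ∉ T) : shuffleSign K S (insert b T) = shuffleSign K S {b} * shuffleSign K S T := by
  rw [Finset.insert_eq, shuffleSign_union_right _ (by simpa using h)]

lemma shuffleSign_eq_mul_erase_right (S : Finset (Fin 4)) {b : Fin 4} {T : Finset (Fin 4)}
    (h : b ∈ T) : shuffleSign K S T = shuffleSign K S {b} * shuffleSign K S (T.erase b) := by
  rw [← shuffleSign_insert_right _ (Finset.notMem_erase b T), Finset.insert_erase h]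

lemma shuffleSign_mul_self (S T : Finset (Fin 4)) :
    shuffleSign K S T * shuffleSign K S T = 1 := by
  rw [shuffleSign, ← mul_pow, neg_mul_neg, one_mul, one_pow]

lemma shuffleSign_mul_swap {S T : Finset (Fin 4)} (h : Disjoint S T) :
    shuffleSign K S T * shuffleSign K T S = (-1) ^ (S.card * T.card) := by
  rw [shuffleSign_eq_prod S T, shuffleSign_eq_prod T S, Finset.prod_comm (s := T),
    ← Finset.prod_mul_distrib, mul_comm S.card, pow_mul, ← Finset.prod_const]
  refine Finset.prod_congr rfl fun a ha => ?_
  rw [← Finset.prod_mul_distrib, ← Finset.prod_const]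
  refine Finset.prod_congr rfl fun b hb => ?_
  rcases lt_or_gt_of_ne (Finset.disjoint_iff_ne.mp h a ha b hb) with hab | hab <;>
    simp [hab, hab.not_gt]

lemma shuffleSign_swap {S T : Finset (Fin 4)} (h : Disjoint S T) :
    shuffleSign K S T = (-1) ^ (S.card * T.card) * shuffleSign K T S := by
  rw [← shuffleSign_mul_swap h, mul_assoc, shuffleSign_mul_self, mul_one]

lemma shuffleSign_singleton_swap {a : Fin 4} {S : Finset (Fin 4)} (h : a ∉ S) :
    shuffleSign K S {a} = (-1) ^ S.card * shuffleSign K {a} S := by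
  simpa using shuffleSign_swap (K := K) (Finset.disjoint_singleton_right.mpr h)

lemma neg_one_pow_card_filter_lt (a : Fin 4) (S : Finset (Fin 4)) :
    (-1 : K) ^ (S.filter fun b => b < a).card = shuffleSign K {a} S := by
  rw [shuffleSign_eq_prod, Finset.prod_singleton, Finset.prod_ite, Finset.prod_const_one,
    mul_one, Finset.prod_const]

lemma intCast_shuffleSign (S T : Finset (Fin 4)) :
    ((shuffleSign ℤ S T : ℤ) : K) = shuffleSign K S T := by
  simp [shuffleSign]

end ShuffleSign

section Reindexing

variable {ι M : Type*} [DecidableEq ι] [AddCommMonoid M]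

lemma sum_mem_sum_powersetCard_erase (r : ℕ) (S : Finset ι) (g : Finset ι → ι → M) :
    ∑ ν ∈ S, ∑ U ∈ (S.erase ν).powersetCard r, g U ν =
      ∑ U ∈ S.powersetCard r, ∑ ν ∈ S \ U, g U ν := by
  refine Finset.sum_comm' fun ν U => ?_
  simp only [Finset.mem_powersetCard, Finset.subset_erase, Finset.mem_sdiff]
  tauto

lemma sum_powersetCard_succ_sum_mem (r : ℕ) (S : Finset ι) (g : Finset ι → ι → M) :
    ∑ T ∈ S.powersetCard (r + 1), ∑ ν ∈ T, g T ν =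
      ∑ U ∈ S.powersetCard r, ∑ ν ∈ S \ U, g (insert ν U) ν := by
  rw [Finset.sum_sigma', Finset.sum_sigma']
  refine Finset.sum_nbij' (fun z => ⟨z.1.erase z.2, z.2⟩) (fun z => ⟨insert z.2 z.1, z.2⟩)
    ?_ ?_ ?_ ?_ ?_ <;> rintro ⟨T, ν⟩ h <;>
    simp only [Finset.mem_sigma, Finset.mem_powersetCard, Finset.mem_sdiff] at h ⊢
  · exact ⟨⟨(T.erase_subset ν).trans h.1.1, by rw [Finset.card_erase_of_mem h.2, h.1.2]; rfl⟩,
      h.1.1 h.2, T.notMem_erase ν⟩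
  · exact ⟨⟨Finset.insert_subset h.2.1 h.1.1, by rw [Finset.card_insert_of_notMem h.2.2, h.1.2]⟩,
      Finset.mem_insert_self ν T⟩
  · rw [Finset.insert_erase h.2]
  · rw [Finset.erase_insert h.2.2]
  · rw [Finset.insert_erase h.2]

end Reindexing

/-! ### The exterior derivative and the boundary operator -/

section Calculus

variable {N : ℕ} {L : Lattice} {r : ℕ} {K : Type} [CommRing K]

lemma coeff_extDeriv_insert (f : Form N L r K) (x : Site N L) {S : Finset (Fin 4)} {ν : Fin 4}
    (hν : ν ∉ S) (hS : S.card = r) : (extDeriv f).coeff x (insert ν S) =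
      shuffleSign K {ν} S * (f.coeff (x.shift (vec {ν})) S - f.coeff x S) +
        ∑ μ ∈ S, shuffleSign K {μ} (insert ν (S.erase μ)) *
          (f.coeff (x.shift (vec {μ})) (insert ν (S.erase μ)) -
            f.coeff x (insert ν (S.erase μ))) := by
  rw [coeff_extDeriv _ _ (by rw [Finset.card_insert_of_notMem hν, hS]),
    Finset.sum_insert hν, Finset.erase_insert hν]
  congr 1
  refine Finset.sum_congr rfl fun μ hμ => ?_
  rw [Finset.erase_insert_of_ne (ne_of_mem_of_not_mem hμ hν).symm]

lemma coeff_bdry_erase (f : Form N L (r + 1) K) (x : Site N L) {S : Finset (Fin 4)} {μ : Fin 4}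
    (hμ : μ ∈ S) (hS : S.card = r + 1) : (bdry f).coeff x (S.erase μ) =
      shuffleSign K (S.erase μ) {μ} * (f.coeff x S - f.coeff (x.shift (-vec {μ})) S) +
        ∑ ν ∈ Sᶜ, shuffleSign K (S.erase μ) {ν} * (f.coeff x (insert ν (S.erase μ)) -
          f.coeff (x.shift (-vec {ν})) (insert ν (S.erase μ))) := by
  rw [coeff_bdry _ _ (by rw [Finset.card_erase_of_mem hμ, hS]; rfl), Finset.compl_erase,
    Finset.sum_insert (by simpa using hμ), Finset.insert_erase hμ]

lemma extDeriv_extDeriv (f : Form N L r K) : extDeriv (extDeriv f) = 0 := by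
  refine Form.ext_coeff fun x S hS => ?_
  rw [Form.coeff_zero, coeff_extDeriv _ _ hS, Finset.sum_congr rfl fun μ hμ => by
    rw [coeff_extDeriv _ _ (by rw [Finset.card_erase_of_mem hμ, hS]; rfl),
      coeff_extDeriv _ _ (by rw [Finset.card_erase_of_mem hμ, hS]; rfl),
      ← Finset.sum_sub_distrib, Finset.mul_sum], Finset.sum_sigma']
  refine Finset.sum_involution (fun z _ => ⟨z.2, z.1⟩) ?_ ?_ ?_ (fun _ _ => rfl) <;>
    rintro ⟨μ, ν⟩ h <;> obtain ⟨hμ, hνμ, hν⟩ : μ ∈ S ∧ ν ≠ μ ∧ ν ∈ S := by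
      simpa only [Finset.mem_sigma, Finset.mem_erase] using h
  · set R := (S.erase μ).erase ν with hR
    have erase_μ : S.erase μ = insert ν R :=
      (Finset.insert_erase (Finset.mem_erase.mpr ⟨hνμ, hν⟩)).symm
    have erase_ν : S.erase ν = insert μ R := by
      rw [hR, Finset.erase_right_comm,
        Finset.insert_erase (Finset.mem_erase.mpr ⟨hνμ.symm, hμ⟩)]
    have notMem_μ : μ ∉ R := fun h => Finset.notMem_erase μ S (Finset.mem_of_mem_erase h)
    have notMem_ν : ν ∉ R := Finset.notMem_erase _ _
    have swap : shuffleSign K {μ} {ν} = -shuffleSign K {ν} {μ} := by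
      simpa using shuffleSign_swap (K := K) (Finset.disjoint_singleton.mpr hνμ.symm)
    simp only [Site.shift_shift, erase_ν, Finset.erase_insert notMem_μ]
    rw [erase_μ, shuffleSign_insert_right _ notMem_μ, shuffleSign_insert_right _ notMem_ν, swap,
      add_comm (vec {ν}) (vec {μ})]
    ring
  · exact fun _ hz => hνμ (congrArg Sigma.fst hz)
  · simpa only [Finset.mem_sigma, Finset.mem_erase] using ⟨hν, hνμ.symm, hμ⟩

lemma shuffleSign_mul_shuffleSign_insert_erase {S : Finset (Fin 4)} {μ ν : Fin 4} (hμ : μ ∈ S)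
    (hν : ν ∉ S) : shuffleSign K S {ν} * shuffleSign K {μ} (insert ν (S.erase μ)) =
      shuffleSign K {μ} (S.erase μ) * shuffleSign K (S.erase μ) {ν} := by
  rw [shuffleSign_insert_right _ fun h => hν (Finset.mem_of_mem_erase h)]
  nth_rewrite 1 [← Finset.insert_erase hμ]
  rw [shuffleSign_insert_left (Finset.notMem_erase μ S)]
  linear_combination (shuffleSign K (S.erase μ) {ν} * shuffleSign K {μ} (S.erase μ)) *
    shuffleSign_mul_self (K := K) {μ} {ν}

/-- The lattice Hodge Laplacian acts componentwise: the terms of `∂d` and `d∂` that mix two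
directions are the same, and only second differences in a single direction remain. -/
lemma coeff_bdry_extDeriv_sub_extDeriv_bdry (f : Form N L (r + 1) K) (x : Site N L)
    {S : Finset (Fin 4)} (hS : S.card = r + 1) :
    (bdry (extDeriv f)).coeff x S - (extDeriv (bdry f)).coeff x S = (-1) ^ (r + 1) *
      ∑ μ, (f.coeff (x.shift (vec {μ})) S - 2 * f.coeff x S + f.coeff (x.shift (-vec {μ})) S) := by
  set Δ : Fin 4 → K := fun μ =>
    f.coeff (x.shift (vec {μ})) S - 2 * f.coeff x S + f.coeff (x.shift (-vec {μ})) S with hΔ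
  set mixed : Fin 4 → Fin 4 → K := fun μ ν => shuffleSign K {μ} (S.erase μ) *
    shuffleSign K (S.erase μ) {ν} *
      (f.coeff (x.shift (vec {μ})) (insert ν (S.erase μ)) - f.coeff x (insert ν (S.erase μ)) -
        f.coeff (x.shift (-vec {ν} + vec {μ})) (insert ν (S.erase μ)) +
        f.coeff (x.shift (-vec {ν})) (insert ν (S.erase μ))) with hmixed
  have bdry_extDeriv : (bdry (extDeriv f)).coeff x S =
      ∑ ν ∈ Sᶜ, ((-1) ^ (r + 1) * Δ ν + ∑ μ ∈ S, mixed μ ν) := by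
    rw [coeff_bdry _ _ hS]
    refine Finset.sum_congr rfl fun ν hν => ?_
    have hνS : ν ∉ S := Finset.mem_compl.mp hν
    have swap := shuffleSign_singleton_swap (K := K) hνS
    rw [coeff_extDeriv_insert _ _ hνS hS, coeff_extDeriv_insert _ _ hνS hS, add_sub_add_comm,
      ← Finset.sum_sub_distrib, mul_add, Finset.mul_sum]
    congr 1
    · rw [swap, hS, hΔ, Site.shift_shift, neg_add_cancel, Site.shift_zero]
      linear_combination (-1) ^ (r + 1) * Δ ν * shuffleSign_mul_self (K := K) {ν} S
    · refine Finset.sum_congr rfl fun μ hμ => ?_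
      simp only [hmixed, ← shuffleSign_mul_shuffleSign_insert_erase hμ hνS, Site.shift_shift]
      ring
  have extDeriv_bdry : (extDeriv (bdry f)).coeff x S =
      ∑ μ ∈ S, ((-1) ^ r * Δ μ + ∑ ν ∈ Sᶜ, mixed μ ν) := by
    rw [coeff_extDeriv _ _ hS]
    refine Finset.sum_congr rfl fun μ hμ => ?_
    have swap := shuffleSign_singleton_swap (K := K) (Finset.notMem_erase μ S)
    rw [Finset.card_erase_of_mem hμ, hS, Nat.add_sub_cancel] at swap
    rw [coeff_bdry_erase _ _ hμ hS, coeff_bdry_erase _ _ hμ hS, add_sub_add_comm,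
      ← Finset.sum_sub_distrib, mul_add, Finset.mul_sum]
    congr 1
    · rw [swap, hΔ, Site.shift_shift, add_neg_cancel, Site.shift_zero]
      linear_combination (-1) ^ r * Δ μ * shuffleSign_mul_self (K := K) {μ} (S.erase μ)
    · refine Finset.sum_congr rfl fun ν _ => ?_
      simp only [hmixed, Site.shift_shift, add_comm (vec {μ})]
      ring
  rw [bdry_extDeriv, extDeriv_bdry, Finset.sum_add_distrib, Finset.sum_add_distrib,
    Finset.sum_comm, ← Finset.sum_add_sum_compl S, ← Finset.mul_sum, ← Finset.mul_sum]
  ring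

end Calculus

section Correlation

variable {N : ℕ} [NeZero N] {L : Lattice} {p q : ℕ} {K : Type} [CommRing K]

/-- The correlation `∑ₓ f_{x,U} g_{x+w,V}` of two components at distance `w`. Since the lattice is
periodic, every sum over `x` of products of components is of this kind. -/
def correlation (f : Form N L p K) (g : Form N L q K) (U V : Finset (Fin 4))
    (w : Fin 4 → ZMod N) : K :=
  ∑ x, f.coeff x U * g.coeff (x.shift w) V

lemma sum_coeff_shift_mul_coeff_shift (f : Form N L p K) (g : Form N L q K)
    (U V : Finset (Fin 4)) (v w : Fin 4 → ZMod N) :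
    ∑ x : Site N L, f.coeff (x.shift v) U * g.coeff (x.shift w) V =
      correlation f g U V (w - v) := by
  rw [correlation, ← sum_shift (fun x => f.coeff x U * _) v]
  simp only [Site.shift_shift, add_sub_cancel]

lemma correlation_swap (f : Form N L p K) (g : Form N L q K) (U V : Finset (Fin 4))
    (w : Fin 4 → ZMod N) : correlation f g U V w = correlation g f V U (-w) := by
  rw [← zero_sub w, ← sum_coeff_shift_mul_coeff_shift]
  simp only [correlation, Site.shift_zero, mul_comm]

lemma correlation_extDeriv_right (f : Form N L p K) (g : Form N L q K) (U : Finset (Fin 4))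
    {V : Finset (Fin 4)} (hV : V.card = q + 1) (w : Fin 4 → ZMod N) :
    correlation f (extDeriv g) U V w = ∑ ν ∈ V, shuffleSign K {ν} (V.erase ν) *
      (correlation f g U (V.erase ν) (w + vec {ν}) - correlation f g U (V.erase ν) w) := by
  simp only [correlation, coeff_extDeriv _ _ hV, Site.shift_shift, Finset.mul_sum,
    ← Finset.sum_sub_distrib]
  rw [Finset.sum_comm]
  exact Finset.sum_congr rfl fun ν _ => Finset.sum_congr rfl fun x _ => by ring

lemma correlation_extDeriv_left (f : Form N L p K) (g : Form N L q K) {U : Finset (Fin 4)}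
    (hU : U.card = p + 1) (V : Finset (Fin 4)) (w : Fin 4 → ZMod N) :
    correlation (extDeriv f) g U V w = ∑ ν ∈ U, shuffleSign K {ν} (U.erase ν) *
      (correlation f g (U.erase ν) V (w - vec {ν}) - correlation f g (U.erase ν) V w) := by
  rw [correlation_swap, correlation_extDeriv_right _ _ _ hU]
  refine Finset.sum_congr rfl fun ν _ => ?_
  rw [correlation_swap f g, correlation_swap f g, neg_sub', sub_neg_eq_add]

lemma correlation_bdry_left (f : Form N L (p + 1) K) (g : Form N L q K) {U : Finset (Fin 4)}
    (hU : U.card = p) (V : Finset (Fin 4)) (w : Fin 4 → ZMod N) :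
    correlation (bdry f) g U V w = ∑ ν ∈ Uᶜ, shuffleSign K U {ν} *
      (correlation f g (insert ν U) V w - correlation f g (insert ν U) V (w + vec {ν})) := by
  simp only [← sub_neg_eq_add w, ← sum_coeff_shift_mul_coeff_shift]
  simp only [correlation, coeff_bdry _ _ hU, Finset.sum_mul, Finset.mul_sum,
    ← Finset.sum_sub_distrib]
  rw [Finset.sum_comm]
  exact Finset.sum_congr rfl fun ν _ => Finset.sum_congr rfl fun x _ => by ring

lemma dot_eq_sum_correlation (f g : Form N L p K) :
    dot f g = ∑ S ∈ Finset.powersetCard p Finset.univ, correlation f g S S 0 := by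
  rw [dot_eq, Finset.sum_comm]
  simp only [correlation, Site.shift_zero]

lemma sum_coeff_cup (f : Form N L p K) (g : Form N L q K) {S : Finset (Fin 4)}
    (hS : S.card = p + q) : ∑ x, (cup f g).coeff x S =
      ∑ T ∈ S.powersetCard p, shuffleSign K T (S \ T) * correlation f g T (S \ T) (vec T) := by
  simp only [coeff_cup f g _ hS, correlation, Finset.mul_sum]
  exact Finset.sum_comm

lemma dot_bdry (B : Form N L (p + 1) K) (f : Form N L p K) :
    dot (bdry B) f = (-1) ^ (p + 1) * dot B (extDeriv f) := by
  have expand_bdry : dot (bdry B) f = ∑ U ∈ Finset.powersetCard p Finset.univ,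
      ∑ ν ∈ Finset.univ \ U, shuffleSign K U {ν} * (correlation B f (insert ν U) U 0 -
        correlation B f (insert ν U) U (vec {ν})) := by
    rw [dot_eq_sum_correlation]
    refine Finset.sum_congr rfl fun U hU => ?_
    rw [correlation_bdry_left _ _ (Finset.mem_powersetCard.mp hU).2]
    simp only [Finset.compl_eq_univ_sdiff, zero_add]
  have expand_extDeriv : dot B (extDeriv f) = ∑ U ∈ Finset.powersetCard p Finset.univ,
      ∑ ν ∈ Finset.univ \ U, shuffleSign K {ν} ((insert ν U).erase ν) *
        (correlation B f (insert ν U) ((insert ν U).erase ν) (0 + vec {ν}) -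
          correlation B f (insert ν U) ((insert ν U).erase ν) 0) := by
    rw [dot_eq_sum_correlation, ← sum_powersetCard_succ_sum_mem p Finset.univ fun T ν =>
      shuffleSign K {ν} (T.erase ν) * (correlation B f T (T.erase ν) (0 + vec {ν}) -
        correlation B f T (T.erase ν) 0)]
    refine Finset.sum_congr rfl fun T hT => ?_
    rw [correlation_extDeriv_right _ _ _ (Finset.mem_powersetCard.mp hT).2]
  simp only [expand_bdry, expand_extDeriv, Finset.mul_sum]
  refine Finset.sum_congr rfl fun U hU => Finset.sum_congr rfl fun ν hν => ?_
  have hνU : ν ∉ U := (Finset.mem_sdiff.mp hν).2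
  rw [Finset.erase_insert hνU, shuffleSign_singleton_swap hνU,
    (Finset.mem_powersetCard.mp hU).2, zero_add]
  ring

lemma card_sdiff_of_mem_powersetCard {S U : Finset (Fin 4)} (hS : S.card = p + q)
    (hU : U ∈ S.powersetCard p) : (S \ U).card = q := by
  obtain ⟨hUS, hUp⟩ := Finset.mem_powersetCard.mp hU
  rw [Finset.card_sdiff_of_subset hUS, hS, hUp, Nat.add_sub_cancel_left]

lemma sum_coeff_extDeriv_cup (f : Form N L p K) (g : Form N L q K) {S : Finset (Fin 4)}
    (hS : S.card = p + q + 1) : ∑ x, (cup (extDeriv f) g).coeff x S =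
      ∑ U ∈ S.powersetCard p, ∑ ν ∈ S \ U,
        shuffleSign K (insert ν U) ((S \ U).erase ν) * (shuffleSign K {ν} U *
          (correlation f g U ((S \ U).erase ν) (vec U) -
            correlation f g U ((S \ U).erase ν) (vec {ν} + vec U))) := by
  have sum_over_T : ∑ x, (cup (extDeriv f) g).coeff x S = ∑ T ∈ S.powersetCard (p + 1), ∑ ν ∈ T,
      shuffleSign K T (S \ T) * (shuffleSign K {ν} (T.erase ν) *
        (correlation f g (T.erase ν) (S \ T) (vec T - vec {ν}) -
          correlation f g (T.erase ν) (S \ T) (vec T))) := by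
    rw [sum_coeff_cup _ _ (by rw [hS]; ring)]
    refine Finset.sum_congr rfl fun T hT => ?_
    rw [correlation_extDeriv_left _ _ (Finset.mem_powersetCard.mp hT).2, Finset.mul_sum]
  rw [sum_over_T, sum_powersetCard_succ_sum_mem p S fun T ν =>
      shuffleSign K T (S \ T) * (shuffleSign K {ν} (T.erase ν) *
        (correlation f g (T.erase ν) (S \ T) (vec T - vec {ν}) -
          correlation f g (T.erase ν) (S \ T) (vec T)))]
  refine Finset.sum_congr rfl fun U _ => Finset.sum_congr rfl fun ν hν => ?_
  have hνU : ν ∉ U := (Finset.mem_sdiff.mp hν).2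
  rw [Finset.erase_insert hνU, Finset.sdiff_insert, vec_insert hνU, add_sub_cancel_left]

lemma sum_coeff_cup_extDeriv (f : Form N L p K) (g : Form N L q K) {S : Finset (Fin 4)}
    (hS : S.card = p + q + 1) : ∑ x, (cup f (extDeriv g)).coeff x S =
      ∑ U ∈ S.powersetCard p, ∑ ν ∈ S \ U,
        shuffleSign K U (S \ U) * (shuffleSign K {ν} ((S \ U).erase ν) *
          (correlation f g U ((S \ U).erase ν) (vec {ν} + vec U) -
            correlation f g U ((S \ U).erase ν) (vec U))) := by
  rw [sum_coeff_cup f (extDeriv g) hS]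
  refine Finset.sum_congr rfl fun U hU => ?_
  have card_sdiff : (S \ U).card = q + 1 := card_sdiff_of_mem_powersetCard hS hU
  rw [correlation_extDeriv_right _ _ _ card_sdiff, Finset.mul_sum]
  simp only [add_comm (vec U)]

lemma sum_coeff_extDeriv_cup_eq (f : Form N L p K) (g : Form N L q K) {S : Finset (Fin 4)}
    (hS : S.card = p + q + 1) : ∑ x, (cup (extDeriv f) g).coeff x S =
      (-1) ^ (p + 1) * ∑ x, (cup f (extDeriv g)).coeff x S := by
  rw [sum_coeff_extDeriv_cup f g hS, sum_coeff_cup_extDeriv f g hS, Finset.mul_sum]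
  refine Finset.sum_congr rfl fun U hU => ?_
  rw [Finset.mul_sum]
  refine Finset.sum_congr rfl fun ν hν => ?_
  have hνU : ν ∉ U := (Finset.mem_sdiff.mp hν).2
  have swap : shuffleSign K {ν} U = (-1) ^ p * shuffleSign K U {ν} := by
    rw [shuffleSign_swap (Finset.disjoint_singleton_left.mpr hνU), Finset.card_singleton,
      one_mul, (Finset.mem_powersetCard.mp hU).2]
  rw [shuffleSign_insert_left hνU, shuffleSign_eq_mul_erase_right U hν, swap]
  ring

end Correlation

/-! ### The higher cup product -/

section CupOne

variable {N : ℕ} {L : Lattice} {p q : ℕ} {K : Type} [CommRing K]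

lemma Site.reflect_shift_reflect (a : Fin 4) (x : Site N L) (v : Fin 4 → ZMod N) :
    ((x.reflect a).shift v).reflect a = x.shift fun μ => if μ < a then v μ else -v μ := by
  ext μ
  by_cases h : μ < a <;> simp [Site.shift, Site.reflect, h, add_comm]

lemma Site.reflect_shift_reflect_left (a : Fin 4) (x : Site N L) {S T : Finset (Fin 4)}
    (hT : T ⊆ S) : (((x.reflect a).shift (-vec (S.filter fun b => a ≤ b))).reflect a).shift
      (-vec (T.filter fun b => a ≤ b)) = x.shift (vec ((S \ T).filter fun b => a ≤ b)) := by
  rw [Site.reflect_shift_reflect, Site.shift_shift]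
  congr 1
  funext μ
  simp only [vec, Pi.add_apply, Pi.neg_apply, Finset.mem_filter, Finset.mem_sdiff]
  grind

lemma Site.reflect_shift_reflect_right (a : Fin 4) (x : Site N L) {S T : Finset (Fin 4)}
    (hT : T ⊆ S) : ((((x.reflect a).shift (-vec (S.filter fun b => a ≤ b))).shift
      (vec T)).reflect a).shift (-vec ((S \ T).filter fun b => a ≤ b)) =
        x.shift (vec (T.filter fun b => b < a)) := by
  rw [Site.shift_shift, Site.reflect_shift_reflect, Site.shift_shift]
  congr 1
  funext μ
  simp only [vec, Pi.add_apply, Pi.neg_apply, Finset.mem_filter, Finset.mem_sdiff]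
  grind

lemma coeff_parity_cup_parity (a : Fin 4) (α : Form N L p K) (β : Form N L q K)
    (x : Site N L) {S : Finset (Fin 4)} (h : S.card = p + q) :
    (parity a (cup (parity a α) (parity a β))).coeff x S =
      ∑ T ∈ S.powersetCard p, shuffleSign K T (S \ T) *
        (α.coeff (x.shift (vec ((S \ T).filter fun b => a ≤ b))) T *
          β.coeff (x.shift (vec (T.filter fun b => b < a))) (S \ T)) := by
  rw [coeff_parity _ _ _ h, coeff_cup _ _ _ h, Finset.mul_sum]
  refine Finset.sum_congr rfl fun T hT => ?_
  obtain ⟨hTS, hTp⟩ := Finset.mem_powersetCard.mp hT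
  have card_split : (S.filter fun b => a ≤ b).card =
      (T.filter fun b => a ≤ b).card + ((S \ T).filter fun b => a ≤ b).card := by
    rw [← Finset.card_union_of_disjoint, ← Finset.filter_union, Finset.union_sdiff_of_subset hTS]
    exact Finset.disjoint_filter_filter Finset.disjoint_sdiff
  rw [coeff_parity _ _ _ hTp, coeff_parity _ _ _ (card_sdiff_of_mem_powersetCard h hT),
    Site.reflect_shift_reflect_left a x hTS, Site.reflect_shift_reflect_right a x hTS,
    card_split, pow_add]
  have sq_sign (n : ℕ) : ((-1 : K) ^ n) ^ 2 = 1 := by rw [← pow_mul]; simp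
  set A := α.coeff (x.shift (vec ((S \ T).filter fun b => a ≤ b))) T
  set B := β.coeff (x.shift (vec (T.filter fun b => b < a))) (S \ T)
  linear_combination (shuffleSign K T (S \ T) * A * B) *
    (((-1) ^ ((S \ T).filter fun b => a ≤ b).card) ^ 2 *
      sq_sign (T.filter fun b => a ≤ b).card + sq_sign ((S \ T).filter fun b => a ≤ b).card)

lemma coeff_cupOne (α : Form N L (p + 1) K) (β : Form N L (q + 1) K) (x : Site N L)
    {S : Finset (Fin 4)} (h : S.card = p + q + 1) : (cupOne α β).coeff x S =
      (-1) ^ q * ∑ T ∈ S.powersetCard p, ∑ μ ∈ S \ T, shuffleSign K T ((S \ T).erase μ) *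
        (α.coeff (x.shift (vec (((S \ T).erase μ).filter fun b => μ < b))) (insert μ T) *
          β.coeff (x.shift (vec (T.filter fun b => b < μ))) (S \ T)) := by
  rw [Form.coeff_of_card _ _ _ h]
  simp only [cupOne]
  rw [← sum_mem_sum_powersetCard_erase p S fun T μ => shuffleSign K T ((S \ T).erase μ) *
        (α.coeff (x.shift (vec (((S \ T).erase μ).filter fun b => μ < b))) (insert μ T) *
          β.coeff (x.shift (vec (T.filter fun b => b < μ))) (S \ T)),
    Finset.mul_sum, Finset.mul_sum]
  refine Finset.sum_congr rfl fun μ hμ => ?_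
  have card_erase : (S.erase μ).card = p + q := by rw [Finset.card_erase_of_mem hμ]; lia
  rw [coeff_parity_cup_parity _ _ _ _ card_erase, Finset.mul_sum, Finset.mul_sum, Finset.mul_sum]
  refine Finset.sum_congr rfl fun T hT => ?_
  obtain ⟨hTS, hTp⟩ := Finset.mem_powersetCard.mp hT
  set V := S.erase μ \ T with hV
  have hμV : μ ∉ V := by simp [hV]
  have erase_eq : (S \ T).erase μ = V := by rw [hV, Finset.erase_sdiff_comm]
  have insert_eq : insert μ V = S \ T := by
    rw [← erase_eq, Finset.insert_erase]
    exact Finset.mem_sdiff.mpr ⟨hμ, fun h => (Finset.mem_erase.mp (hTS h)).1 rfl⟩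
  have filter_le_eq : (V.filter fun b => μ ≤ b) = V.filter fun b => μ < b :=
    Finset.filter_congr fun b hb => ⟨fun h => lt_of_le_of_ne h fun e => hμV (e ▸ hb), le_of_lt⟩
  have sign_position : (-1 : K) ^ (S.filter fun b => b < μ).card =
      shuffleSign K {μ} T * shuffleSign K {μ} V := by
    rw [← shuffleSign_union_right _ Finset.disjoint_sdiff, Finset.union_sdiff_of_subset hTS,
      ← neg_one_pow_card_filter_lt, Finset.filter_erase,
      Finset.erase_eq_of_notMem (by simp)]
  rw [coeff_interiorProd _ _ _ hTp, coeff_interiorProd _ _ _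
    (card_sdiff_of_mem_powersetCard card_erase hT), ← hV, erase_eq, insert_eq, filter_le_eq,
    pow_succ (-1) (Finset.card _), sign_position]
  set A := α.coeff (x.shift (vec (V.filter fun b => μ < b))) (insert μ T)
  set B := β.coeff (x.shift (vec (T.filter fun b => b < μ))) (S \ T)
  linear_combination ((-1) ^ q * shuffleSign K T V * A * B) *
    (shuffleSign K {μ} V * shuffleSign K {μ} V * shuffleSign_mul_self (K := K) {μ} T +
      shuffleSign_mul_self (K := K) {μ} V)

/-- The `k`-th point of the lattice path from `-∑_{μ ∈ V} μ̂` to `∑_{μ ∈ U} μ̂` which runs once, in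
increasing order, through every direction in `U ∪ V`. The differences in `f ∪₁ dg` and `df ∪₁ g`
in the distinguished direction of `∪₁` are taken along its steps. -/
def cupPath (N : ℕ) (U V : Finset (Fin 4)) (k : ℕ) : Fin 4 → ZMod N :=
  vec (U.filter fun μ => μ.val < k) - vec (V.filter fun μ => k ≤ μ.val)

lemma cupPath_zero (U V : Finset (Fin 4)) : cupPath N U V 0 = -vec V := by
  simp [cupPath]

lemma cupPath_four (U V : Finset (Fin 4)) : cupPath N U V 4 = vec U := by
  have none_above : (V.filter fun μ => 4 ≤ μ.val) = ∅ :=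
    Finset.filter_false_of_mem fun μ _ => μ.isLt.not_ge
  simp [cupPath, none_above]

lemma cupPath_succ_of_notMem {U V : Finset (Fin 4)} {μ : Fin 4} (hU : μ ∉ U) (hV : μ ∉ V) :
    cupPath N U V (μ + 1) = cupPath N U V μ := by
  funext ν
  simp only [cupPath, vec, Pi.sub_apply, Finset.mem_filter]
  grind

lemma cupPath_insert_left {T V : Finset (Fin 4)} {μ : Fin 4} (hV : μ ∉ V) :
    cupPath N (insert μ T) V μ =
      vec (T.filter fun b => b < μ) - vec (V.filter fun b => μ < b) := by
  funext ν
  simp only [cupPath, vec, Pi.sub_apply, Finset.mem_filter, Finset.mem_insert]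
  grind

lemma cupPath_insert_left_succ (T V : Finset (Fin 4)) (μ : Fin 4) :
    cupPath N (insert μ T) V (μ + 1) =
      vec (T.filter fun b => b < μ) - vec (V.filter fun b => μ < b) + vec {μ} := by
  funext ν
  simp only [cupPath, vec, Pi.sub_apply, Pi.add_apply, Finset.mem_filter, Finset.mem_insert,
    Finset.mem_singleton]
  grind

lemma cupPath_insert_right (T V : Finset (Fin 4)) (μ : Fin 4) :
    cupPath N T (insert μ V) μ =
      vec (T.filter fun b => b < μ) - vec (V.filter fun b => μ < b) - vec {μ} := by
  funext ν
  simp only [cupPath, vec, Pi.sub_apply, Finset.mem_filter, Finset.mem_insert,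
    Finset.mem_singleton]
  grind

lemma cupPath_insert_right_succ {T V : Finset (Fin 4)} {μ : Fin 4} (hT : μ ∉ T) :
    cupPath N T (insert μ V) (μ + 1) =
      vec (T.filter fun b => b < μ) - vec (V.filter fun b => μ < b) := by
  funext ν
  simp only [cupPath, vec, Pi.sub_apply, Finset.mem_filter, Finset.mem_insert]
  grind

variable [NeZero N]

lemma sum_coeff_cupOne (α : Form N L (p + 1) K) (β : Form N L (q + 1) K) {S : Finset (Fin 4)}
    (h : S.card = p + q + 1) : ∑ x, (cupOne α β).coeff x S =
      (-1) ^ q * ∑ T ∈ S.powersetCard p, ∑ μ ∈ S \ T, shuffleSign K T ((S \ T).erase μ) *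
        correlation α β (insert μ T) (S \ T)
          (vec (T.filter fun b => b < μ) - vec (((S \ T).erase μ).filter fun b => μ < b)) := by
  simp only [coeff_cupOne _ _ _ h, ← sum_coeff_shift_mul_coeff_shift, Finset.mul_sum]
  rw [Finset.sum_comm]
  exact Finset.sum_congr rfl fun T _ => Finset.sum_comm

/-- The change of the correlation of two complementary components along the `μ`-th step of
`cupPath`. -/
def pathStep (f : Form N L p K) (g : Form N L q K) (U V : Finset (Fin 4)) (μ : Fin 4) : K :=
  correlation f g U V (cupPath N U V (μ + 1)) - correlation f g U V (cupPath N U V μ)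

lemma sum_pathStep (f : Form N L p K) (g : Form N L q K) {S U : Finset (Fin 4)} (hU : U ⊆ S) :
    ∑ μ ∈ U, pathStep f g U (S \ U) μ + ∑ μ ∈ S \ U, pathStep f g U (S \ U) μ =
      correlation f g U (S \ U) (vec U) - correlation f g U (S \ U) (-vec (S \ U)) := by
  have constant_off : ∀ μ ∉ S, pathStep f g U (S \ U) μ = 0 := fun μ hμ => by
    rw [pathStep, cupPath_succ_of_notMem (fun h => hμ (hU h))
      (fun h => hμ (Finset.mem_sdiff.mp h).1), sub_self]
  rw [← Finset.sum_union Finset.disjoint_sdiff, Finset.union_sdiff_of_subset hU,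
    Finset.sum_subset (Finset.subset_univ S) fun μ _ => constant_off μ]
  simp only [pathStep]
  rw [Fin.sum_univ_eq_sum_range fun k => correlation f g U (S \ U) (cupPath N U (S \ U) (k + 1)) -
    correlation f g U (S \ U) (cupPath N U (S \ U) k),
    Finset.sum_range_sub fun k => correlation f g U (S \ U) (cupPath N U (S \ U) k),
    cupPath_four, cupPath_zero]

/-- The term of `f ∪₁ dg` with distinguished direction `μ` in which `g` is differenced in another
direction `ν`, on the components `insert μ T` of `f` and `V` of `dg`. -/
def crossTermRight (f : Form N L (p + 1) K) (g : Form N L (q + 1) K) (T V : Finset (Fin 4))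
    (μ ν : Fin 4) : K :=
  shuffleSign K T (V.erase μ) * (shuffleSign K {ν} (V.erase ν) *
    (correlation f g (insert μ T) (V.erase ν) (vec (T.filter fun b => b < μ) -
        vec ((V.erase μ).filter fun b => μ < b) + vec {ν}) -
      correlation f g (insert μ T) (V.erase ν) (vec (T.filter fun b => b < μ) -
        vec ((V.erase μ).filter fun b => μ < b))))

/-- The term of `df ∪₁ g` with distinguished direction `μ` in which `f` is differenced in another
direction `ν`, on the components `insert μ U` of `df` and `V` of `g`. -/
def crossTermLeft (f : Form N L (p + 1) K) (g : Form N L (q + 1) K) (U V : Finset (Fin 4))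
    (μ ν : Fin 4) : K :=
  shuffleSign K U (V.erase μ) * (shuffleSign K {ν} ((insert μ U).erase ν) *
    (correlation f g ((insert μ U).erase ν) V (vec (U.filter fun b => b < μ) -
        vec ((V.erase μ).filter fun b => μ < b) - vec {ν}) -
      correlation f g ((insert μ U).erase ν) V (vec (U.filter fun b => b < μ) -
        vec ((V.erase μ).filter fun b => μ < b))))

lemma sum_coeff_cupOne_extDeriv (f : Form N L (p + 1) K) (g : Form N L (q + 1) K)
    {S : Finset (Fin 4)} (hS : S.card = p + q + 2) :
    ∑ x, (cupOne f (extDeriv g)).coeff x S = (-1) ^ (q + 1) *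
      (∑ U ∈ S.powersetCard (p + 1), shuffleSign K U (S \ U) *
          ∑ μ ∈ U, pathStep f g U (S \ U) μ +
        ∑ T ∈ S.powersetCard p, ∑ μ ∈ S \ T, ∑ ν ∈ (S \ T).erase μ,
          crossTermRight f g T (S \ T) μ ν) := by
  have hS' : S.card = p + (q + 2) := hS
  rw [sum_coeff_cupOne f (extDeriv g) hS']
  congr 1
  simp only [Finset.mul_sum]
  rw [sum_powersetCard_succ_sum_mem p S fun U μ =>
    shuffleSign K U (S \ U) * pathStep f g U (S \ U) μ, ← Finset.sum_add_distrib]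
  refine Finset.sum_congr rfl fun T hT => ?_
  rw [← Finset.sum_add_distrib]
  refine Finset.sum_congr rfl fun μ hμ => ?_
  have hμT : μ ∉ T := (Finset.mem_sdiff.mp hμ).2
  have hμV : μ ∉ (S \ T).erase μ := Finset.notMem_erase μ _
  have card_sdiff : (S \ T).card = q + 1 + 1 := card_sdiff_of_mem_powersetCard hS' hT
  rw [correlation_extDeriv_right _ _ _ card_sdiff, ← Finset.add_sum_erase _ _ hμ, mul_add,
    Finset.mul_sum, Finset.sdiff_insert, pathStep, cupPath_insert_left hμV,
    cupPath_insert_left_succ, shuffleSign_insert_left hμT]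
  simp only [crossTermRight]
  ring

lemma crossTermLeft_eq (f : Form N L (p + 1) K) (g : Form N L (q + 1) K) {S T : Finset (Fin 4)}
    (hT : T.card = p) {μ ν : Fin 4} (hμ : μ ∈ S \ T) (hν : ν ∈ (S \ T).erase μ) :
    crossTermLeft f g (insert ν T) (S \ insert ν T) μ ν =
      (-1) ^ (p + 1) * crossTermRight f g T (S \ T) μ ν := by
  have hνμ : ν ≠ μ := (Finset.mem_erase.mp hν).1
  have hνT : ν ∉ T := (Finset.mem_sdiff.mp (Finset.mem_erase.mp hν).2).2
  have hμT : μ ∉ T := (Finset.mem_sdiff.mp hμ).2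
  set W := ((S \ T).erase μ).erase ν with hW
  have hνW : ν ∉ W := Finset.notMem_erase ν _
  have hμW : μ ∉ W := fun h => Finset.notMem_erase μ _ (Finset.mem_of_mem_erase h)
  have erase_μ : (S \ T).erase μ = insert ν W := (Finset.insert_erase hν).symm
  have erase_ν : (S \ T).erase ν = insert μ W := by
    rw [hW, Finset.erase_right_comm, Finset.insert_erase (Finset.mem_erase.mpr ⟨hνμ.symm, hμ⟩)]
  have swap : shuffleSign K {ν} T = (-1) ^ p * shuffleSign K T {ν} := by
    rw [shuffleSign_swap (Finset.disjoint_singleton_left.mpr hνT), Finset.card_singleton,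
      one_mul, hT]
  rw [crossTermLeft, crossTermRight, Finset.sdiff_insert, erase_μ, erase_ν, Finset.erase_insert hμW,
    Finset.erase_insert_of_ne hνμ.symm, Finset.erase_insert hνT, shuffleSign_insert_left hνT,
    shuffleSign_insert_right _ hμT, shuffleSign_insert_right _ hνW,
    shuffleSign_insert_right _ hμW, swap]
  set w : Fin 4 → ZMod N := vec (T.filter fun b => b < μ) - vec (W.filter fun b => μ < b) with hw
  rcases lt_or_gt_of_ne hνμ with hlt | hgt
  · have below : (vec ((insert ν T).filter fun b => b < μ) : Fin 4 → ZMod N) =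
        vec {ν} + vec (T.filter fun b => b < μ) := by
      rw [Finset.filter_insert, if_pos hlt, vec_insert (by simp [hνT])]
    rw [below, Finset.filter_insert, if_neg hlt.not_gt, add_sub_assoc, ← hw,
      add_sub_cancel_left, add_comm (vec {ν})]
    ring
  · have above : (vec ((insert ν W).filter fun b => μ < b) : Fin 4 → ZMod N) =
        vec {ν} + vec (W.filter fun b => μ < b) := by
      rw [Finset.filter_insert, if_pos hgt, vec_insert (by simp [hνW])]
    rw [above, Finset.filter_insert, if_neg hgt.not_gt, add_comm (vec {ν}), ← sub_sub, ← hw,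
      sub_add_cancel]
    ring

lemma shuffleSign_mul_correlation_extDeriv_insert (f : Form N L (p + 1) K)
    (g : Form N L (q + 1) K) {U V : Finset (Fin 4)} (hU : U.card = p + 1) {μ : Fin 4}
    (hμU : μ ∉ U) (hμV : μ ∈ V) :
    shuffleSign K U (V.erase μ) * correlation (extDeriv f) g (insert μ U) V
        (vec (U.filter fun b => b < μ) - vec ((V.erase μ).filter fun b => μ < b)) =
      (-1) ^ p * (shuffleSign K U V * pathStep f g U V μ) +
        ∑ ν ∈ U, crossTermLeft f g U V μ ν := by
  have before : cupPath N U V μ = vec (U.filter fun b => b < μ) -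
      vec ((V.erase μ).filter fun b => μ < b) - vec {μ} := by
    rw [← cupPath_insert_right, Finset.insert_erase hμV]
  have after : cupPath N U V (μ + 1) = vec (U.filter fun b => b < μ) -
      vec ((V.erase μ).filter fun b => μ < b) := by
    rw [← cupPath_insert_right_succ hμU, Finset.insert_erase hμV]
  have swap : shuffleSign K {μ} U = (-1) ^ (p + 1) * shuffleSign K U {μ} := by
    rw [shuffleSign_swap (Finset.disjoint_singleton_left.mpr hμU), Finset.card_singleton,
      one_mul, hU]
  rw [correlation_extDeriv_left _ _ (by rw [Finset.card_insert_of_notMem hμU, hU]),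
    Finset.sum_insert hμU, Finset.erase_insert hμU, mul_add, Finset.mul_sum, pathStep, before,
    after, shuffleSign_eq_mul_erase_right U hμV, swap]
  simp only [crossTermLeft]
  ring

lemma sum_coeff_extDeriv_cupOne (f : Form N L (p + 1) K) (g : Form N L (q + 1) K)
    {S : Finset (Fin 4)} (hS : S.card = p + q + 2) :
    (-1) ^ (p + 1) * ∑ x, (cupOne (extDeriv f) g).coeff x S = (-1) ^ (q + 1) *
      (∑ U ∈ S.powersetCard (p + 1), shuffleSign K U (S \ U) *
          ∑ μ ∈ S \ U, pathStep f g U (S \ U) μ -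
        ∑ T ∈ S.powersetCard p, ∑ μ ∈ S \ T, ∑ ν ∈ (S \ T).erase μ,
          crossTermRight f g T (S \ T) μ ν) := by
  rw [sum_coeff_cupOne (extDeriv f) g (by rw [hS]; ring), Finset.sum_congr rfl fun U hU =>
    Finset.sum_congr rfl fun μ hμ => shuffleSign_mul_correlation_extDeriv_insert f g
      (Finset.mem_powersetCard.mp hU).2 (Finset.mem_sdiff.mp hμ).2 hμ]
  simp only [Finset.sum_add_distrib, ← Finset.mul_sum _ _ ((-1 : K) ^ p),
    ← Finset.mul_sum _ _ (shuffleSign K _ (S \ _)), Finset.sum_comm (s := S \ _)]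
  rw [sum_powersetCard_succ_sum_mem p S fun U ν => ∑ μ ∈ S \ U, crossTermLeft f g U (S \ U) μ ν]
  have cross_terms : ∀ T ∈ S.powersetCard p,
      ∑ ν ∈ S \ T, ∑ μ ∈ S \ insert ν T, crossTermLeft f g (insert ν T) (S \ insert ν T) μ ν =
        (-1) ^ (p + 1) * ∑ μ ∈ S \ T, ∑ ν ∈ (S \ T).erase μ,
          crossTermRight f g T (S \ T) μ ν := fun T hT => by
    simp only [Finset.mul_sum]
    rw [Finset.sum_congr rfl fun μ hμ => Finset.sum_congr rfl fun ν hν =>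
        (crossTermLeft_eq f g (Finset.mem_powersetCard.mp hT).2 hμ hν).symm]
    refine Finset.sum_comm' fun μ ν => ?_
    simp only [Finset.mem_sdiff, Finset.mem_erase, Finset.mem_insert]
    tauto
  rw [Finset.sum_congr rfl cross_terms, ← Finset.mul_sum]
  have sq_sign : (-1 : K) ^ p * (-1) ^ p = 1 := by rw [← mul_pow, neg_mul_neg, one_mul, one_pow]
  have collect (A C : K) : (-1) ^ (p + 1) * ((-1) ^ q * ((-1) ^ p * A + (-1) ^ (p + 1) * C)) =
      (-1) ^ (q + 1) * (A - C) := by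
    linear_combination (-1) ^ (q + 1) * (A - C) * sq_sign
  exact collect _ _

lemma sum_coeff_cupOne_extDeriv_add (f : Form N L (p + 1) K) (g : Form N L (q + 1) K)
    {S : Finset (Fin 4)} (hS : S.card = p + q + 2) :
    ∑ x, (cupOne f (extDeriv g)).coeff x S +
        (-1) ^ (p + 1) * ∑ x, (cupOne (extDeriv f) g).coeff x S =
      (-1) ^ (q + 1) * (∑ x, (cup f g).coeff x S -
        (-1) ^ ((p + 1) * (q + 1)) * ∑ x, (cup g f).coeff x S) := by
  have cup_swap : ∑ x, (cup g f).coeff x S = ∑ U ∈ S.powersetCard (p + 1),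
      (-1) ^ ((p + 1) * (q + 1)) * (shuffleSign K U (S \ U) *
        correlation f g U (S \ U) (-vec (S \ U))) := by
    have hS' : S.card = q + 1 + (p + 1) := by rw [hS]; ring
    rw [sum_coeff_cup _ _ hS']
    refine Finset.sum_nbij' (S \ ·) (S \ ·) ?_ ?_ ?_ ?_ ?_ <;> intro U hU <;>
      have hUS := (Finset.mem_powersetCard.mp hU).1
    · exact Finset.mem_powersetCard.mpr ⟨Finset.sdiff_subset, card_sdiff_of_mem_powersetCard hS' hU⟩
    · exact Finset.mem_powersetCard.mpr ⟨Finset.sdiff_subset,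
        card_sdiff_of_mem_powersetCard (hS.trans (by ring)) hU⟩
    · exact Finset.sdiff_sdiff_eq_self hUS
    · exact Finset.sdiff_sdiff_eq_self hUS
    · rw [Finset.sdiff_sdiff_eq_self hUS, shuffleSign_swap Finset.disjoint_sdiff,
        (Finset.mem_powersetCard.mp hU).2, card_sdiff_of_mem_powersetCard hS' hU,
        correlation_swap, mul_assoc, mul_comm (q + 1)]
  have sq_sign : ((-1 : K) ^ ((p + 1) * (q + 1))) * (-1) ^ ((p + 1) * (q + 1)) = 1 := by
    rw [← mul_pow, neg_mul_neg, one_mul, one_pow]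
  rw [sum_coeff_cupOne_extDeriv f g hS, sum_coeff_extDeriv_cupOne f g hS, cup_swap,
    sum_coeff_cup f g (by rw [hS]; ring), ← Finset.mul_sum, ← mul_assoc _ _ (Finset.sum _ _),
    sq_sign, one_mul, ← Finset.sum_sub_distrib]
  have steps : ∀ U ∈ S.powersetCard (p + 1), shuffleSign K U (S \ U) *
      correlation f g U (S \ U) (vec U) - shuffleSign K U (S \ U) *
      correlation f g U (S \ U) (-vec (S \ U)) = _ := fun U hU => by
    rw [← mul_sub, ← sum_pathStep f g (Finset.mem_powersetCard.mp hU).1, mul_add]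
  rw [Finset.sum_congr rfl steps, Finset.sum_add_distrib]
  ring

end CupOne

/-! ### Linearity -/

section Linearity
variable {N : ℕ} {L : Lattice} {r : ℕ} {K : Type} [CommRing K]

lemma extDeriv_add (α β : Form N L r K) : extDeriv (α + β) = extDeriv α + extDeriv β := by
  funext c
  simp only [extDeriv, Form.coeff_add, Pi.add_apply, ← Finset.sum_add_distrib]
  exact Finset.sum_congr rfl fun _ _ => by ring

lemma extDeriv_sub (α β : Form N L r K) : extDeriv (α - β) = extDeriv α - extDeriv β := by
  funext c
  simp only [extDeriv, Form.coeff_sub, Pi.sub_apply, ← Finset.sum_sub_distrib]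
  exact Finset.sum_congr rfl fun _ _ => by ring

lemma extDeriv_smul (a : K) (α : Form N L r K) : extDeriv (a • α) = a • extDeriv α := by
  funext c
  simp only [extDeriv, Form.coeff_smul, Pi.smul_apply, smul_eq_mul, Finset.mul_sum]
  exact Finset.sum_congr rfl fun _ _ => by ring

/-- The exterior derivative `d`, bundled as a linear map. -/
def extDerivₗ (N : ℕ) (L : Lattice) (r : ℕ) (K : Type) [CommRing K] :
    Form N L r K →ₗ[K] Form N L (r + 1) K where
  toFun := extDeriv
  map_add' := extDeriv_add
  map_smul' := extDeriv_smul

lemma bdry_add (α β : Form N L (r + 1) K) : bdry (α + β) = bdry α + bdry β := by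
  funext c
  simp only [bdry, Form.coeff_add, Pi.add_apply, ← Finset.sum_add_distrib]
  exact Finset.sum_congr rfl fun _ _ => by ring

lemma bdry_smul (a : K) (α : Form N L (r + 1) K) : bdry (a • α) = a • bdry α := by
  funext c
  simp only [bdry, Form.coeff_smul, Pi.smul_apply, smul_eq_mul, Finset.mul_sum]
  exact Finset.sum_congr rfl fun _ _ => by ring

/-- The boundary operator `∂`, bundled as a linear map. -/
def bdryₗ (N : ℕ) (L : Lattice) (r : ℕ) (K : Type) [CommRing K] :
    Form N L (r + 1) K →ₗ[K] Form N L r K where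
  toFun := bdry
  map_add' := bdry_add
  map_smul' := bdry_smul

lemma toReal_add (n m : Form N L r ℤ) : (n + m : Form N L r ℤ).toReal = n.toReal + m.toReal := by
  funext c; simp [Form.toReal]

lemma toReal_smul (a : ℤ) (n : Form N L r ℤ) :
    (a • n : Form N L r ℤ).toReal = (a : ℝ) • n.toReal := by
  funext c; simp [Form.toReal]

lemma extDeriv_toReal (n : Form N L r ℤ) : extDeriv n.toReal = (extDeriv n).toReal := by
  funext c
  simp [extDeriv, Form.coeff_toReal, Form.toReal, intCast_shuffleSign]

lemma extDeriv_toReal_eq_zero {n : Form N L r ℤ} (hn : extDeriv n = 0) :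
    extDeriv n.toReal = 0 := by
  rw [extDeriv_toReal, hn]
  exact funext fun _ => Int.cast_zero

variable {p q : ℕ}

lemma cup_add_left (α α' : Form N L p K) (β : Form N L q K) :
    cup (α + α') β = cup α β + cup α' β := by
  funext c
  simp only [cup, Form.coeff_add, Pi.add_apply, ← Finset.sum_add_distrib]
  exact Finset.sum_congr rfl fun _ _ => by ring

lemma cup_add_right (α : Form N L p K) (β β' : Form N L q K) :
    cup α (β + β') = cup α β + cup α β' := by
  funext c
  simp only [cup, Form.coeff_add, Pi.add_apply, ← Finset.sum_add_distrib]
  exact Finset.sum_congr rfl fun _ _ => by ring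

lemma cup_smul_left (a : K) (α : Form N L p K) (β : Form N L q K) :
    cup (a • α) β = a • cup α β := by
  funext c
  simp only [cup, Form.coeff_smul, Pi.smul_apply, smul_eq_mul, Finset.mul_sum]
  exact Finset.sum_congr rfl fun _ _ => by ring

lemma cup_smul_right (a : K) (α : Form N L p K) (β : Form N L q K) :
    cup α (a • β) = a • cup α β := by
  funext c
  simp only [cup, Form.coeff_smul, Pi.smul_apply, smul_eq_mul, Finset.mul_sum]
  exact Finset.sum_congr rfl fun _ _ => by ring

lemma cup_zero_right (α : Form N L p K) : cup α (0 : Form N L q K) = 0 := by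
  simpa using cup_smul_right (0 : K) α (0 : Form N L q K)

lemma parity_add (a : Fin 4) (α β : Form N L r K) :
    parity a (α + β) = parity a α + parity a β := by
  funext c; simp [parity, mul_add]

lemma parity_smul (a : Fin 4) (k : K) (α : Form N L r K) :
    parity a (k • α) = k • parity a α := by
  funext c
  simp only [parity, Form.coeff_smul, Pi.smul_apply, smul_eq_mul]
  ring

lemma interiorProd_add (a : Fin 4) (α β : Form N L (r + 1) K) :
    interiorProd a (α + β) = interiorProd a α + interiorProd a β := by
  funext c; simp [interiorProd, mul_add]

lemma interiorProd_smul (a : Fin 4) (k : K) (α : Form N L (r + 1) K) :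
    interiorProd a (k • α) = k • interiorProd a α := by
  funext c
  simp only [interiorProd, Form.coeff_smul, Pi.smul_apply, smul_eq_mul]
  ring

lemma cupOne_add_left (α α' : Form N L (p + 1) K) (β : Form N L (q + 1) K) :
    cupOne (α + α') β = cupOne α β + cupOne α' β := by
  funext c
  simp only [cupOne, interiorProd_add, parity_add, cup_add_left, Form.coeff_add, Pi.add_apply,
    mul_add, Finset.sum_add_distrib]

lemma cupOne_smul_left (a : K) (α : Form N L (p + 1) K) (β : Form N L (q + 1) K) :
    cupOne (a • α) β = a • cupOne α β := by
  funext c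
  simp only [cupOne, interiorProd_smul, parity_smul, cup_smul_left, Form.coeff_smul,
    Pi.smul_apply, smul_eq_mul, Finset.mul_sum]
  exact Finset.sum_congr rfl fun _ _ => by ring

lemma cupOne_smul_right (a : K) (α : Form N L (p + 1) K) (β : Form N L (q + 1) K) :
    cupOne α (a • β) = a • cupOne α β := by
  funext c
  simp only [cupOne, interiorProd_smul, parity_smul, cup_smul_right, Form.coeff_smul,
    Pi.smul_apply, smul_eq_mul, Finset.mul_sum]
  exact Finset.sum_congr rfl fun _ _ => by ring

lemma cupOne_zero_left (β : Form N L (q + 1) K) : cupOne (0 : Form N L (p + 1) K) β = 0 := by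
  simpa using cupOne_smul_left (0 : K) (0 : Form N L (p + 1) K) β

lemma cup_toReal (n : Form N L p ℤ) (m : Form N L q ℤ) :
    cup n.toReal m.toReal = (cup n m).toReal := by
  funext c
  simp [cup, Form.coeff_toReal, Form.toReal, intCast_shuffleSign]

lemma parity_toReal (a : Fin 4) (n : Form N L r ℤ) :
    parity a n.toReal = (parity a n).toReal := by
  funext c; simp [parity, Form.coeff_toReal, Form.toReal]

lemma interiorProd_toReal (a : Fin 4) (n : Form N L (r + 1) ℤ) :
    interiorProd a n.toReal = (interiorProd a n).toReal := by
  funext c; simp [interiorProd, Form.coeff_toReal, Form.toReal, intCast_shuffleSign]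

lemma cupOne_toReal (n : Form N L (p + 1) ℤ) (m : Form N L (q + 1) ℤ) :
    cupOne n.toReal m.toReal = (cupOne n m).toReal := by
  funext c
  simp only [cupOne, interiorProd_toReal, parity_toReal, cup_toReal, Form.coeff_toReal]
  simp only [Form.toReal, cupOne]
  push_cast
  rfl

variable [NeZero N]

lemma total_add (α β : Form N L 4 K) : total (α + β) = total α + total β := by
  simp [total, Finset.sum_add_distrib]

lemma total_zero : total (0 : Form N L 4 K) = 0 := by
  simp [total]

lemma total_smul (a : K) (α : Form N L 4 K) : total (a • α) = a * total α := by
  simp [total, Finset.mul_sum]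

lemma total_toReal (n : Form N L 4 ℤ) : total n.toReal = (total n : ℤ) := by
  simp [total, Form.toReal]

lemma dot_add_left (α α' β : Form N L r K) : dot (α + α') β = dot α β + dot α' β := by
  simp [dot, add_mul, Finset.sum_add_distrib]

lemma dot_comm (α β : Form N L r K) : dot α β = dot β α := by
  simp [dot, mul_comm]

lemma dot_add_right (α β β' : Form N L r K) : dot α (β + β') = dot α β + dot α β' := by
  simp [dot, mul_add, Finset.sum_add_distrib]

lemma dot_smul_left (a : K) (α β : Form N L r K) : dot (a • α) β = a * dot α β := by
  simp [dot, mul_assoc, Finset.mul_sum]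

lemma dot_smul_right (a : K) (α β : Form N L r K) : dot α (a • β) = a * dot α β := by
  simp [dot, mul_left_comm, Finset.mul_sum]

lemma dot_self_nonneg (α : Form N L r ℝ) : 0 ≤ dot α α :=
  Finset.sum_nonneg fun c _ => mul_self_nonneg (α c)

lemma eq_zero_of_dot_self {α : Form N L r ℝ} (h : dot α α = 0) : α = 0 := by
  funext c
  exact mul_self_eq_zero.mp ((Finset.sum_eq_zero_iff_of_nonneg fun c _ =>
    mul_self_nonneg (α c)).mp h c (Finset.mem_univ c))

end Linearity

section TopDegree

variable {N : ℕ} [NeZero N] {L : Lattice} {K : Type} [CommRing K]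

lemma total_cup_extDeriv_left (A : Form N L 1 K) (g : Form N L 2 K) :
    total (cup (extDeriv A) g) = total (cup A (extDeriv g)) := by
  rw [total_eq, total_eq, sum_coeff_extDeriv_cup_eq A g (Finset.card_fin 4)]
  ring

lemma total_cup_extDeriv_right (g : Form N L 2 K) (A : Form N L 1 K) :
    total (cup g (extDeriv A)) = -total (cup (extDeriv g) A) := by
  rw [total_eq, total_eq, sum_coeff_extDeriv_cup_eq g A (Finset.card_fin 4)]
  ring

lemma total_cupOne_extDeriv (f g : Form N L 2 K) :
    total (cupOne f (extDeriv g)) + total (cupOne (extDeriv f) g) =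
      total (cup f g) - total (cup g f) := by
  have leibniz := sum_coeff_cupOne_extDeriv_add f g (Finset.card_fin 4)
  simp only [total_eq]
  linear_combination leibniz

lemma total_cupOne_extDeriv_of_closed {f : Form N L 2 K} (hf : extDeriv f = 0)
    (g : Form N L 2 K) :
    total (cupOne f (extDeriv g)) = total (cup f g) - total (cup g f) := by
  rw [← total_cupOne_extDeriv, hf, cupOne_zero_left,
    show total (0 : Form N L (2 + 1 + 1) K) = 0 from total_zero, add_zero]

lemma total_cupOne_add_left (f f' : Form N L 2 K) (g : Form N L 3 K) :
    total (cupOne (f + f') g) = total (cupOne f g) + total (cupOne f' g) := by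
  rw [cupOne_add_left]
  exact total_add _ _

lemma total_cupOne_smul_left (a : K) (f : Form N L 2 K) (g : Form N L 3 K) :
    total (cupOne (a • f) g) = a * total (cupOne f g) := by
  rw [cupOne_smul_left]
  exact total_smul _ _

lemma total_cupOne_smul_right (a : K) (f : Form N L 2 K) (g : Form N L 3 K) :
    total (cupOne f (a • g)) = a * total (cupOne f g) := by
  rw [cupOne_smul_right]
  exact total_smul _ _

lemma total_cupOne_toReal (n : Form N L 2 ℤ) (m : Form N L 3 ℤ) :
    total (cupOne n.toReal m.toReal) = (total (cupOne n m) : ℤ) := by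
  rw [cupOne_toReal]
  exact total_toReal _

lemma dot_bdry_two (B : Form N L 3 K) (f : Form N L 2 K) :
    dot (bdry B) f = -dot B (extDeriv f) := by
  rw [dot_bdry]
  ring

end TopDegree

/-! ### Hodge decomposition of closed forms -/

section Projection

variable {N : ℕ} [NeZero N] {L : Lattice} {r : ℕ}

/-- The orthogonal projection of an `r`-form onto the span of a family of `r`-forms, for the inner
product `dot`. -/
def projRange {ι : Type*} (T : ι → Form N L r ℝ) (f : Form N L r ℝ) : Form N L r ℝ :=
  WithLp.ofLp ((Submodule.span ℝ (Set.range fun b =>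
    (WithLp.toLp 2 (T b) : EuclideanSpace ℝ (Cell N L r)))).starProjection (WithLp.toLp 2 f))

lemma projRange_mem {V : Type*} [AddCommGroup V] [Module ℝ V] (T : V →ₗ[ℝ] Form N L r ℝ)
    (f : Form N L r ℝ) : ∃ a, projRange T f = T a := by
  have span_le : Submodule.span ℝ (Set.range fun b =>
      (WithLp.toLp 2 (T b) : EuclideanSpace ℝ (Cell N L r))) ≤
      LinearMap.range ((WithLp.linearEquiv 2 ℝ (Cell N L r → ℝ)).symm.toLinearMap ∘ₗ T) := by
    rw [Submodule.span_le]
    rintro _ ⟨b, rfl⟩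
    exact ⟨b, rfl⟩
  obtain ⟨a, ha⟩ := span_le (Submodule.starProjection_apply_mem _ (WithLp.toLp 2 f))
  exact ⟨a, congrArg WithLp.ofLp ha.symm⟩

lemma dot_sub_projRange {ι : Type*} (T : ι → Form N L r ℝ) (f : Form N L r ℝ) (b : ι) :
    dot (f - projRange T f) (T b) = 0 := by
  have orthogonal := Submodule.sub_starProjection_mem_orthogonal (K := Submodule.span ℝ
    (Set.range fun b => (WithLp.toLp 2 (T b) : EuclideanSpace ℝ (Cell N L r)))) (WithLp.toLp 2 f)
  have := (Submodule.mem_orthogonal _ _).mp orthogonal _ (Submodule.subset_span ⟨b, rfl⟩)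
  simpa [PiLp.inner_apply, dot, projRange] using this

end Projection

section Harmonic

variable {N : ℕ} [NeZero N] {L : Lattice} {r : ℕ}

lemma sum_mul_second_difference (φ : Site N L → ℝ) (v : Fin 4 → ZMod N) :
    ∑ x, φ x * (φ (x.shift v) - 2 * φ x + φ (x.shift (-v))) =
      -∑ x, (φ (x.shift v) - φ x) ^ 2 := by
  have square := sum_shift (fun x : Site N L => φ x ^ 2) v
  have backward := sum_shift (fun x : Site N L => φ x * φ (x.shift (-v))) v
  simp only [Site.shift_shift, add_neg_cancel, Site.shift_zero] at backward
  rw [← sub_eq_zero] at square backward ⊢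
  rw [← Finset.sum_sub_distrib] at square backward
  rw [← Finset.sum_neg_distrib, ← Finset.sum_sub_distrib]
  have vanish := congrArg₂ (· - ·) square backward
  simp only [sub_zero, ← Finset.sum_sub_distrib] at vanish
  exact (Finset.sum_congr rfl fun x _ => by ring).trans vanish

lemma apply_eq_of_apply_shift_vec {α : Type*} (φ : Site N L → α)
    (h : ∀ (x : Site N L) μ, φ (x.shift (vec {μ})) = φ x) (x y : Site N L) : φ x = φ y := by
  let periods : AddSubmonoid (Fin 4 → ZMod N) :=
    { carrier := {v | ∀ x : Site N L, φ (x.shift v) = φ x}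
      zero_mem' := by simp
      add_mem' := fun {v w} hv hw x => by rw [← Site.shift_shift, hw, hv] }
  have mem_periods (v : Fin 4 → ZMod N) : v ∈ periods := by
    have expand : v = ∑ μ : Fin 4, (v μ).val • (vec {μ} : Fin 4 → ZMod N) := by
      funext i
      simp only [Finset.sum_apply, Pi.smul_apply, vec, Finset.mem_singleton, smul_ite, smul_zero,
        Finset.sum_ite_eq, Finset.mem_univ, if_true, nsmul_one, ZMod.natCast_val, ZMod.cast_id',
        id_eq]
    rw [expand]
    exact periods.sum_mem fun μ _ => periods.nsmul_mem (fun x => h x μ) _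
  have shift_sub : x.shift (y.coord - x.coord) = y := by
    ext i
    simp [Site.shift]
  rw [← mem_periods (y.coord - x.coord) x, shift_sub]

lemma apply_eq_of_laplacian_eq_zero (φ : Site N L → ℝ) (h : ∀ x : Site N L,
    ∑ μ, (φ (x.shift (vec {μ})) - 2 * φ x + φ (x.shift (-vec {μ}))) = 0)
    (x y : Site N L) : φ x = φ y := by
  have energy : ∑ μ : Fin 4, ∑ x : Site N L, (φ (x.shift (vec {μ})) - φ x) ^ 2 = 0 := by
    rw [← neg_eq_zero, ← Finset.sum_neg_distrib]
    simp only [← sum_mul_second_difference]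
    rw [Finset.sum_comm]
    simp only [← Finset.mul_sum, h, mul_zero, Finset.sum_const_zero]
  refine apply_eq_of_apply_shift_vec φ (fun x μ => ?_) x y
  have gradient := (Finset.sum_eq_zero_iff_of_nonneg fun μ _ =>
    Finset.sum_nonneg fun x _ => sq_nonneg _).mp energy μ (Finset.mem_univ μ)
  exact sub_eq_zero.mp (sq_eq_zero_iff.mp ((Finset.sum_eq_zero_iff_of_nonneg fun x _ =>
    sq_nonneg _).mp gradient x (Finset.mem_univ x)))

/-- The harmonic part of a closed form: the constant form whose components are the mean values of
those of `f`. -/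
def meanForm (f : Form N L r ℝ) : Form N L r ℝ :=
  fun c => ((N : ℝ) ^ 4)⁻¹ * ∑ x, f.coeff x c.2.1

lemma card_site : Fintype.card (Site N L) = N ^ 4 := by
  rw [Fintype.card_congr (Site.equivCoord N L)]
  simp [ZMod.card]

@[simp]
lemma coeff_meanForm (f : Form N L r ℝ) (x : Site N L) (S : Finset (Fin 4)) :
    (meanForm f).coeff x S = ((N : ℝ) ^ 4)⁻¹ * ∑ y, f.coeff y S := by
  by_cases h : S.card = r
  · rw [Form.coeff_of_card _ _ _ h]
    rfl
  · simp [Form.coeff_of_card_ne _ _ _ h]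

@[simp]
lemma sum_coeff_extDeriv (f : Form N L r ℝ) (S : Finset (Fin 4)) :
    ∑ x, (extDeriv f).coeff x S = 0 := by
  by_cases h : S.card = r + 1
  · simp only [coeff_extDeriv _ _ h]
    rw [Finset.sum_comm]
    refine Finset.sum_eq_zero fun μ _ => ?_
    rw [← Finset.mul_sum, Finset.sum_sub_distrib,
      sum_shift (fun x : Site N L => f.coeff x (S.erase μ)), sub_self, mul_zero]
  · simp [Form.coeff_of_card_ne _ _ _ h]

@[simp]
lemma sum_coeff_bdry (f : Form N L (r + 1) ℝ) (S : Finset (Fin 4)) :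
    ∑ x, (bdry f).coeff x S = 0 := by
  by_cases h : S.card = r
  · simp only [coeff_bdry _ _ h]
    rw [Finset.sum_comm]
    refine Finset.sum_eq_zero fun μ _ => ?_
    rw [← Finset.mul_sum, Finset.sum_sub_distrib,
      sum_shift (fun x : Site N L => f.coeff x (insert μ S)), sub_self, mul_zero]
  · simp [Form.coeff_of_card_ne _ _ _ h]

lemma coeff_eq_of_extDeriv_eq_zero_of_bdry_eq_zero {f : Form N L (r + 1) ℝ}
    (hd : extDeriv f = 0) (hb : bdry f = 0) {S : Finset (Fin 4)} (hS : S.card = r + 1)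
    (x y : Site N L) : f.coeff x S = f.coeff y S := by
  refine apply_eq_of_laplacian_eq_zero (fun x => f.coeff x S) (fun x => ?_) x y
  have laplacian := coeff_bdry_extDeriv_sub_extDeriv_bdry f x hS
  rw [hd, hb, show bdry (0 : Form N L (r + 2) ℝ) = 0 from (bdryₗ N L (r + 1) ℝ).map_zero,
    show extDeriv (0 : Form N L r ℝ) = 0 from (extDerivₗ N L r ℝ).map_zero, sub_self, eq_comm,
    mul_eq_zero] at laplacian
  exact laplacian.resolve_left (pow_ne_zero _ (by norm_num))

lemma exists_eq_meanForm_add_extDeriv (f : Form N L (r + 1) ℝ) (hf : extDeriv f = 0) :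
    ∃ A : Form N L r ℝ, f = meanForm f + extDeriv A := by
  obtain ⟨A, hA⟩ := projRange_mem (extDerivₗ N L r ℝ) f
  set g := f - projRange (extDerivₗ N L r ℝ) f with hg
  have decomposition : f = g + extDeriv A := by
    rw [hg, hA]
    simp [extDerivₗ]
  have closed : extDeriv g = 0 := by
    rw [hg, hA, extDeriv_sub, hf, zero_sub, neg_eq_zero]
    exact extDeriv_extDeriv A
  have coclosed : bdry g = 0 := by
    apply eq_zero_of_dot_self
    rw [dot_bdry, show dot g (extDeriv (bdry g)) = 0 from
      dot_sub_projRange (extDerivₗ N L r ℝ) f (bdry g), mul_zero]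
  have harmonic : g = meanForm f := by
    refine Form.ext_coeff fun x S hS => ?_
    have : (N : ℝ) ≠ 0 := Nat.cast_ne_zero.mpr (NeZero.ne N)
    rw [coeff_meanForm, decomposition]
    simp only [Form.coeff_add, Finset.sum_add_distrib, sum_coeff_extDeriv, add_zero]
    rw [Finset.sum_congr rfl fun y _ =>
      coeff_eq_of_extDeriv_eq_zero_of_bdry_eq_zero closed coclosed hS y x]
    simp [card_site, this]
  exact ⟨A, harmonic ▸ decomposition⟩

end Harmonic

/-! ### Fluxes -/

/-- Fluxes through the six coordinate planes, grouped in three pairs of complementary planes. -/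
abbrev Flux (K : Type) : Type := (K × K) × (K × K) × (K × K)

/-- The intersection pairing of fluxes. -/
def Flux.wedge {K : Type} [CommRing K] (y z : Flux K) : K :=
  (y.1.1 * z.1.2 + y.1.2 * z.1.1) + (y.2.1.1 * z.2.1.2 + y.2.1.2 * z.2.1.1) +
    (y.2.2.1 * z.2.2.2 + y.2.2.2 * z.2.2.1)

/-- The euclidean pairing of fluxes. -/
def Flux.inner {K : Type} [CommRing K] (y z : Flux K) : K :=
  (y.1.1 * z.1.1 + y.1.2 * z.1.2) + (y.2.1.1 * z.2.1.1 + y.2.1.2 * z.2.1.2) +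
    (y.2.2.1 * z.2.2.1 + y.2.2.2 * z.2.2.2)

section Fluxes

variable {N : ℕ} [NeZero N] {L : Lattice} {r : ℕ}

/-- The flux of a `2`-form through the plane with directions `S`, averaged over the parallel
planes: each of the `N²` planes contributes the sum of `f` over its plaquettes. -/
def planeFlux (f : Form N L r ℝ) (S : Finset (Fin 4)) : ℝ := ((N : ℝ) ^ 2)⁻¹ * ∑ x, f.coeff x S

/-- The mean fluxes of a `2`-form through the coordinate planes. The orientations are such that the
two planes of each pair intersect positively, which gives the minus sign for the plane `{1, 3}`. -/
def flux (f : Form N L 2 ℝ) : Flux ℝ :=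
  ((planeFlux f {0, 1}, planeFlux f {2, 3}), (planeFlux f {0, 2}, -planeFlux f {1, 3}),
    (planeFlux f {0, 3}, planeFlux f {1, 2}))

lemma planeFlux_add (f g : Form N L r ℝ) (S : Finset (Fin 4)) :
    planeFlux (f + g) S = planeFlux f S + planeFlux g S := by
  simp [planeFlux, Finset.sum_add_distrib, mul_add]

lemma planeFlux_smul (a : ℝ) (f : Form N L r ℝ) (S : Finset (Fin 4)) :
    planeFlux (a • f) S = a * planeFlux f S := by
  simp only [planeFlux, Form.coeff_smul, ← Finset.mul_sum]
  ring

lemma planeFlux_meanForm (f : Form N L r ℝ) (S : Finset (Fin 4)) :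
    planeFlux (meanForm f) S = planeFlux f S := by
  simp [planeFlux, card_site, NeZero.ne N]

lemma flux_add (f g : Form N L 2 ℝ) : flux (f + g) = flux f + flux g := by
  simp only [flux, planeFlux_add, neg_add, Prod.mk_add_mk]

lemma flux_smul (a : ℝ) (f : Form N L 2 ℝ) : flux (a • f) = a • flux f := by
  simp [flux, planeFlux_smul]

lemma flux_extDeriv (A : Form N L 1 ℝ) : flux (extDeriv A) = 0 := by
  simp [flux, planeFlux]

lemma flux_bdry (B : Form N L 3 ℝ) : flux (bdry B) = 0 := by
  simp [flux, planeFlux]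

lemma flux_meanForm (f : Form N L 2 ℝ) : flux (meanForm f) = flux f := by
  simp only [flux, planeFlux_meanForm]

variable {p q : ℕ}

lemma correlation_meanForm_left (f : Form N L p ℝ) (g : Form N L q ℝ) (U V : Finset (Fin 4))
    (w : Fin 4 → ZMod N) :
    correlation (meanForm f) g U V w = planeFlux f U * planeFlux g V := by
  simp only [correlation, coeff_meanForm, ← Finset.mul_sum, planeFlux,
    sum_shift (fun x : Site N L => g.coeff x V)]
  field_simp

lemma correlation_meanForm_right (f : Form N L p ℝ) (g : Form N L q ℝ) (U V : Finset (Fin 4))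
    (w : Fin 4 → ZMod N) :
    correlation f (meanForm g) U V w = planeFlux f U * planeFlux g V := by
  rw [correlation_swap, correlation_meanForm_left, mul_comm]

lemma sum_powersetCard_two {M : Type*} [AddCommMonoid M] (φ : Finset (Fin 4) → M) :
    ∑ S ∈ Finset.powersetCard 2 Finset.univ, φ S =
      (φ {0, 1} + φ {2, 3}) + (φ {0, 2} + φ {1, 3}) + (φ {0, 3} + φ {1, 2}) := by
  have planes : Finset.powersetCard 2 (Finset.univ : Finset (Fin 4)) =
      {{0, 1}, {2, 3}, {0, 2}, {1, 3}, {0, 3}, {1, 2}} := by decide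
  rw [planes]
  iterate 5 rw [Finset.sum_insert (by decide)]
  rw [Finset.sum_singleton]
  abel

lemma sum_shuffleSign_mul_planeFlux (f g : Form N L 2 ℝ) :
    ∑ U ∈ Finset.powersetCard 2 Finset.univ, shuffleSign ℝ U (Finset.univ \ U) *
      (planeFlux f U * planeFlux g (Finset.univ \ U)) = (flux f).wedge (flux g) := by
  rw [sum_powersetCard_two]
  have sign (S : Finset (Fin 4)) (ε : ℤ) (h : shuffleSign ℤ S (Finset.univ \ S) = ε) :
      shuffleSign ℝ S (Finset.univ \ S) = ε := by rw [← intCast_shuffleSign, h]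
  rw [sign {0, 1} 1 (by decide), sign {2, 3} 1 (by decide), sign {0, 2} (-1) (by decide),
    sign {1, 3} (-1) (by decide), sign {0, 3} 1 (by decide), sign {1, 2} 1 (by decide),
    show (Finset.univ \ {0, 1} : Finset (Fin 4)) = {2, 3} by decide,
    show (Finset.univ \ {2, 3} : Finset (Fin 4)) = {0, 1} by decide,
    show (Finset.univ \ {0, 2} : Finset (Fin 4)) = {1, 3} by decide,
    show (Finset.univ \ {1, 3} : Finset (Fin 4)) = {0, 2} by decide,
    show (Finset.univ \ {0, 3} : Finset (Fin 4)) = {1, 2} by decide,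
    show (Finset.univ \ {1, 2} : Finset (Fin 4)) = {0, 3} by decide]
  push_cast
  simp only [flux, Flux.wedge]
  ring

lemma total_cup_meanForm_left (f g : Form N L 2 ℝ) :
    total (cup (meanForm f) g) = (flux f).wedge (flux g) := by
  rw [total_eq, sum_coeff_cup _ _ (Finset.card_fin 4)]
  simp only [correlation_meanForm_left, sum_shuffleSign_mul_planeFlux]

lemma total_cup_meanForm_right (f g : Form N L 2 ℝ) :
    total (cup f (meanForm g)) = (flux f).wedge (flux g) := by
  rw [total_eq, sum_coeff_cup _ _ (Finset.card_fin 4)]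
  simp only [correlation_meanForm_right, sum_shuffleSign_mul_planeFlux]

lemma dot_meanForm_left (f g : Form N L 2 ℝ) :
    dot (meanForm f) g = (flux f).inner (flux g) := by
  rw [dot_eq_sum_correlation, sum_powersetCard_two]
  simp only [correlation_meanForm_left, flux, Flux.inner]
  ring

lemma total_cup_of_closed (f g : Form N L 2 ℝ) (hf : extDeriv f = 0) (hg : extDeriv g = 0) :
    total (cup f g) = (flux f).wedge (flux g) := by
  obtain ⟨A, hA⟩ := exists_eq_meanForm_add_extDeriv f hf
  conv_lhs => rw [hA]
  rw [cup_add_left, total_add, total_cup_meanForm_left, total_cup_extDeriv_left,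
    show extDeriv g = (0 : Form N L 3 ℝ) from hg, cup_zero_right,
    show total (0 : Form N L (1 + 3) ℝ) = 0 from total_zero, add_zero]

end Fluxes

/-! ### Hodge duals -/

section Star

variable {N : ℕ} {L : Lattice} {p q : ℕ}

/-- The Hodge dual that represents the functional `f ↦ ∑ f ∪ w` by the inner product. -/
def rightStar (w : Form N L q ℝ) : Form N L p ℝ := fun c =>
  shuffleSign ℝ c.2.1 c.2.1ᶜ * w.coeff (c.1.shift (vec c.2.1)) c.2.1ᶜ

/-- The Hodge dual that represents the functional `f ↦ ∑ w ∪ f` by the inner product. -/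
def leftStar (w : Form N L q ℝ) : Form N L p ℝ := fun c =>
  shuffleSign ℝ c.2.1ᶜ c.2.1 * w.coeff (c.1.shift (-vec c.2.1ᶜ)) c.2.1ᶜ

lemma coeff_rightStar (w : Form N L q ℝ) (x : Site N L) {S : Finset (Fin 4)} (h : S.card = p) :
    (rightStar w : Form N L p ℝ).coeff x S =
      shuffleSign ℝ S Sᶜ * w.coeff (x.shift (vec S)) Sᶜ := by
  rw [Form.coeff_of_card _ _ _ h]
  rfl

lemma coeff_leftStar (w : Form N L q ℝ) (x : Site N L) {S : Finset (Fin 4)} (h : S.card = p) :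
    (leftStar w : Form N L p ℝ).coeff x S =
      shuffleSign ℝ Sᶜ S * w.coeff (x.shift (-vec Sᶜ)) Sᶜ := by
  rw [Form.coeff_of_card _ _ _ h]
  rfl

lemma shuffleSign_compl_mul_compl_singleton {K : Type} [CommRing K] {S : Finset (Fin 4)}
    {ν : Fin 4} (hν : ν ∈ S) : shuffleSign K S Sᶜ * shuffleSign K Sᶜ {ν} =
      -(shuffleSign K {ν} (S.erase ν) * shuffleSign K (S.erase ν) (insert ν Sᶜ)) := by
  have hνS : ν ∉ S.erase ν := Finset.notMem_erase ν S
  have hνSc : ν ∉ Sᶜ := by simpa using hν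
  have insert_left := shuffleSign_insert_left (K := K) hνS Sᶜ
  rw [Finset.insert_erase hν] at insert_left
  have insert_right := shuffleSign_insert_right (K := K) (S.erase ν) hνSc
  have swap_erase := shuffleSign_mul_swap (K := K) (Finset.disjoint_singleton_left.mpr hνS)
  have swap_compl := shuffleSign_mul_swap (K := K) (Finset.disjoint_singleton_left.mpr hνSc)
  have parity : (-1 : K) ^ Sᶜ.card = -(-1) ^ (S.erase ν).card := by
    have card_add := Finset.card_add_card_compl S
    rw [Fintype.card_fin, ← Finset.card_erase_add_one hν] at card_add
    have := Finset.card_le_univ (S.erase ν)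
    rw [show Sᶜ.card = 3 - (S.erase ν).card by omega]
    rw [Fintype.card_fin] at this
    interval_cases (S.erase ν).card <;> norm_num at card_add ⊢
    omega
  rw [Finset.card_singleton, one_mul] at swap_erase swap_compl
  rw [insert_left, insert_right]
  linear_combination shuffleSign K (S.erase ν) Sᶜ * (swap_compl + swap_erase + parity)

lemma rightStar_bdry {r : ℕ} (hr : r + 1 + q = 4) (B : Form N L (q + 1) ℝ) :
    (rightStar (bdry B) : Form N L (r + 1) ℝ) = (-1 : ℝ) • extDeriv (rightStar B) := by
  refine Form.ext_coeff fun x S hS => ?_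
  have hSc : Sᶜ.card = q := by rw [Finset.card_compl, Fintype.card_fin]; omega
  rw [coeff_rightStar _ _ hS, coeff_bdry _ _ hSc, Form.coeff_smul, coeff_extDeriv _ _ hS,
    compl_compl, Finset.mul_sum, Finset.mul_sum]
  refine Finset.sum_congr rfl fun ν hν => ?_
  have hcard : (S.erase ν).card = r := by rw [Finset.card_erase_of_mem hν, hS]; rfl
  have hvec : (vec S : Fin 4 → ZMod N) = vec {ν} + vec (S.erase ν) := by
    rw [← vec_insert (Finset.notMem_erase ν S), Finset.insert_erase hν]
  rw [coeff_rightStar _ _ hcard, coeff_rightStar _ _ hcard, Finset.compl_erase, Site.shift_shift,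
    Site.shift_shift, ← hvec,
    show (vec S + -vec {ν} : Fin 4 → ZMod N) = vec (S.erase ν) by rw [hvec]; abel]
  linear_combination (B.coeff (x.shift (vec S)) (insert ν Sᶜ) -
    B.coeff (x.shift (vec (S.erase ν))) (insert ν Sᶜ)) *
      shuffleSign_compl_mul_compl_singleton (K := ℝ) hν

lemma leftStar_bdry {r : ℕ} (hr : r + 1 + q = 4) (B : Form N L (q + 1) ℝ) :
    (leftStar (bdry B) : Form N L (r + 1) ℝ) = extDeriv (leftStar B) := by
  refine Form.ext_coeff fun x S hS => ?_
  have hSc : Sᶜ.card = q := by rw [Finset.card_compl, Fintype.card_fin]; omega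
  rw [coeff_leftStar _ _ hS, coeff_bdry _ _ hSc, coeff_extDeriv _ _ hS,
    compl_compl, Finset.mul_sum]
  refine Finset.sum_congr rfl fun ν hν => ?_
  have hνSc : ν ∉ Sᶜ := by simpa using hν
  have hcard : (S.erase ν).card = r := by rw [Finset.card_erase_of_mem hν, hS]; rfl
  have hvec : (-vec (insert ν Sᶜ) : Fin 4 → ZMod N) = -vec Sᶜ + -vec {ν} := by
    rw [vec_insert hνSc, neg_add_rev]
  rw [coeff_leftStar _ _ hcard, coeff_leftStar _ _ hcard, Finset.compl_erase,
    shuffleSign_eq_mul_erase_right Sᶜ hν, shuffleSign_insert_left hνSc, Site.shift_shift,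
    Site.shift_shift, hvec,
    show (vec {ν} + (-vec Sᶜ + -vec {ν}) : Fin 4 → ZMod N) = -vec Sᶜ by abel]
  linear_combination shuffleSign ℝ Sᶜ (S.erase ν) *
    (B.coeff (x.shift (-vec Sᶜ)) (insert ν Sᶜ) -
      B.coeff (x.shift (-vec Sᶜ + -vec {ν})) (insert ν Sᶜ)) *
    (shuffleSign_mul_self (K := ℝ) Sᶜ {ν} - shuffleSign_mul_self (K := ℝ) {ν} (S.erase ν))

variable [NeZero N]

lemma sum_powersetCard_compl {M : Type*} [AddCommMonoid M] (hpq : p + q = 4)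
    (φ : Finset (Fin 4) → M) :
    ∑ S ∈ Finset.powersetCard p Finset.univ, φ Sᶜ =
      ∑ S ∈ Finset.powersetCard q Finset.univ, φ S := by
  refine Finset.sum_nbij' compl compl ?_ ?_ ?_ ?_ ?_ <;>
    simp +contextual [Finset.mem_powersetCard, Finset.card_compl] <;> omega

lemma dot_rightStar_rightStar (hpq : p + q = 4) (f g : Form N L q ℝ) :
    dot (rightStar f : Form N L p ℝ) (rightStar g) = dot f g := by
  rw [dot_eq_sum_correlation, dot_eq_sum_correlation, ← sum_powersetCard_compl hpq]
  refine Finset.sum_congr rfl fun S hS => ?_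
  have hS' := (Finset.mem_powersetCard.mp hS).2
  simp only [correlation, Site.shift_zero]
  rw [← sum_shift (fun x => f.coeff x Sᶜ * g.coeff x Sᶜ) (vec S)]
  refine Finset.sum_congr rfl fun x _ => ?_
  rw [coeff_rightStar _ _ hS', coeff_rightStar _ _ hS', mul_mul_mul_comm, shuffleSign_mul_self,
    one_mul]

lemma dot_leftStar_leftStar (hpq : p + q = 4) (f g : Form N L q ℝ) :
    dot (leftStar f : Form N L p ℝ) (leftStar g) = dot f g := by
  rw [dot_eq_sum_correlation, dot_eq_sum_correlation, ← sum_powersetCard_compl hpq]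
  refine Finset.sum_congr rfl fun S hS => ?_
  have hS' := (Finset.mem_powersetCard.mp hS).2
  simp only [correlation, Site.shift_zero]
  rw [← sum_shift (fun x => f.coeff x Sᶜ * g.coeff x Sᶜ) (-vec Sᶜ)]
  refine Finset.sum_congr rfl fun x _ => ?_
  rw [coeff_leftStar _ _ hS', coeff_leftStar _ _ hS', mul_mul_mul_comm, shuffleSign_mul_self,
    one_mul]

lemma total_cup_eq_dot_rightStar (f w : Form N L 2 ℝ) :
    total (cup f w) = dot f (rightStar w) := by
  rw [total_eq, sum_coeff_cup f w (Finset.card_fin 4), dot_eq_sum_correlation]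
  refine Finset.sum_congr rfl fun S hS => ?_
  simp only [correlation, Finset.mul_sum]
  refine Finset.sum_congr rfl fun x _ => ?_
  rw [Site.shift_zero, coeff_rightStar _ _ (Finset.mem_powersetCard.mp hS).2,
    ← Finset.compl_eq_univ_sdiff]
  ring

lemma total_cup_eq_dot_leftStar (f w : Form N L 2 ℝ) :
    total (cup w f) = dot f (leftStar w) := by
  rw [total_eq, sum_coeff_cup w f (Finset.card_fin 4), dot_eq_sum_correlation,
    ← sum_powersetCard_compl (p := 2) rfl]
  refine Finset.sum_congr rfl fun S hS => ?_
  rw [← Finset.compl_eq_univ_sdiff, compl_compl, correlation_swap]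
  simp only [correlation, Finset.mul_sum]
  refine Finset.sum_congr rfl fun x _ => ?_
  rw [Site.shift_zero, coeff_leftStar _ _ (Finset.mem_powersetCard.mp hS).2]
  ring

end Star

/-! ### Transport between lattices -/

section Transport

variable {N : ℕ} {L : Lattice} {r : ℕ} {K : Type} [CommRing K] (v : Fin 4 → ZMod N)

/-- The pull-back of a form under the translation by `v`, from a lattice to another one. -/
def transport (L' : Lattice) (α : Form N L r K) : Form N L' r K :=
  fun c => α (⟨c.1.coord + v⟩, c.2)

variable {L' : Lattice}

@[simp] lemma coeff_transport (α : Form N L r K) (x : Site N L') (S : Finset (Fin 4)) :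
    (transport v L' α).coeff x S = α.coeff ⟨x.coord + v⟩ S := rfl

lemma mk_coord_shift_add (x : Site N L') (a : Fin 4 → ZMod N) :
    (⟨(x.shift a).coord + v⟩ : Site N L) = Site.shift ⟨x.coord + v⟩ a := by
  ext
  simp only [Site.shift, Pi.add_apply]
  ring

lemma extDeriv_transport (α : Form N L r K) :
    extDeriv (transport v L' α) = transport v L' (extDeriv α) := by
  funext c
  simp [extDeriv, transport, mk_coord_shift_add]

lemma bdry_transport (α : Form N L (r + 1) K) :
    bdry (transport v L' α) = transport v L' (bdry α) := by
  funext c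
  simp only [bdry, coeff_transport, mk_coord_shift_add]
  rfl

lemma cup_transport {p q : ℕ} (α : Form N L p K) (β : Form N L q K) :
    cup (transport v L' α) (transport v L' β) = transport v L' (cup α β) := by
  funext c
  simp only [cup, coeff_transport, mk_coord_shift_add]
  rfl

lemma cupOne_transport {p q : ℕ} (α : Form N L (p + 1) K) (β : Form N L (q + 1) K) :
    cupOne (transport v L' α) (transport v L' β) = transport v L' (cupOne α β) := by
  refine Form.ext_coeff fun x S hS => ?_
  rw [coeff_transport, coeff_cupOne _ _ _ hS, coeff_cupOne _ _ _ hS]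
  simp only [coeff_transport, mk_coord_shift_add]

lemma toReal_transport (n : Form N L r ℤ) :
    (transport v L' n).toReal = transport v L' n.toReal := rfl

lemma transport_sub (α β : Form N L r K) :
    transport v L' (α - β) = transport v L' α - transport v L' β := rfl

omit [CommRing K] in
lemma transport_transport_neg (α : Form N L' r K) :
    transport v L' (transport (-v) L α) = α := by
  funext c
  simp [transport]

variable [NeZero N]

lemma sum_translate {M : Type*} [AddCommMonoid M] (g : Site N L → M) :
    ∑ x : Site N L', g ⟨x.coord + v⟩ = ∑ x, g x :=
  Equiv.sum_comp
    { toFun := fun x : Site N L' => (⟨x.coord + v⟩ : Site N L)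
      invFun := fun x => ⟨x.coord - v⟩
      left_inv := fun x => by ext; simp
      right_inv := fun x => by ext; simp } g

lemma total_transport (α : Form N L 4 K) : total (transport v L' α) = total α := by
  simp only [total_eq, coeff_transport]
  exact sum_translate v fun x => α.coeff x Finset.univ

lemma dot_transport (α β : Form N L r K) :
    dot (transport v L' α) (transport v L' β) = dot α β := by
  simp only [dot_eq, coeff_transport]
  exact sum_translate v fun x => ∑ S ∈ Finset.powersetCard r Finset.univ,
    α.coeff x S * β.coeff x S

lemma planeFlux_transport (f : Form N L r ℝ) (S : Finset (Fin 4)) :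
    planeFlux (transport v L' f) S = planeFlux f S := by
  simp only [planeFlux, coeff_transport]
  rw [sum_translate v fun x => f.coeff x S]

lemma flux_transport (f : Form N L 2 ℝ) : flux (transport v L' f) = flux f := by
  simp only [flux, planeFlux_transport]

lemma projBdry_mem (α : Form N L 2 ℝ) : ∃ B, projBdry α = bdry B :=
  projRange_mem (bdryₗ N L 2 ℝ) α

lemma dot_sub_projBdry (α : Form N L 2 ℝ) (B : Form N L 3 ℝ) :
    dot (α - projBdry α) (bdry B) = 0 :=
  dot_sub_projRange (bdryₗ N L 2 ℝ) α B

lemma projBdry_eq_of_forall_dot_eq_zero {α : Form N L 2 ℝ} {B : Form N L 3 ℝ}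
    (orthogonal : ∀ B', dot (α - bdry B) (bdry B') = 0) : projBdry α = bdry B := by
  obtain ⟨B₀, hB₀⟩ := projBdry_mem α
  have difference_mem : projBdry α - bdry B = bdry (B₀ + (-1 : ℝ) • B) := by
    rw [bdry_add, bdry_smul, hB₀, neg_one_smul, sub_eq_add_neg]
  have difference_eq : projBdry α - bdry B = (α - bdry B) + (-1 : ℝ) • (α - projBdry α) := by
    rw [neg_one_smul]
    abel
  rw [← sub_eq_zero]
  apply eq_zero_of_dot_self
  nth_rw 2 [difference_mem]
  rw [difference_eq, dot_add_left, dot_smul_left, orthogonal, dot_sub_projBdry]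
  ring

lemma projBdry_transport (α : Form N L 2 ℝ) :
    projBdry (transport v L' α) = transport v L' (projBdry α) := by
  obtain ⟨B, hB⟩ := projBdry_mem α
  rw [hB, ← bdry_transport]
  refine projBdry_eq_of_forall_dot_eq_zero fun B' => ?_
  rw [← transport_transport_neg (L := L) v B', bdry_transport, bdry_transport, ← transport_sub,
    dot_transport, ← hB, dot_sub_projBdry]

lemma uOf_transport (l : Form N L 2 ℤ) : uOf (transport v L' l) = uOf l := by
  simp only [uOf, toReal_transport, projBdry_transport, extDeriv_transport]
  rw [cupOne_transport]
  exact total_transport v _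

end Transport

/-! ### Decomposition of the field strength -/

section Pairing

variable {N : ℕ} {L : Lattice} [NeZero N] (s : Bool)

section CommRing

variable {K : Type} [CommRing K]

/-- The pairing `∑ f ∪ g` (`s = true`) or `∑ g ∪ f` (`s = false`) of two-forms; the two orders
belong to the two framings of a loop. -/
def pairing (f g : Form N L 2 K) : K :=
  if s then total (cup f g) else total (cup g f)

lemma pairing_true (f g : Form N L 2 K) : pairing true f g = total (cup f g) := rfl

lemma pairing_false (f g : Form N L 2 K) : pairing false f g = total (cup g f) := rfl

lemma pairing_not (f g : Form N L 2 K) : pairing (!s) f g = pairing s g f := by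
  cases s <;> rfl

lemma pairing_add_left (f f' g : Form N L 2 K) :
    pairing s (f + f') g = pairing s f g + pairing s f' g := by
  cases s <;> simp only [pairing, cup_add_left, cup_add_right] <;> exact total_add _ _

lemma pairing_smul_left (a : K) (f g : Form N L 2 K) :
    pairing s (a • f) g = a * pairing s f g := by
  cases s <;> simp only [pairing, cup_smul_left, cup_smul_right] <;> exact total_smul _ _

lemma pairing_add_right (f g g' : Form N L 2 K) :
    pairing s f (g + g') = pairing s f g + pairing s f g' := by
  simp only [← pairing_not s _ f, pairing_add_left]

lemma pairing_smul_right (a : K) (f g : Form N L 2 K) :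
    pairing s f (a • g) = a * pairing s f g := by
  simp only [← pairing_not s _ f, pairing_smul_left]

lemma total_cupOne_extDeriv_eq_pairing_sub {f : Form N L 2 K} (hf : extDeriv f = 0)
    (g : Form N L 2 K) :
    total (cupOne f (extDeriv g)) = pairing true f g - pairing false f g :=
  total_cupOne_extDeriv_of_closed hf g

lemma pairing_transport (v : Fin 4 → ZMod N) (L' : Lattice)
    (f g : Form N L 2 K) : pairing s (transport v L' f) (transport v L' g) = pairing s f g := by
  cases s
  · rw [pairing_false, pairing_false, cup_transport]
    exact total_transport v _
  · rw [pairing_true, pairing_true, cup_transport]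
    exact total_transport v _

end CommRing

lemma pairing_toReal (n m : Form N L 2 ℤ) :
    pairing s n.toReal m.toReal = (pairing s n m : ℤ) := by
  cases s <;> simp only [pairing, cup_toReal] <;> exact total_toReal _

lemma Flux.wedge_comm {K : Type} [CommRing K] (y z : Flux K) : y.wedge z = z.wedge y := by
  simp only [Flux.wedge]
  ring

lemma pairing_of_closed (f g : Form N L 2 ℝ) (hf : extDeriv f = 0) (hg : extDeriv g = 0) :
    pairing s f g = (flux f).wedge (flux g) := by
  cases s
  · rw [pairing_false, total_cup_of_closed _ _ hg hf, Flux.wedge_comm]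
  · rw [pairing_true, total_cup_of_closed _ _ hf hg]

lemma pairing_meanForm_left (f g : Form N L 2 ℝ) :
    pairing s (meanForm f) g = (flux f).wedge (flux g) := by
  cases s
  · rw [pairing_false, total_cup_meanForm_right, Flux.wedge_comm]
  · rw [pairing_true, total_cup_meanForm_left]

lemma exists_pairing_bdry_eq_dot_extDeriv (B : Form N L 3 ℝ) : ∃ A : Form N L 1 ℝ,
    (∀ f, pairing s f (bdry B) = dot f (extDeriv A)) ∧
      dot (extDeriv A) (extDeriv A) = dot (bdry B) (bdry B) := by
  cases s
  · refine ⟨leftStar B, fun f => ?_, ?_⟩ <;> rw [← leftStar_bdry rfl]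
    · exact total_cup_eq_dot_leftStar f _
    · exact dot_leftStar_leftStar rfl _ _
  · refine ⟨(-1 : ℝ) • rightStar B, fun f => ?_, ?_⟩ <;> rw [extDeriv_smul, ← rightStar_bdry rfl]
    · exact total_cup_eq_dot_rightStar f _
    · exact dot_rightStar_rightStar rfl _ _

lemma dot_bdry_of_closed (B : Form N L 3 ℝ) {f : Form N L 2 ℝ} (hf : extDeriv f = 0) :
    dot (bdry B) f = 0 := by
  rw [dot_bdry_two, hf]
  simp [dot]

lemma pairing_bdry_self (B : Form N L 3 ℝ) : pairing s (bdry B) (bdry B) = 0 := by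
  obtain ⟨A, hA, -⟩ := exists_pairing_bdry_eq_dot_extDeriv s B
  rw [hA, dot_bdry_of_closed _ (extDeriv_extDeriv A)]

end Pairing

section Decomposition

variable {N : ℕ} {L : Lattice} [NeZero N] (l : Form N L 2 ℤ) (s : Bool)

/-- The closed part `l - P_∂ l` of an integer form. -/
def closedPart : Form N L 2 ℝ := l.toReal - projBdry l.toReal

lemma toReal_eq_projBdry_add_closedPart : l.toReal = projBdry l.toReal + closedPart l := by
  rw [closedPart, add_sub_cancel]

lemma extDeriv_closedPart : extDeriv (closedPart l) = 0 := by
  apply eq_zero_of_dot_self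
  have orthogonal := dot_sub_projBdry l.toReal (extDeriv (closedPart l))
  rw [dot_comm, dot_bdry_two] at orthogonal
  exact neg_eq_zero.mp orthogonal

lemma extDeriv_projBdry : extDeriv (projBdry l.toReal) = extDeriv l.toReal := by
  conv_rhs => rw [toReal_eq_projBdry_add_closedPart, extDeriv_add, extDeriv_closedPart, add_zero]

lemma flux_projBdry : flux (projBdry l.toReal) = 0 := by
  obtain ⟨B, hB⟩ := projBdry_mem l.toReal
  rw [hB, flux_bdry]

lemma flux_closedPart : flux (closedPart l) = flux l.toReal := by
  conv_rhs => rw [toReal_eq_projBdry_add_closedPart, flux_add, flux_projBdry, zero_add]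

lemma pairing_projBdry_self : pairing s (projBdry l.toReal) (projBdry l.toReal) = 0 := by
  obtain ⟨B, hB⟩ := projBdry_mem l.toReal
  rw [hB, pairing_bdry_self]

/-- The pairing of `P_∂ l` and `l - P_∂ l`, by which the framing enters the topological terms. -/
def crossPairing : ℝ := pairing s (projBdry l.toReal) (closedPart l)

/-- The square `(P_∂ l)²`. -/
def normSq : ℝ := dot (projBdry l.toReal) (projBdry l.toReal)

lemma pontryagin_eq (n : Form N L 2 ℤ) :
    pontryagin n = pairing true n n + total (cupOne n (extDeriv n)) :=
  rfl

lemma total_cupOne_self : ((total (cupOne l (extDeriv l)) : ℤ) : ℝ) =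
    uOf l + crossPairing l false - crossPairing l true := by
  rw [← total_cupOne_toReal, ← extDeriv_toReal, ← extDeriv_projBdry]
  nth_rw 1 [toReal_eq_projBdry_add_closedPart]
  rw [total_cupOne_add_left, total_cupOne_extDeriv_eq_pairing_sub (extDeriv_closedPart l),
    ← pairing_not true (projBdry l.toReal), ← pairing_not false (projBdry l.toReal), Bool.not_true,
    Bool.not_false, uOf, crossPairing, crossPairing]
  ring

lemma exists_int_crossPairing : ∃ z : ℤ,
    crossPairing l true = crossPairing l false + uOf l - z := by
  refine ⟨total (cupOne l (extDeriv l)), ?_⟩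
  rw [total_cupOne_self]
  ring

lemma pairing_self : ((pairing true l l : ℤ) : ℝ) =
    crossPairing l true + crossPairing l false + (flux l.toReal).wedge (flux l.toReal) := by
  rw [← pairing_toReal]
  conv_lhs => rw [toReal_eq_projBdry_add_closedPart]
  rw [pairing_add_left, pairing_add_right, pairing_add_right, pairing_projBdry_self,
    pairing_of_closed true _ _ (extDeriv_closedPart l) (extDeriv_closedPart l), flux_closedPart,
    ← pairing_not true (projBdry l.toReal), Bool.not_true, crossPairing, crossPairing]
  ring

lemma wedge_flux_toReal : (flux l.toReal).wedge (flux l.toReal) =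
    vOf l - uOf l - 2 * crossPairing l false := by
  rw [vOf, pontryagin_eq, Int.cast_add, pairing_self, total_cupOne_self]
  ring

lemma normSq_transport (v : Fin 4 → ZMod N) (L' : Lattice) :
    normSq (transport v L' l) = normSq l := by
  rw [normSq, toReal_transport, projBdry_transport, dot_transport, normSq]

lemma crossPairing_transport (v : Fin 4 → ZMod N) (L' : Lattice) :
    crossPairing (transport v L' l) s = crossPairing l s := by
  simp only [crossPairing, closedPart, toReal_transport, projBdry_transport, ← transport_sub,
    pairing_transport]

lemma vOf_transport (v : Fin 4 → ZMod N) (L' : Lattice) : vOf (transport v L' l) = vOf l := by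
  rw [vOf, vOf, pontryagin_eq, pontryagin_eq, pairing_transport, extDeriv_transport,
    cupOne_transport]
  exact congrArg _ (total_transport v (cupOne l (extDeriv l)))

end Decomposition

section FramedCharge

variable {N : ℕ} {L : Lattice} [NeZero N] (s : Bool)

/-- The sign of a framing. -/
def framingSign : ℝ := if s then 1 else -1

/-- The topological charge that belongs to a framing: `Q` (`s = true`) or `Q̃` (`s = false`). -/
def framedCharge (A : Form N L 1 ℝ) (n : Form N L 2 ℤ) : ℝ :=
  if s then charge A n else chargeTilde A n

lemma framedCharge_eq (A : Form N L 1 ℝ) (n : Form N L 2 ℤ) : framedCharge s A n =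
    1 / (8 * Real.pi ^ 2) * pairing true (fieldStrength A n) (fieldStrength A n) +
      framingSign s / (4 * Real.pi) *
        total (cupOne (fieldStrength A n) (extDeriv n.toReal)) := by
  cases s
  · simp only [framedCharge, chargeTilde, framingSign, pairing, Bool.false_eq_true, if_false,
      if_true]
    ring
  · simp only [framedCharge, charge, framingSign, pairing, if_true]

end FramedCharge

/-! ### Field strengths with a given monopole current -/

section Exact

variable {N : ℕ} {L : Lattice} [NeZero N]

/-- The part of a two-form that remains after its mean value is removed; it is exact if the form is
closed. -/
def exactPart (f : Form N L 2 ℝ) : Form N L 2 ℝ := f - meanForm f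

lemma eq_meanForm_add_exactPart (f : Form N L 2 ℝ) : f = meanForm f + exactPart f := by
  simp [exactPart]

lemma exists_exactPart_eq {f : Form N L 2 ℝ} (hf : extDeriv f = 0) :
    ∃ A : Form N L 1 ℝ, exactPart f = extDeriv A := by
  obtain ⟨A, hA⟩ := exists_eq_meanForm_add_extDeriv f hf
  exact ⟨A, sub_eq_iff_eq_add'.mpr hA⟩

lemma flux_exactPart {f : Form N L 2 ℝ} (hf : extDeriv f = 0) : flux (exactPart f) = 0 := by
  obtain ⟨A, hA⟩ := exists_exactPart_eq hf
  rw [hA, flux_extDeriv]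

lemma dot_self_of_closed {f : Form N L 2 ℝ} (hf : extDeriv f = 0) :
    dot f f = (flux f).inner (flux f) + dot (exactPart f) (exactPart f) := by
  have orthogonal : dot (meanForm f) (exactPart f) = 0 := by
    rw [dot_meanForm_left, flux_exactPart hf]
    simp [Flux.inner]
  conv_lhs => rw [eq_meanForm_add_exactPart f]
  rw [dot_add_left, dot_add_right, dot_add_right, dot_comm (exactPart f) (meanForm f), orthogonal,
    dot_meanForm_left, flux_meanForm]
  ring

end Exact

section Field

variable {N : ℕ} {L : Lattice} [NeZero N] (l : Form N L 2 ℤ) (q : ℤ) {f : Form N L 2 ℝ} (s : Bool)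

omit [NeZero N] in
lemma fieldStrength_eq (A : Form N L 1 ℝ) (n : Form N L 2 ℤ) :
    fieldStrength A n = extDeriv A + (2 * Real.pi) • n.toReal := rfl

lemma dot_field_self (hf : extDeriv f = 0) : dot ((2 * Real.pi * q) • projBdry l.toReal + f)
      ((2 * Real.pi * q) • projBdry l.toReal + f) =
    (2 * Real.pi * q) ^ 2 * normSq l + (flux f).inner (flux f) +
      dot (exactPart f) (exactPart f) := by
  obtain ⟨B, hB⟩ := projBdry_mem l.toReal
  have orthogonal : dot (projBdry l.toReal) f = 0 := by rw [hB, dot_bdry_of_closed _ hf]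
  rw [dot_add_left, dot_add_right, dot_add_right, dot_comm f, dot_smul_left, dot_smul_left,
    dot_smul_right, orthogonal, dot_self_of_closed hf, normSq]
  ring

lemma pairing_projBdry_right (f : Form N L 2 ℝ) : pairing s f (projBdry l.toReal) =
    pairing s (exactPart f) (projBdry l.toReal) := by
  conv_lhs => rw [eq_meanForm_add_exactPart f]
  rw [pairing_add_left, pairing_meanForm_left, flux_projBdry]
  simp [Flux.wedge]

lemma pairing_field_toReal (hf : extDeriv f = 0) :
    pairing s ((2 * Real.pi * q) • projBdry l.toReal + f) l.toReal =
      2 * Real.pi * q * crossPairing l s + pairing s (exactPart f) (projBdry l.toReal) +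
        (flux f).wedge (flux l.toReal) := by
  nth_rw 2 [toReal_eq_projBdry_add_closedPart]
  rw [pairing_add_right, pairing_add_left, pairing_add_left, pairing_smul_left, pairing_smul_left,
    pairing_projBdry_self, pairing_projBdry_right,
    pairing_of_closed s _ _ hf (extDeriv_closedPart l), flux_closedPart, crossPairing]
  ring

lemma pairing_field_self (hf : extDeriv f = 0) :
    pairing true ((2 * Real.pi * q) • projBdry l.toReal + f)
      ((2 * Real.pi * q) • projBdry l.toReal + f) =
      2 * Real.pi * q * (pairing true (exactPart f) (projBdry l.toReal) +
        pairing false (exactPart f) (projBdry l.toReal)) + (flux f).wedge (flux f) := by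
  rw [pairing_add_left, pairing_add_right, pairing_add_right, pairing_smul_left,
    pairing_smul_left, pairing_smul_right, pairing_smul_right, pairing_projBdry_self,
    pairing_of_closed true _ _ hf hf, ← pairing_not true f, Bool.not_true,
    pairing_projBdry_right l _ f, pairing_projBdry_right l _ f]
  ring

lemma total_cupOne_field (hf : extDeriv f = 0) :
    total (cupOne ((2 * Real.pi * q) • projBdry l.toReal + f)
      ((q : ℝ) • extDeriv (projBdry l.toReal))) =
      q * (2 * Real.pi * q * uOf l + (pairing true (exactPart f) (projBdry l.toReal) -
        pairing false (exactPart f) (projBdry l.toReal))) := by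
  rw [total_cupOne_smul_right, total_cupOne_add_left, total_cupOne_smul_left,
    total_cupOne_extDeriv_eq_pairing_sub hf, pairing_projBdry_right l true f,
    pairing_projBdry_right l false f, uOf]

lemma framedCharge_field (A : Form N L 1 ℝ) (n : Form N L 2 ℤ) (hf : extDeriv f = 0)
    (hF : fieldStrength A n = (2 * Real.pi * q) • projBdry l.toReal + f)
    (hn : extDeriv n = q • extDeriv l) :
    framedCharge s A n = (flux f).wedge (flux f) / (8 * Real.pi ^ 2) +
      framingSign s * q ^ 2 * uOf l / 2 +
      q / (2 * Real.pi) * pairing s (exactPart f) (projBdry l.toReal) := by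
  have extDeriv_n : extDeriv n.toReal = (q : ℝ) • extDeriv (projBdry l.toReal) := by
    rw [extDeriv_toReal, hn, toReal_smul, extDeriv_projBdry, extDeriv_toReal]
  rw [framedCharge_eq, hF, extDeriv_n, total_cupOne_field l q hf, pairing_field_self l q hf]
  have := Real.pi_ne_zero
  cases s <;> simp only [framingSign, Bool.false_eq_true, if_false, if_true] <;> field_simp <;> ring

end Field

/-! ### Closed integer forms -/

section PlaneForm

variable {N : ℕ} {L : Lattice}

/-- The plane in the directions complementary to `S` through the origin, as the two-form with
components in the directions of `S` that is dual to it. -/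
def planeForm (N : ℕ) (L : Lattice) (S : Finset (Fin 4)) : Form N L 2 ℤ :=
  fun c => if c.2.1 = S ∧ ∀ μ ∈ S, c.1.coord μ = 0 then 1 else 0

lemma coeff_planeForm (S : Finset (Fin 4)) {T : Finset (Fin 4)} (hT : T.card = 2) (x : Site N L) :
    (planeForm N L S).coeff x T = if T = S ∧ ∀ μ ∈ S, x.coord μ = 0 then 1 else 0 := by
  rw [Form.coeff_of_card _ _ _ hT]
  rfl

lemma extDeriv_planeForm (S : Finset (Fin 4)) : extDeriv (planeForm N L S) = 0 := by
  refine Form.ext_coeff fun x T hT => ?_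
  rw [coeff_extDeriv _ _ hT, Form.coeff_zero]
  refine Finset.sum_eq_zero fun μ hμ => ?_
  have card_erase : (T.erase μ).card = 2 := by rw [Finset.card_erase_of_mem hμ, hT]
  have on_plane_iff : (T.erase μ = S ∧ ∀ ν ∈ S, (x.shift (vec {μ})).coord ν = 0) ↔
      (T.erase μ = S ∧ ∀ ν ∈ S, x.coord ν = 0) := by
    refine and_congr_right fun h => forall₂_congr fun ν hν => ?_
    have : ν ≠ μ := Finset.ne_of_mem_erase (h ▸ hν)
    simp [Site.shift, vec, this]
  rw [coeff_planeForm _ card_erase, coeff_planeForm _ card_erase, if_congr on_plane_iff rfl rfl,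
    sub_self, mul_zero]

variable [NeZero N]

lemma card_filter_forall_mem_eq_zero (T : Finset (Fin 4)) :
    (Finset.univ.filter fun x : Fin 4 → ZMod N => ∀ μ ∈ T, x μ = 0).card = N ^ Tᶜ.card := by
  have filter_eq : (Finset.univ.filter fun x : Fin 4 → ZMod N => ∀ μ ∈ T, x μ = 0) =
      Fintype.piFinset fun μ => if μ ∈ T then {0} else Finset.univ := by
    ext x
    simp only [Finset.mem_filter, Finset.mem_univ, true_and, Fintype.mem_piFinset]
    refine forall_congr' fun μ => ?_
    by_cases h : μ ∈ T <;> simp [h]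
  have card_factor (μ : Fin 4) :
      (if μ ∈ T then ({0} : Finset (ZMod N)) else Finset.univ).card =
        if μ ∈ Tᶜ then N else 1 := by
    by_cases h : μ ∈ T <;> simp [h, ZMod.card]
  rw [filter_eq, Fintype.card_piFinset, Finset.prod_congr rfl fun μ _ => card_factor μ,
    Finset.prod_ite_mem, Finset.univ_inter, Finset.prod_const]

lemma planeFlux_planeForm (S : Finset (Fin 4)) {T : Finset (Fin 4)} (hT : T.card = 2) :
    planeFlux (planeForm N L S).toReal T = if T = S then 1 else 0 := by
  simp only [planeFlux, Form.coeff_toReal, coeff_planeForm S hT]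
  split_ifs with h
  · subst h
    have card_plane : ∑ x : Site N L, (((if ∀ μ ∈ T, x.coord μ = 0 then 1 else 0 : ℤ)) : ℝ) =
        (N : ℝ) ^ 2 := by
      have := card_filter_forall_mem_eq_zero (N := N) T
      rw [Finset.card_compl, hT, Finset.card_filter] at this
      push_cast
      exact ((Site.equivCoord N L).sum_comp fun x => if ∀ μ ∈ T, x μ = 0 then (1 : ℝ) else 0).trans
        (by exact_mod_cast this)
    simp only [true_and, card_plane]
    exact inv_mul_cancel₀ (pow_ne_zero 2 (Nat.cast_ne_zero.mpr (NeZero.ne N)))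
  · simp [h]

end PlaneForm

section IntegerForms

variable {N : ℕ} {L : Lattice}

/-- A closed integer form with the given fluxes. -/
def fluxForm (N : ℕ) (L : Lattice) (m : Flux ℤ) : Form N L 2 ℤ :=
  m.1.1 • planeForm N L {0, 1} + m.1.2 • planeForm N L {2, 3} +
  m.2.1.1 • planeForm N L {0, 2} + (-m.2.1.2) • planeForm N L {1, 3} +
  m.2.2.1 • planeForm N L {0, 3} + m.2.2.2 • planeForm N L {1, 2}

/-- Integer fluxes as real fluxes. -/
def Flux.toReal (m : Flux ℤ) : Flux ℝ :=
  ((m.1.1, m.1.2), (m.2.1.1, m.2.1.2), (m.2.2.1, m.2.2.2))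

lemma Flux.toReal_injective : Function.Injective Flux.toReal := by
  rintro ⟨⟨a, b⟩, ⟨c, d⟩, ⟨e, f⟩⟩ ⟨⟨a', b'⟩, ⟨c', d'⟩, ⟨e', f'⟩⟩ h
  simpa [Flux.toReal] using h

lemma extDeriv_fluxForm (m : Flux ℤ) : extDeriv (fluxForm N L m) = 0 := by
  simp only [fluxForm, extDeriv_add, extDeriv_smul, extDeriv_planeForm, smul_zero, add_zero]

variable [NeZero N]

lemma planeFlux_fluxForm (m : Flux ℤ) {T : Finset (Fin 4)} (hT : T.card = 2) :
    planeFlux (fluxForm N L m).toReal T =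
      m.1.1 * (if T = {0, 1} then 1 else 0) + m.1.2 * (if T = {2, 3} then 1 else 0) +
      m.2.1.1 * (if T = {0, 2} then 1 else 0) - m.2.1.2 * (if T = {1, 3} then 1 else 0) +
      m.2.2.1 * (if T = {0, 3} then 1 else 0) + m.2.2.2 * (if T = {1, 2} then 1 else 0) := by
  simp only [fluxForm, toReal_add, toReal_smul, planeFlux_add, planeFlux_smul,
    planeFlux_planeForm _ hT, Int.cast_neg]
  ring

lemma flux_fluxForm (m : Flux ℤ) : flux (fluxForm N L m).toReal = m.toReal := by
  simp only [flux, Flux.toReal]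
  rw [planeFlux_fluxForm m (by decide), planeFlux_fluxForm m (by decide),
    planeFlux_fluxForm m (by decide), planeFlux_fluxForm m (by decide),
    planeFlux_fluxForm m (by decide), planeFlux_fluxForm m (by decide)]
  norm_num +decide

/-- The fluxes of `n` are recovered from its integer pairings with the closed forms of unit flux,
because the pairing of closed forms depends only on their fluxes. -/
lemma exists_flux_eq_toReal {n : Form N L 2 ℤ} (hn : extDeriv n = 0) :
    ∃ m : Flux ℤ, flux n.toReal = m.toReal := by
  have wedge_toReal (m : Flux ℤ) : (flux n.toReal).wedge m.toReal =
      (pairing true n (fluxForm N L m) : ℤ) := by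
    rw [← pairing_toReal, pairing_of_closed true _ _ (extDeriv_toReal_eq_zero hn)
      (extDeriv_toReal_eq_zero (extDeriv_fluxForm m)), flux_fluxForm]
  refine ⟨((pairing true n (fluxForm N L ((0, 1), (0, 0), (0, 0))),
    pairing true n (fluxForm N L ((1, 0), (0, 0), (0, 0)))),
    (pairing true n (fluxForm N L ((0, 0), (0, 1), (0, 0))),
    pairing true n (fluxForm N L ((0, 0), (1, 0), (0, 0)))),
    (pairing true n (fluxForm N L ((0, 0), (0, 0), (0, 1))),
    pairing true n (fluxForm N L ((0, 0), (0, 0), (1, 0))))), ?_⟩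
  simp only [Flux.toReal, ← wedge_toReal]
  simp [Flux.wedge]

lemma exists_pairing_self_eq_two_mul (s : Bool) {n : Form N L 2 ℤ} (hn : extDeriv n = 0) :
    ∃ k : ℤ, pairing s n n = 2 * k := by
  obtain ⟨m, hm⟩ := exists_flux_eq_toReal hn
  have hn' := extDeriv_toReal_eq_zero hn
  refine ⟨m.1.1 * m.1.2 + m.2.1.1 * m.2.1.2 + m.2.2.1 * m.2.2.2, ?_⟩
  have wedge_self := pairing_of_closed s _ _ hn' hn'
  rw [pairing_toReal, hm] at wedge_self
  simp only [Flux.wedge, Flux.toReal] at wedge_self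
  rw [← Int.cast_inj (α := ℝ), wedge_self]
  push_cast
  ring

lemma exists_pontryagin_smul_add_of_closed (l : Form N L 2 ℤ) {n : Form N L 2 ℤ} (q : ℤ)
    (hn : extDeriv n = 0) : ∃ k : ℤ, pontryagin (q • l + n) = q ^ 2 * vOf l + 2 * k := by
  obtain ⟨k, hk⟩ := exists_pairing_self_eq_two_mul true hn
  refine ⟨q * pairing true n l + k, ?_⟩
  have extDeriv_eq : extDeriv (q • l + n) = q • extDeriv l := by
    rw [extDeriv_add, extDeriv_smul, hn, add_zero]
  rw [vOf, pontryagin_eq, pontryagin_eq, extDeriv_eq, total_cupOne_smul_right,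
    total_cupOne_add_left, total_cupOne_smul_left, total_cupOne_extDeriv_eq_pairing_sub hn,
    pairing_add_left, pairing_add_right, pairing_add_right, pairing_smul_left, pairing_smul_left,
    pairing_smul_right, pairing_smul_right, hk, ← pairing_not true n l, Bool.not_true]
  ring

end IntegerForms

/-! ### Theta functions -/

section GaussianWave

lemma summable_exp_neg_sq {c : ℝ} (hc : 0 < c) :
    Summable fun n : ℤ => Real.exp (-c * (n : ℝ) ^ 2) := by
  refine (summable_pow_mul_jacobiTheta₂_term_bound 0 (T := c / Real.pi)
    (div_pos hc Real.pi_pos) 0).congr fun n => ?_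
  have := Real.pi_ne_zero
  rw [pow_zero, one_mul]
  congr 1
  field_simp
  ring

lemma summable_exp_neg_shift_sq {c : ℝ} (hc : 0 < c) (α : ℝ) :
    Summable fun n : ℤ => Real.exp (-c * (n + α) ^ 2) := by
  refine Summable.of_nonneg_of_le (fun n => (Real.exp_pos _).le) (fun n => ?_)
    ((summable_exp_neg_sq (half_pos hc)).mul_left (Real.exp (c * α ^ 2)))
  rw [← Real.exp_add, Real.exp_le_exp]
  nlinarith [mul_nonneg hc.le (sq_nonneg ((n : ℝ) + 2 * α))]

lemma summable_exp_neg_shift_sq_prod {c d : ℝ} (hc : 0 < c) (hd : 0 < d) (α β : ℝ) :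
    Summable fun m : ℤ × ℤ =>
      Real.exp (-c * (m.1 + α) ^ 2) * Real.exp (-d * (m.2 + β) ^ 2) :=
  (summable_exp_neg_shift_sq hc α).mul_of_nonneg (summable_exp_neg_shift_sq hd β)
    (fun _ => (Real.exp_pos _).le) (fun _ => (Real.exp_pos _).le)

/-- The Gaussian `exp(-πAx²)` multiplied by the plane wave `exp(-2πiηx)`. -/
def gaussianWave (A η x : ℝ) : ℂ :=
  Complex.exp (-(Real.pi * A * x ^ 2) - 2 * Real.pi * Complex.I * (η * x))

lemma norm_gaussianWave (A η x : ℝ) :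
    ‖gaussianWave A η x‖ = Real.exp (-(Real.pi * A) * x ^ 2) := by
  rw [gaussianWave, Complex.norm_exp]
  congr 1
  simp [← Complex.ofReal_pow, ← Complex.ofReal_mul]

lemma tsum_gaussianWave_add {A : ℝ} (hA : 0 < A) (η α : ℝ) :
    ∑' m : ℤ, gaussianWave A η (m + α) =
      ((√A)⁻¹ : ℝ) * (Complex.exp (-(2 * Real.pi * Complex.I * (α * η))) *
        ∑' k : ℤ, gaussianWave A⁻¹ (-α) (k + η)) := by
  have hA' : (A : ℂ) ≠ 0 := by exact_mod_cast hA.ne'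
  have hsqrt : (((√A)⁻¹ : ℝ) : ℂ) = 1 / (A : ℂ) ^ (1 / 2 : ℂ) := by
    rw [Real.sqrt_eq_rpow, Complex.ofReal_inv, Complex.ofReal_cpow hA.le, one_div]
    norm_num
  have hleft (m : ℤ) : gaussianWave A η (m + α) =
      Complex.exp (-(Real.pi * A * α ^ 2) - 2 * Real.pi * Complex.I * (η * α)) *
        Complex.exp (-Real.pi * A * (m : ℂ) ^ 2 +
          2 * Real.pi * (-(A * α) - Complex.I * η) * m) := by
    rw [gaussianWave, ← Complex.exp_add]
    congr 1
    push_cast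
    ring
  have hright (k : ℤ) : Complex.exp (-(2 * Real.pi * Complex.I * (α * η))) *
        gaussianWave A⁻¹ (-α) (k + η) =
      Complex.exp (-(Real.pi * A * α ^ 2) - 2 * Real.pi * Complex.I * (η * α)) *
        Complex.exp (-Real.pi / A * (k + Complex.I * (-(A * α) - Complex.I * η)) ^ 2) := by
    rw [gaussianWave, ← Complex.exp_add, ← Complex.exp_add]
    congr 1
    push_cast
    field_simp
    linear_combination (-2 * k * η + 2 * η * A * α * Complex.I + η ^ 2 * (Complex.I ^ 2 - 1) +
      A ^ 2 * α ^ 2) * Complex.I_sq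
  simp only [← tsum_mul_left (a := Complex.exp _), hleft, hright]
  rw [tsum_mul_left, Complex.tsum_exp_neg_quadratic (by simpa using hA), tsum_mul_left, hsqrt]
  ring

end GaussianWave

section PairTheta

/-- The general term of `pairTheta`. -/
def pairThetaTerm (A B : ℝ) (η α : ℝ × ℝ) (m : ℤ × ℤ) : ℂ :=
  gaussianWave A (η.1 + B * (m.2 + α.2)) (m.1 + α.1) * gaussianWave A η.2 (m.2 + α.2)

/-- The theta function `∑ exp(-πA(y₁² + y₂²) - 2πi(B y₁ y₂ + η · y))`, `y ∈ ℤ² + α`. -/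
def pairTheta (A B : ℝ) (η α : ℝ × ℝ) : ℂ := ∑' m, pairThetaTerm A B η α m

/-- The summand of `pairTheta` after Poisson summation in the first variable only: `k` is dual to
`y₁`, while `m` still labels `y₂`. -/
def mixedThetaTerm (A B : ℝ) (η α : ℝ × ℝ) (k m : ℤ) : ℂ :=
  Complex.exp (-(2 * Real.pi * Complex.I * (α.1 * (η.1 + B * (m + α.2))))) *
    gaussianWave A⁻¹ (-α.1) (k + (η.1 + B * (m + α.2))) * gaussianWave A η.2 (m + α.2)

variable {A : ℝ}

lemma summable_norm_pairThetaTerm (hA : 0 < A) (B : ℝ) (η α : ℝ × ℝ) :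
    Summable fun m => ‖pairThetaTerm A B η α m‖ := by
  simp only [pairThetaTerm, norm_mul, norm_gaussianWave]
  have hc := mul_pos Real.pi_pos hA
  exact summable_exp_neg_shift_sq_prod hc hc α.1 α.2

lemma sq_add_sq_eq_completed_square (hA : 0 < A) (B κ y : ℝ) :
    A⁻¹ * (κ + B * y) ^ 2 + A * y ^ 2 =
      A / (A ^ 2 + B ^ 2) * κ ^ 2 +
        (A ^ 2 + B ^ 2) / A * (y + B * κ / (A ^ 2 + B ^ 2)) ^ 2 := by
  have : 0 < A ^ 2 + B ^ 2 := by positivity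
  field_simp
  ring

lemma summable_mixedThetaTerm (hA : 0 < A) (B : ℝ) (η α : ℝ × ℝ) :
    Summable (Function.uncurry (mixedThetaTerm A B η α)) := by
  have := Real.pi_pos
  have : 0 < A ^ 2 + B ^ 2 := by positivity
  refine .of_norm (.of_nonneg_of_le (fun _ => norm_nonneg _) (fun m => ?_)
    (summable_exp_neg_shift_sq_prod (c := Real.pi * (A / (A ^ 2 + B ^ 2)) / 2)
      (d := Real.pi * A / 2) (by positivity) (by positivity) η.1 α.2))
  have hphase (x : ℝ) : ‖Complex.exp (-(2 * Real.pi * Complex.I * x))‖ = 1 := by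
    rw [show -(2 * Real.pi * Complex.I * x) = ((-(2 * Real.pi * x) : ℝ) : ℂ) * Complex.I by
      push_cast; ring, Complex.norm_exp_ofReal_mul_I]
  have hone := hphase (α.1 * (η.1 + B * (m.2 + α.2)))
  push_cast at hone
  simp only [Function.uncurry, mixedThetaTerm, norm_mul, hone, norm_gaussianWave, one_mul,
    ← Real.exp_add, Real.exp_le_exp]
  set κ : ℝ := m.1 + η.1
  set y : ℝ := m.2 + α.2
  have hκ : (m.1 : ℝ) + (η.1 + B * y) = κ + B * y := (add_assoc _ _ _).symm
  have hlow_y : A * y ^ 2 ≤ A⁻¹ * (κ + B * y) ^ 2 + A * y ^ 2 :=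
    le_add_of_nonneg_left (by positivity)
  have hlow_κ : A / (A ^ 2 + B ^ 2) * κ ^ 2 ≤ A⁻¹ * (κ + B * y) ^ 2 + A * y ^ 2 := by
    rw [sq_add_sq_eq_completed_square hA]
    exact le_add_of_nonneg_right (by positivity)
  rw [hκ]
  nlinarith

lemma tsum_pairThetaTerm_left (hA : 0 < A) (B : ℝ) (η α : ℝ × ℝ) (m : ℤ) :
    ∑' m₁ : ℤ, pairThetaTerm A B η α (m₁, m) =
      ((√A)⁻¹ : ℝ) * ∑' k : ℤ, mixedThetaTerm A B η α k m := by
  simp only [pairThetaTerm, mixedThetaTerm]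
  rw [tsum_mul_right, tsum_mul_right, tsum_mul_left, tsum_gaussianWave_add hA]
  push_cast
  ring

lemma mixedThetaTerm_eq (hA : 0 < A) (B : ℝ) (η α : ℝ × ℝ) (k m : ℤ) :
    mixedThetaTerm A B η α k m =
      Complex.exp (-(2 * Real.pi * Complex.I *
          (α.1 * η.1 - B / (A ^ 2 + B ^ 2) * η.2 * (k + η.1)))) *
        gaussianWave (A / (A ^ 2 + B ^ 2)) (-α.1) (k + η.1) *
        gaussianWave ((A ^ 2 + B ^ 2) / A) η.2
          (m + (α.2 + B * (k + η.1) / (A ^ 2 + B ^ 2))) := by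
  have hA' : (A : ℂ) ≠ 0 := by exact_mod_cast hA.ne'
  have hD : (A : ℂ) ^ 2 + (B : ℂ) ^ 2 ≠ 0 := by
    exact_mod_cast (by positivity : 0 < A ^ 2 + B ^ 2).ne'
  simp only [mixedThetaTerm, gaussianWave, ← Complex.exp_add]
  congr 1
  push_cast
  field_simp
  ring

lemma tsum_mixedThetaTerm_right (hA : 0 < A) (B : ℝ) (η α : ℝ × ℝ) (k : ℤ) :
    ∑' m : ℤ, mixedThetaTerm A B η α k m =
      ((√((A ^ 2 + B ^ 2) / A))⁻¹ : ℝ) *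
        (Complex.exp (-(2 * Real.pi * Complex.I * (α.1 * η.1 + α.2 * η.2))) *
          ∑' k₂ : ℤ, pairThetaTerm (A / (A ^ 2 + B ^ 2)) (-B / (A ^ 2 + B ^ 2)) (-α) η
            (k, k₂)) := by
  simp only [mixedThetaTerm_eq hA]
  rw [tsum_mul_left, tsum_gaussianWave_add (by positivity), mul_left_comm, inv_div]
  congr 1
  rw [← tsum_mul_left, ← tsum_mul_left, ← tsum_mul_left]
  refine tsum_congr fun k₂ => ?_
  simp only [pairThetaTerm, gaussianWave, ← Complex.exp_add, Prod.fst_neg, Prod.snd_neg]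
  congr 1
  push_cast
  ring

lemma pairTheta_poisson (hA : 0 < A) (B : ℝ) (η α : ℝ × ℝ) :
    pairTheta A B η α = ((√(A ^ 2 + B ^ 2))⁻¹ : ℝ) *
      (Complex.exp (-(2 * Real.pi * Complex.I * (α.1 * η.1 + α.2 * η.2))) *
        pairTheta (A / (A ^ 2 + B ^ 2)) (-B / (A ^ 2 + B ^ 2)) (-α) η) := by
  have hD : 0 < A ^ 2 + B ^ 2 := by positivity
  have hsum := (summable_norm_pairThetaTerm hA B η α).of_norm
  have hsum' := (summable_norm_pairThetaTerm (div_pos hA hD) (-B / (A ^ 2 + B ^ 2)) (-α) η).of_norm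
  have hsqrt : √A * √((A ^ 2 + B ^ 2) / A) = √(A ^ 2 + B ^ 2) := by
    rw [← Real.sqrt_mul hA.le, mul_div_cancel₀ _ hA.ne']
  calc pairTheta A B η α
      = ∑' m₂ : ℤ, ∑' m₁ : ℤ, pairThetaTerm A B η α (m₁, m₂) := by
        rw [pairTheta, hsum.tsum_prod]
        exact Summable.tsum_comm (α := ℂ) (f := fun m₂ m₁ : ℤ => pairThetaTerm A B η α (m₁, m₂))
          ((Equiv.prodComm ℤ ℤ).summable_iff.mpr hsum)
    _ = ((√A)⁻¹ : ℝ) * ∑' k : ℤ, ∑' m : ℤ, mixedThetaTerm A B η α k m := by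
        simp only [tsum_pairThetaTerm_left hA]
        rw [tsum_mul_left, Summable.tsum_comm (summable_mixedThetaTerm hA B η α)]
    _ = _ := by
        simp only [tsum_mixedThetaTerm_right hA]
        rw [tsum_mul_left, tsum_mul_left, ← hsum'.tsum_prod, ← mul_assoc, ← Complex.ofReal_mul,
          ← mul_inv, hsqrt]
        rfl

lemma pairTheta_neg_swap (A B : ℝ) (η α : ℝ × ℝ) :
    pairTheta A B (-η.swap) (-α.swap) = pairTheta A B η α := by
  rw [pairTheta, pairTheta, ← ((Equiv.prodComm ℤ ℤ).trans (Equiv.neg (ℤ × ℤ))).tsum_eq]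
  refine tsum_congr fun m => ?_
  simp only [pairThetaTerm, gaussianWave, ← Complex.exp_add, Equiv.trans_apply,
    Equiv.prodComm_apply, Equiv.neg_apply, Prod.fst_neg, Prod.snd_neg, Prod.fst_swap,
    Prod.snd_swap]
  congr 1
  push_cast
  ring

end PairTheta

section FluxTheta

lemma Flux.wedge_smul_left {K : Type} [CommRing K] (a : K) (y z : Flux K) :
    (a • y).wedge z = a * y.wedge z := by
  simp only [Flux.wedge, Prod.smul_fst, Prod.smul_snd, smul_eq_mul]
  ring

lemma Flux.wedge_smul_right {K : Type} [CommRing K] (a : K) (y z : Flux K) :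
    y.wedge (a • z) = a * y.wedge z := by
  rw [Flux.wedge_comm, Flux.wedge_smul_left, Flux.wedge_comm]

lemma Flux.inner_smul_smul {K : Type} [CommRing K] (a b : K) (y z : Flux K) :
    (a • y).inner (b • z) = a * b * y.inner z := by
  simp only [Flux.inner, Prod.smul_fst, Prod.smul_snd, smul_eq_mul]
  ring

/-- The Boltzmann weight of the flux `m + aλ`, with a source of charge `b` in the direction
`λ`. -/
def fluxThetaTerm (β θ : ℝ) (b a : ℤ) (lam : Flux ℝ) (m : Flux ℤ) : ℂ :=
  Complex.exp (-(2 * Real.pi ^ 2 * β * (m.toReal + (a : ℝ) • lam).inner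
      (m.toReal + (a : ℝ) • lam) : ℝ)
    - Complex.I * (θ / 2 * (m.toReal + (a : ℝ) • lam).wedge (m.toReal + (a : ℝ) • lam) +
      2 * Real.pi * b * (m.toReal + (a : ℝ) • lam).wedge lam : ℝ))

/-- The theta function of the six fluxes. -/
def fluxTheta (β θ : ℝ) (b a : ℤ) (lam : Flux ℝ) : ℂ := ∑' m, fluxThetaTerm β θ b a lam m

/-- The factor that complementary planes contribute to `fluxTheta`. -/
def planePairTheta (β θ : ℝ) (b a : ℤ) (lam : ℝ × ℝ) : ℂ :=
  pairTheta (2 * Real.pi * β) (θ / (2 * Real.pi)) ((b : ℝ) • lam.swap) ((a : ℝ) • lam)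

/-- The scale factor of Poisson summation over the fluxes through a pair of planes. -/
def poissonFactor (β θ : ℝ) : ℝ := (√((2 * Real.pi * β) ^ 2 + (θ / (2 * Real.pi)) ^ 2))⁻¹

lemma poissonFactor_ne_zero {β : ℝ} (hβ : 0 < β) (θ : ℝ) : poissonFactor β θ ≠ 0 := by
  have := Real.pi_pos
  exact (inv_pos.mpr (Real.sqrt_pos.mpr (by positivity))).ne'

lemma planePairTheta_poisson {β : ℝ} (hβ : 0 < β) (θ : ℝ) (b a : ℤ) (lam : ℝ × ℝ) :
    planePairTheta β θ b a lam = poissonFactor β θ *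
      (Complex.exp (-(2 * Real.pi * Complex.I * (b * a * (2 * lam.1 * lam.2) : ℝ))) *
        planePairTheta (dualBeta β θ) (dualTheta β θ) a (-b) lam) := by
  have := Real.pi_pos
  have hβ' : 2 * Real.pi * dualBeta β θ =
      2 * Real.pi * β / ((2 * Real.pi * β) ^ 2 + (θ / (2 * Real.pi)) ^ 2) := by
    rw [dualBeta, mul_div_assoc]
  have hθ' : dualTheta β θ / (2 * Real.pi) =
      -(θ / (2 * Real.pi)) / ((2 * Real.pi * β) ^ 2 + (θ / (2 * Real.pi)) ^ 2) := by
    rw [dualTheta]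
    ring
  have hη : (a : ℝ) • lam.swap = -((-((a : ℝ) • lam)).swap) := by ext <;> simp
  have hα : ((-b : ℤ) : ℝ) • lam = -((b : ℝ) • lam.swap).swap := by ext <;> simp
  rw [planePairTheta, planePairTheta, pairTheta_poisson (by positivity), ← poissonFactor, hβ', hθ',
    hη, hα, pairTheta_neg_swap]
  congr 3
  simp only [Prod.smul_fst, Prod.smul_snd, Prod.fst_swap, Prod.snd_swap, smul_eq_mul]
  push_cast
  ring

lemma fluxTheta_eq_prod {β : ℝ} (hβ : 0 < β) (θ : ℝ) (b a : ℤ) (lam : Flux ℝ) :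
    fluxTheta β θ b a lam = planePairTheta β θ b a lam.1 *
      (planePairTheta β θ b a lam.2.1 * planePairTheta β θ b a lam.2.2) := by
  have hpi := Real.pi_pos
  have hπ : (Real.pi : ℂ) ≠ 0 := by exact_mod_cast hpi.ne'
  have hsum (z : ℝ × ℝ) := summable_norm_pairThetaTerm (A := 2 * Real.pi * β) (by positivity)
    (θ / (2 * Real.pi)) ((b : ℝ) • z.swap) ((a : ℝ) • z)
  simp only [planePairTheta, pairTheta]
  rw [tsum_mul_tsum_of_summable_norm (hsum lam.2.1) (hsum lam.2.2),
    tsum_mul_tsum_of_summable_norm (hsum lam.1) ((hsum lam.2.1).mul_norm (hsum lam.2.2))]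
  refine tsum_congr fun m => ?_
  simp only [fluxThetaTerm, pairThetaTerm, gaussianWave, ← Complex.exp_add]
  congr 1
  simp only [Flux.inner, Flux.wedge, Flux.toReal, Prod.fst_add, Prod.snd_add, Prod.smul_fst,
    Prod.smul_snd, smul_eq_mul, Prod.fst_swap, Prod.snd_swap]
  push_cast
  field_simp
  ring

lemma fluxTheta_poisson {β θ : ℝ} (hβ : 0 < β) (hβ' : 0 < dualBeta β θ) (b a : ℤ)
    (lam : Flux ℝ) : fluxTheta β θ b a lam = (poissonFactor β θ : ℂ) ^ 3 *
      (Complex.exp (-(2 * Real.pi * Complex.I * (b * a * lam.wedge lam : ℝ))) *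
        fluxTheta (dualBeta β θ) (dualTheta β θ) a (-b) lam) := by
  have hsplit : Complex.exp (-(2 * Real.pi * Complex.I * (b * a * lam.wedge lam : ℝ))) =
      Complex.exp (-(2 * Real.pi * Complex.I * (b * a * (2 * lam.1.1 * lam.1.2) : ℝ))) *
      Complex.exp (-(2 * Real.pi * Complex.I * (b * a * (2 * lam.2.1.1 * lam.2.1.2) : ℝ))) *
      Complex.exp (-(2 * Real.pi * Complex.I * (b * a * (2 * lam.2.2.1 * lam.2.2.2) : ℝ))) := by
    rw [← Complex.exp_add, ← Complex.exp_add]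
    congr 1
    simp only [Flux.wedge]
    push_cast
    ring
  rw [fluxTheta_eq_prod hβ, fluxTheta_eq_prod hβ', planePairTheta_poisson hβ _ b a lam.1,
    planePairTheta_poisson hβ _ b a lam.2.1, planePairTheta_poisson hβ _ b a lam.2.2, hsplit]
  ring

lemma fluxTheta_neg (β θ : ℝ) (b a : ℤ) (lam : Flux ℝ) :
    fluxTheta β θ (-b) (-a) lam = fluxTheta β θ b a lam := by
  rw [fluxTheta, ← (Equiv.neg (Flux ℤ)).tsum_eq]
  refine tsum_congr fun m => ?_
  have hneg : (-m).toReal + ((-a : ℤ) : ℝ) • lam = (-1 : ℝ) • (m.toReal + (a : ℝ) • lam) := by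
    ext <;> simp [Flux.toReal]
  simp only [fluxThetaTerm, Equiv.neg_apply]
  rw [hneg, Flux.inner_smul_smul, Flux.wedge_smul_left, Flux.wedge_smul_left,
    Flux.wedge_smul_right]
  congr 1
  push_cast
  ring

lemma fluxTheta_shift (β θ : ℝ) (b a : ℤ) (lam : Flux ℝ) :
    fluxTheta β (θ + 2 * Real.pi) (b - a) a lam =
      Complex.exp (Complex.I * Real.pi * (a ^ 2 * lam.wedge lam : ℝ)) *
        fluxTheta β θ b a lam := by
  rw [fluxTheta, fluxTheta, ← tsum_mul_left]
  refine tsum_congr fun m => ?_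
  simp only [fluxThetaTerm]
  rw [← Complex.exp_add, Complex.exp_eq_exp_iff_exists_int]
  refine ⟨-(m.1.1 * m.1.2 + m.2.1.1 * m.2.1.2 + m.2.2.1 * m.2.2.2), ?_⟩
  simp only [Flux.wedge, Flux.toReal, Prod.fst_add, Prod.snd_add, Prod.smul_fst,
    Prod.smul_snd, smul_eq_mul]
  push_cast
  ring

end FluxTheta

/-! ### Integration over compact gauge fields -/

section Torus

/-- The normalized Lebesgue measure on `[-π, π)`, the one-component factor of `gaugeMeasure`. -/
def circleMeasure : Measure ℝ :=
  (2 * NNReal.pi)⁻¹ • volume.restrict (Set.Ico (-Real.pi) Real.pi)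

instance : IsProbabilityMeasure circleMeasure where
  measure_univ := by
    have hlength : ENNReal.ofReal (Real.pi - -Real.pi) = (2 * NNReal.pi : NNReal) := by
      rw [← ENNReal.ofReal_coe_nnreal]
      congr 1
      push_cast [NNReal.coe_real_pi]
      ring
    have hpi : 2 * NNReal.pi ≠ 0 := mul_ne_zero two_ne_zero NNReal.pi_ne_zero
    rw [circleMeasure, Measure.smul_apply, Measure.restrict_apply MeasurableSet.univ,
      Set.univ_inter, Real.volume_Ico, hlength, ENNReal.smul_def, smul_eq_mul, ← ENNReal.coe_mul,
      inv_mul_cancel₀ hpi, ENNReal.coe_one]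

lemma circleMeasure_ae_mem : ∀ᵐ x ∂circleMeasure, x ∈ Set.Ico (-Real.pi) Real.pi :=
  Measure.ae_smul_measure (ae_restrict_mem measurableSet_Ico) _

lemma integral_circleMeasure (f : ℝ → ℂ) :
    ∫ x, f x ∂circleMeasure = (2 * Real.pi : ℂ)⁻¹ * ∫ x in (-Real.pi)..Real.pi, f x := by
  rw [circleMeasure, integral_smul_nnreal_measure, integral_Ico_eq_integral_Ioc,
    intervalIntegral.integral_of_le (by linarith [Real.pi_pos]), NNReal.smul_def]
  simp [Complex.real_smul]

lemma measurePreserving_toIocMod_add (b : ℝ) :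
    MeasurePreserving (fun x => toIocMod Real.two_pi_pos (-Real.pi) (x + b))
      circleMeasure circleMeasure := by
  have : Fact (0 < 2 * Real.pi) := ⟨Real.two_pi_pos⟩
  have hmk := AddCircle.measurePreserving_mk (2 * Real.pi) (-Real.pi)
  have hadd := measurePreserving_add_right (volume : Measure (AddCircle (2 * Real.pi)))
    (b : AddCircle (2 * Real.pi))
  have hrep := AddCircle.measurePreserving_equivIoc (2 * Real.pi) (a := -Real.pi)
  have hcoe := measurePreserving_subtype_coe (μa := (volume : Measure ℝ))
    (measurableSet_Ioc (a := -Real.pi) (b := -Real.pi + 2 * Real.pi))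
  have hset : volume.restrict (Set.Ioc (-Real.pi) (-Real.pi + 2 * Real.pi)) =
      volume.restrict (Set.Ico (-Real.pi) Real.pi) := by
    rw [show -Real.pi + 2 * Real.pi = Real.pi by ring]
    exact Measure.restrict_congr_set Ico_ae_eq_Ioc.symm
  have hcomp := (hcoe.comp hrep).comp (hadd.comp hmk)
  rw [hset] at hcomp
  exact hcomp.smul_measure (2 * NNReal.pi)⁻¹

lemma integral_circle_exp (k : ℤ) :
    ∫ x, Complex.exp (Complex.I * (x * k : ℝ)) ∂circleMeasure = if k = 0 then 1 else 0 := by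
  rw [integral_circleMeasure]
  split_ifs with h
  · have hpi : (Real.pi : ℂ) ≠ 0 := by exact_mod_cast Real.pi_ne_zero
    simp only [h, Int.cast_zero, mul_zero, Complex.ofReal_zero, Complex.exp_zero,
      intervalIntegral.integral_const, Complex.real_smul]
    push_cast
    field_simp
    ring
  · have hk : Complex.I * (k : ℂ) ≠ 0 := mul_ne_zero Complex.I_ne_zero (by exact_mod_cast h)
    have hcomm : ∀ x : ℝ, Complex.exp (Complex.I * (x * k : ℝ)) =
        Complex.exp (Complex.I * k * x) := fun x => by
      congr 1; push_cast; ring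
    have hends : Complex.exp (Complex.I * k * (Real.pi : ℝ)) =
        Complex.exp (Complex.I * k * ((-Real.pi : ℝ) : ℂ)) :=
      Complex.exp_eq_exp_iff_exists_int.mpr ⟨k, by push_cast; ring⟩
    simp only [hcomm]
    rw [integral_exp_mul_complex hk, hends, sub_self, zero_div, mul_zero]

variable {N : ℕ} [NeZero N] {L : Lattice} {r : ℕ}

lemma gaugeMeasure_eq : gaugeMeasure N L r = Measure.pi fun _ => circleMeasure := rfl

instance : IsProbabilityMeasure (gaugeMeasure N L r) :=
  inferInstanceAs (IsProbabilityMeasure (Measure.pi fun _ : Cell N L r => circleMeasure))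

lemma gaugeMeasure_ae_mem :
    ∀ᵐ A ∂gaugeMeasure N L r, ∀ c, A c ∈ Set.Icc (-Real.pi) Real.pi := by
  rw [ae_all_iff]
  intro c
  have heval := measurePreserving_eval (fun _ : Cell N L r => circleMeasure) c
  filter_upwards [heval.quasiMeasurePreserving.ae circleMeasure_ae_mem] with A hA
  exact Set.Ico_subset_Icc_self hA

lemma integral_exp_dot (k : Form N L r ℤ) :
    ∫ A, Complex.exp (Complex.I * (dot A k.toReal : ℝ)) ∂gaugeMeasure N L r =
      if k = 0 then 1 else 0 := by
  have hprod : ∀ A : Form N L r ℝ, Complex.exp (Complex.I * (dot A k.toReal : ℝ)) =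
      ∏ c, Complex.exp (Complex.I * (A c * k c : ℝ)) := by
    intro A
    rw [← Complex.exp_sum, ← Finset.mul_sum, ← Complex.ofReal_sum]
    rfl
  simp only [hprod, gaugeMeasure_eq]
  rw [integral_fintype_prod_eq_prod (𝕜 := ℂ) (E := fun _ : Cell N L r => ℝ)
    (fun c x => Complex.exp (Complex.I * (x * k c : ℝ)))]
  simp only [integral_circle_exp]
  rw [Finset.prod_ite_zero]
  simp [funext_iff]

lemma lintegral_gauge_add_right {g : Form N L r ℝ → ENNReal} (hg : Measurable g)
    (hper : ∀ A (k : Form N L r ℤ), g (A + (2 * Real.pi) • k.toReal) = g A)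
    (b : Form N L r ℝ) :
    ∫⁻ A, g (A + b) ∂gaugeMeasure N L r = ∫⁻ A, g A ∂gaugeMeasure N L r := by
  let wrap : Form N L r ℝ → Form N L r ℝ := fun A c =>
    toIocMod Real.two_pi_pos (-Real.pi) (A c + b c)
  have hwrap : MeasurePreserving wrap (gaugeMeasure N L r) (gaugeMeasure N L r) :=
    measurePreserving_pi (fun _ : Cell N L r => circleMeasure) (fun _ => circleMeasure)
      fun c => measurePreserving_toIocMod_add (b c)
  rw [← hwrap.lintegral_comp hg]
  congr 1
  funext A
  rw [← hper (wrap A) fun c => toIocDiv Real.two_pi_pos (-Real.pi) (A c + b c)]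
  congr 1
  funext c
  have h := toIocMod_add_toIocDiv_zsmul Real.two_pi_pos (-Real.pi) (A c + b c)
  exact (h.symm.trans (by rw [zsmul_eq_mul, mul_comm (Int.cast _)]) :)

lemma integrable_gauge {Φ : Form N L r ℝ → ℂ} (hc : Continuous Φ) {b : ℝ}
    (hb : ∀ A : Form N L r ℝ, (∀ c, A c ∈ Set.Icc (-Real.pi) Real.pi) → ‖Φ A‖ ≤ b) :
    Integrable Φ (gaugeMeasure N L r) :=
  Integrable.of_bound hc.aestronglyMeasurable b (by
    filter_upwards [gaugeMeasure_ae_mem] with A hA using hb A hA)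

lemma integral_norm_gauge_le {Φ : Form N L r ℝ → ℂ} (hc : Continuous Φ) {b : ℝ}
    (hb : ∀ A : Form N L r ℝ, (∀ c, A c ∈ Set.Icc (-Real.pi) Real.pi) → ‖Φ A‖ ≤ b) :
    ∫ A, ‖Φ A‖ ∂gaugeMeasure N L r ≤ b := by
  have h := integral_mono_ae (μ := gaugeMeasure N L r) (integrable_gauge hc hb).norm
    (integrable_const b) (by filter_upwards [gaugeMeasure_ae_mem] with A hA using hb A hA)
  simpa using h

lemma hasSum_integral_gauge {ι : Type*} [Countable ι] {Φ : ι → Form N L r ℝ → ℂ}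
    (hc : ∀ i, Continuous (Φ i)) {b : ι → ℝ} (hs : Summable b)
    (hb : ∀ A : Form N L r ℝ, (∀ c, A c ∈ Set.Icc (-Real.pi) Real.pi) → ∀ i, ‖Φ i A‖ ≤ b i) :
    HasSum (fun i => ∫ A, Φ i A ∂gaugeMeasure N L r)
      (∫ A, ∑' i, Φ i A ∂gaugeMeasure N L r) :=
  hasSum_integral_of_summable_integral_norm
    (fun i => integrable_gauge (hc i) fun A hA => hb A hA i)
    (Summable.of_nonneg_of_le (fun _ => integral_nonneg fun _ => norm_nonneg _)
      (fun i => integral_norm_gauge_le (hc i) fun A hA => hb A hA i) hs)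

end Torus

/-! ### Gaussian sums over integer forms -/

section GaussianSums

lemma summable_pi_prod {ι : Type*} [Fintype ι] {f : ℤ → ℝ} (hf : Summable f)
    (h0 : ∀ n, 0 ≤ f n) : Summable fun n : ι → ℤ => ∏ i, f (n i) := by
  classical
  refine summable_of_sum_le (c := ∏ _i : ι, ∑' n, f n)
    (fun n => Finset.prod_nonneg fun i _ => h0 _) fun s => ?_
  calc ∑ n ∈ s, ∏ i, f (n i)
      ≤ ∑ n ∈ Fintype.piFinset (fun i => s.image fun n => n i), ∏ i, f (n i) := by
        refine Finset.sum_le_sum_of_subset_of_nonneg (fun n hn => ?_)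
          fun n _ _ => Finset.prod_nonneg fun i _ => h0 _
        rw [Fintype.mem_piFinset]
        exact fun i => Finset.mem_image_of_mem (fun n : ι → ℤ => n i) hn
    _ = ∏ i, ∑ k ∈ s.image (fun n => n i), f k := by rw [Finset.prod_univ_sum]
    _ ≤ ∏ _i : ι, ∑' n, f n := Finset.prod_le_prod
        (fun i _ => Finset.sum_nonneg fun k _ => h0 k)
        fun i _ => hf.sum_le_tsum (s.image fun n => n i) fun k _ => h0 k

variable {N : ℕ} [NeZero N] {L : Lattice} {r : ℕ}

lemma summable_exp_neg_dot {c : ℝ} (hc : 0 < c) :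
    Summable fun n : Form N L r ℤ => Real.exp (-c * dot n.toReal n.toReal) := by
  refine (summable_pi_prod (ι := Cell N L r) (summable_exp_neg_sq hc)
    fun n => (Real.exp_pos _).le).congr fun n => ?_
  rw [← Real.exp_sum, dot, Finset.mul_sum]
  congr 1
  exact Finset.sum_congr rfl fun i _ => by rw [Form.toReal]; ring

lemma continuous_dot {α : Type*} [TopologicalSpace α] {f g : α → Form N L r ℝ}
    (hf : Continuous f) (hg : Continuous g) : Continuous fun a => dot (f a) (g a) :=
  continuous_finsetSum _ fun c _ =>
    ((continuous_apply c).comp hf).mul ((continuous_apply c).comp hg)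

lemma continuous_extDeriv (r : ℕ) :
    Continuous (extDeriv : Form N L r ℝ → Form N L (r + 1) ℝ) :=
  (extDerivₗ N L r ℝ).continuous_of_finiteDimensional

lemma neg_dot_add_le (E n : Form N L r ℝ) :
    -dot (E + n) (E + n) ≤ dot E E - 1 / 2 * dot n n := by
  have h := dot_self_nonneg ((2 : ℝ) • E + n)
  simp only [dot_add_left, dot_add_right, dot_smul_left, dot_smul_right] at h ⊢
  rw [dot_comm n E] at h ⊢
  linarith

/-- Continuous functions of the field strength with Gaussian decay, the class of functions for
which sums over integer forms and integrals over gauge fields may be interchanged. -/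
structure GaussianBounded (g : Form N L 2 ℝ → ℂ) : Prop where
  continuous : Continuous g
  bound : ∃ C κ : ℝ, 0 < κ ∧ ∀ E, ‖g E‖ ≤ C * Real.exp (-κ * dot E E)

variable {g : Form N L 2 ℝ → ℂ} (hg : GaussianBounded g)

include hg

lemma GaussianBounded.exists_summable_bound {s : Set (Form N L 1 ℝ)} (hs : IsCompact s) :
    ∃ b : Form N L 2 ℤ → ℝ, Summable b ∧
      ∀ A ∈ s, ∀ n, ‖g (extDeriv A + (2 * Real.pi) • n.toReal)‖ ≤ b n := by
  obtain ⟨C, κ, hκ, hC⟩ := hg.bound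
  obtain ⟨D, hD⟩ := hs.exists_bound_of_continuousOn
    (continuous_dot (continuous_extDeriv (N := N) (L := L) 1)
      (continuous_extDeriv 1)).continuousOn
  have hC0 : 0 ≤ C := nonneg_of_mul_nonneg_left ((norm_nonneg _).trans (hC 0)) (Real.exp_pos _)
  have hrate : 0 < κ * (2 * Real.pi ^ 2) := mul_pos hκ (by positivity)
  refine ⟨fun n => (C * Real.exp (κ * D)) *
    Real.exp (-(κ * (2 * Real.pi ^ 2)) * dot n.toReal n.toReal),
    (summable_exp_neg_dot hrate).mul_left _, fun A hA n => (hC _).trans ?_⟩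
  beta_reduce
  rw [mul_assoc, ← Real.exp_add]
  refine mul_le_mul_of_nonneg_left (Real.exp_le_exp.mpr ?_) hC0
  have hsplit := neg_dot_add_le (extDeriv A) ((2 * Real.pi) • n.toReal)
  rw [dot_smul_left, dot_smul_right] at hsplit
  have hcompact := (le_abs_self _).trans (hD A hA)
  linarith [mul_le_mul_of_nonneg_left (hsplit.trans (sub_le_sub_right hcompact _)) hκ.le]

lemma GaussianBounded.exists_box_bound : ∃ b : Form N L 2 ℤ → ℝ, Summable b ∧
    ∀ A : Form N L 1 ℝ, (∀ c, A c ∈ Set.Icc (-Real.pi) Real.pi) →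
      ∀ n, ‖g (extDeriv A + (2 * Real.pi) • n.toReal)‖ ≤ b n := by
  obtain ⟨b, hb, h⟩ := hg.exists_summable_bound (isCompact_univ_pi fun _ => isCompact_Icc)
  exact ⟨b, hb, fun A hA => h A fun c _ => hA c⟩

lemma GaussianBounded.summable (A : Form N L 1 ℝ) :
    Summable fun n : Form N L 2 ℤ => ‖g (extDeriv A + (2 * Real.pi) • n.toReal)‖ := by
  obtain ⟨b, hb, h⟩ := hg.exists_summable_bound (isCompact_singleton (x := A))
  exact Summable.of_nonneg_of_le (fun _ => norm_nonneg _) (h A rfl) hb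

end GaussianSums

/-! ### The fluxless sector -/

section Sector

variable {N : ℕ} [NeZero N] {L : Lattice}

/-- The group of closed integer `2`-forms without flux, i.e. of the fluctuations of `n` within
a fixed monopole and flux sector. -/
def fluxless (N : ℕ) [NeZero N] (L : Lattice) : AddSubgroup (Form N L 2 ℤ) where
  carrier := {e | extDeriv e = 0 ∧ flux e.toReal = 0}
  zero_mem' := by
    have hzero : (0 : Form N L 2 ℤ).toReal = (0 : ℝ) • (0 : Form N L 2 ℝ) := by
      funext c; simp [Form.toReal]
    exact ⟨(extDerivₗ N L 2 ℤ).map_zero, by rw [hzero, flux_smul, zero_smul]⟩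
  add_mem' := fun {a b} ha hb => ⟨by rw [extDeriv_add, ha.1, hb.1, add_zero], by
    rw [toReal_add, flux_add, ha.2, hb.2, add_zero]⟩
  neg_mem' := fun {a} ha => by
    rw [← neg_one_zsmul]
    exact ⟨by rw [extDeriv_smul, ha.1, smul_zero], by
      rw [toReal_smul, flux_smul, ha.2, smul_zero]⟩

lemma extDeriv_mem_fluxless (k : Form N L 1 ℤ) : extDeriv k ∈ fluxless N L :=
  ⟨extDeriv_extDeriv k, by rw [← extDeriv_toReal, flux_extDeriv]⟩

/-- The distribution of the field strengths `dA + 2πe` with `A` in the compact gauge field space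
and `e` fluxless. -/
def sectorMeasure (N : ℕ) [NeZero N] (L : Lattice) : Measure (Form N L 2 ℝ) :=
  Measure.sum fun e : fluxless N L =>
    (gaugeMeasure N L 1).map fun A => extDeriv A + (2 * Real.pi) • e.1.toReal

lemma continuous_extDeriv_add (D : Form N L 2 ℝ) :
    Continuous fun A : Form N L 1 ℝ => extDeriv A + D :=
  (continuous_extDeriv 1).add continuous_const

instance : NeZero (sectorMeasure N L) where
  out h := by
    have hzero := congrArg (fun μ => μ Set.univ) (Measure.sum_eq_zero.mp h 0)
    beta_reduce at hzero
    rw [Measure.map_apply (continuous_extDeriv_add _).measurable MeasurableSet.univ] at hzero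
    simp at hzero

lemma lintegral_sectorMeasure {f : Form N L 2 ℝ → ENNReal} (hf : Measurable f) :
    ∫⁻ E, f E ∂sectorMeasure N L =
      ∫⁻ A, ∑' e : fluxless N L, f (extDeriv A + (2 * Real.pi) • e.1.toReal)
        ∂gaugeMeasure N L 1 := by
  have hE := fun D : Form N L 2 ℝ => (continuous_extDeriv_add D).measurable
  rw [sectorMeasure, lintegral_sum_measure]
  refine Eq.trans ?_ (lintegral_tsum fun e => (hf.comp (hE _)).aemeasurable).symm
  exact tsum_congr fun e => lintegral_map hf (hE _)

/-- Shifting the gauge field by `b` can be undone modulo `2π`, at the cost of an exact, hence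
fluxless, integer form. -/
lemma measurePreserving_add_extDeriv (b : Form N L 1 ℝ) :
    MeasurePreserving (· + extDeriv b) (sectorMeasure N L) (sectorMeasure N L) := by
  have hadd : Measurable fun E : Form N L 2 ℝ => E + extDeriv b :=
    (continuous_id.add continuous_const).measurable
  refine ⟨hadd, Measure.ext_of_lintegral _ fun f hf => ?_⟩
  rw [lintegral_map hf hadd]
  have hshift := lintegral_gauge_add_right (N := N) (L := L)
    (g := fun A => ∑' e : fluxless N L, f (extDeriv A + (2 * Real.pi) • e.1.toReal))
    ?_ ?_ b
  · rw [lintegral_sectorMeasure hf, ← hshift]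
    refine (lintegral_sectorMeasure (hf.comp hadd)).trans ?_
    simp only [Function.comp_apply, extDeriv_add, add_right_comm _ (extDeriv b)]
  · exact Measurable.tsum fun e => hf.comp (continuous_extDeriv_add _).measurable
  · intro A k
    rw [← (Equiv.addRight (⟨extDeriv k, extDeriv_mem_fluxless k⟩ : fluxless N L)).tsum_eq
      fun e => f (extDeriv A + (2 * Real.pi) • e.1.toReal)]
    refine tsum_congr fun e => ?_
    rw [extDeriv_add, extDeriv_smul, extDeriv_toReal, Equiv.coe_addRight, AddSubgroup.coe_add,
      toReal_add, smul_add, add_assoc, add_comm ((2 * Real.pi) • (extDeriv k).toReal)]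

variable {g : Form N L 2 ℝ → ℂ} (hg : GaussianBounded g)

include hg

lemma GaussianBounded.integrable_sectorMeasure : Integrable g (sectorMeasure N L) := by
  obtain ⟨b, hb, h⟩ := hg.exists_box_bound
  have hE := fun D : Form N L 2 ℝ => (continuous_extDeriv_add D)
  refine integrable_sum_measure (fun e => ?_)
    (Summable.of_nonneg_of_le (fun e => integral_nonneg fun _ => norm_nonneg _) (fun e => ?_)
      (hb.subtype (· ∈ fluxless N L)))
  · exact (integrable_map_measure hg.continuous.aestronglyMeasurable
      (hE _).measurable.aemeasurable).mpr
      (integrable_gauge (hg.continuous.comp (hE _)) fun A hA => h A hA e.1)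
  · rw [integral_map (hE _).measurable.aemeasurable hg.continuous.norm.aestronglyMeasurable]
    exact integral_norm_gauge_le (hg.continuous.comp (hE _)) fun A hA => h A hA e.1

lemma GaussianBounded.tsum_integral_extDeriv_add (b : Form N L 1 ℝ) :
    ∑' e : fluxless N L, ∫ A, g (extDeriv (A + b) + (2 * Real.pi) • e.1.toReal)
      ∂gaugeMeasure N L 1 = ∫ E, g E ∂sectorMeasure N L := by
  have hb := measurePreserving_add_extDeriv b
  have hcont : Continuous fun E : Form N L 2 ℝ => g (E + extDeriv b) :=
    hg.continuous.comp (continuous_id.add continuous_const)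
  have hint : Integrable (fun E => g (E + extDeriv b)) (sectorMeasure N L) :=
    hb.integrable_comp_of_integrable hg.integrable_sectorMeasure
  rw [← hb.map_eq, integral_map hb.aemeasurable hg.continuous.aestronglyMeasurable,
    sectorMeasure, ← (hasSum_integral_measure hint).tsum_eq]
  refine tsum_congr fun e => ?_
  rw [integral_map (continuous_extDeriv_add _).measurable.aemeasurable
    hcont.aestronglyMeasurable]
  simp only [extDeriv_add, add_right_comm _ (extDeriv b)]

end Sector

/-! ### Gaussian integrals over the fluxless sector -/

section Gaussian

variable {N : ℕ} [NeZero N] {L : Lattice} {β : ℝ}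

/-- The Gaussian weight of a field strength `E`, with the source `J` at complex coupling `z`. -/
def gaussWeight (β : ℝ) (J : Form N L 2 ℝ) (z : ℂ) (E : Form N L 2 ℝ) : ℂ :=
  Complex.exp (-((β / 2 * dot E E : ℝ) : ℂ) + z * (dot E J : ℝ))

lemma norm_gaussWeight (β : ℝ) (J : Form N L 2 ℝ) (z : ℂ) (E : Form N L 2 ℝ) :
    ‖gaussWeight β J z E‖ = Real.exp (-(β / 2 * dot E E) + z.re * dot E J) := by
  rw [gaussWeight, Complex.norm_exp]
  simp only [Complex.add_re, Complex.neg_re, Complex.ofReal_re, Complex.mul_re,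
    Complex.ofReal_im, mul_zero, sub_zero]

lemma continuous_gaussWeight (β : ℝ) (J : Form N L 2 ℝ) (z : ℂ) :
    Continuous (gaussWeight β J z) := by
  have hEE : Continuous fun E : Form N L 2 ℝ => dot E E :=
    continuous_dot continuous_id continuous_id
  have hEJ : Continuous fun E : Form N L 2 ℝ => dot E J :=
    continuous_dot continuous_id continuous_const
  unfold gaussWeight
  fun_prop

lemma gaussianBounded_gaussWeight (hβ : 0 < β) (J : Form N L 2 ℝ) (z : ℂ) :
    GaussianBounded (gaussWeight β J z) := by
  refine ⟨continuous_gaussWeight β J z, Real.exp (z.re ^ 2 / β * dot J J), β / 4, by positivity,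
    fun E => ?_⟩
  rw [norm_gaussWeight, ← Real.exp_add]
  refine Real.exp_le_exp.mpr ?_
  have hsq : 0 ≤ (1 / (4 * β)) *
      dot (β • E + (-2 * z.re) • J) (β • E + (-2 * z.re) • J) :=
    mul_nonneg (by positivity) (dot_self_nonneg _)
  have hexpand : (1 / (4 * β)) * dot (β • E + (-2 * z.re) • J) (β • E + (-2 * z.re) • J) =
      β / 4 * dot E E - z.re * dot E J + z.re ^ 2 / β * dot J J := by
    simp only [dot_add_left, dot_add_right, dot_smul_left, dot_smul_right]
    rw [dot_comm J E]
    field_simp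
    ring
  linarith

lemma gaussWeight_zero (J : Form N L 2 ℝ) (E : Form N L 2 ℝ) :
    gaussWeight β J 0 E = (Real.exp (-(β / 2 * dot E E)) : ℝ) := by
  rw [gaussWeight, zero_mul, add_zero, Complex.ofReal_exp, Complex.ofReal_neg]

lemma integrable_exp_neg_dot (hβ : 0 < β) :
    Integrable (fun E : Form N L 2 ℝ => Real.exp (-(β / 2 * dot E E))) (sectorMeasure N L) := by
  have hint := (gaussianBounded_gaussWeight hβ (0 : Form N L 2 ℝ) 0).integrable_sectorMeasure.re
  simpa only [gaussWeight_zero, RCLike.re_eq_complex_re, Complex.ofReal_re] using hint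

/-- The Gaussian integral over the fluxless sector, without source. -/
def sectorIntegral (N : ℕ) [NeZero N] (L : Lattice) (β : ℝ) : ℂ :=
  ∫ E, gaussWeight β 0 0 E ∂sectorMeasure N L

lemma sectorIntegral_eq (β : ℝ) : sectorIntegral N L β =
    (∫ E, Real.exp (-(β / 2 * dot E E)) ∂sectorMeasure N L : ℝ) := by
  simp only [sectorIntegral, gaussWeight_zero, integral_complex_ofReal]

lemma sectorIntegral_ne_zero (hβ : 0 < β) : sectorIntegral N L β ≠ 0 := by
  rw [sectorIntegral_eq]
  exact_mod_cast (integral_exp_pos (integrable_exp_neg_dot hβ)).ne'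

/-- The Gaussian probability measure on the field strengths of the fluxless sector. -/
def gaussianSector (N : ℕ) [NeZero N] (L : Lattice) (β : ℝ) : Measure (Form N L 2 ℝ) :=
  (sectorMeasure N L).tilted fun E => -(β / 2 * dot E E)

lemma isProbabilityMeasure_gaussianSector (hβ : 0 < β) :
    IsProbabilityMeasure (gaussianSector N L β) :=
  isProbabilityMeasure_tilted (integrable_exp_neg_dot hβ)

lemma complexMGF_gaussianSector (β : ℝ) (J : Form N L 2 ℝ) (z : ℂ) :
    ProbabilityTheory.complexMGF (fun E => dot E J) (gaussianSector N L β) z =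
      (∫ E, gaussWeight β J z E ∂sectorMeasure N L) / sectorIntegral N L β := by
  rw [ProbabilityTheory.complexMGF, gaussianSector, integral_tilted, sectorIntegral_eq,
    ← integral_div]
  refine integral_congr_ae (.of_forall fun E => ?_)
  simp only [gaussWeight, Complex.exp_add, Complex.real_smul, Complex.ofReal_div,
    Complex.ofReal_exp, Complex.ofReal_neg]
  ring

/-- Completing the square: a source `t da` is absorbed by the shift `A ↦ A + (t / β) a`. -/
lemma integral_gaussWeight_ofReal (hβ : 0 < β) (a : Form N L 1 ℝ) (t : ℝ) :
    ∫ E, gaussWeight β (extDeriv a) t E ∂sectorMeasure N L =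
      Complex.exp ((t ^ 2 * dot (extDeriv a) (extDeriv a) / (2 * β) : ℝ)) *
        sectorIntegral N L β := by
  have hshift := measurePreserving_add_extDeriv (N := N) (L := L) ((t / β) • a)
  have hβ' : (β : ℂ) ≠ 0 := by exact_mod_cast hβ.ne'
  rw [sectorIntegral, ← integral_const_mul, ← hshift.map_eq,
    integral_map hshift.aemeasurable (continuous_gaussWeight _ _ _).aestronglyMeasurable,
    hshift.map_eq]
  refine integral_congr_ae (.of_forall fun E => ?_)
  simp only [gaussWeight, ← Complex.exp_add, extDeriv_smul, dot_add_left, dot_add_right,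
    dot_smul_left, dot_smul_right, dot_comm (extDeriv a) E]
  congr 1
  push_cast
  field_simp
  ring

lemma integrableExpSet_gaussianSector (hβ : 0 < β) (J : Form N L 2 ℝ) :
    ProbabilityTheory.integrableExpSet (fun E => dot E J) (gaussianSector N L β) = Set.univ := by
  refine Set.eq_univ_of_forall fun t => ?_
  refine (integrable_tilted_iff (integrable_exp_neg_dot hβ) _).mpr ?_
  have hint := (gaussianBounded_gaussWeight hβ J t).integrable_sectorMeasure.norm
  simpa only [norm_gaussWeight, Real.exp_add, smul_eq_mul, Complex.ofReal_re] using hint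

/-- The source term is a centred Gaussian variable: its moment generating function is known on
the real axis, hence on the whole plane by analytic continuation. -/
lemma integral_gaussWeight (hβ : 0 < β) (a : Form N L 1 ℝ) (z : ℂ) :
    ∫ E, gaussWeight β (extDeriv a) z E ∂sectorMeasure N L =
      Complex.exp (z ^ 2 * (dot (extDeriv a) (extDeriv a) / β : ℝ) / 2) *
        sectorIntegral N L β := by
  have := isProbabilityMeasure_gaussianSector (N := N) (L := L) hβ
  let variance : NNReal :=
    ⟨dot (extDeriv a) (extDeriv a) / β, div_nonneg (dot_self_nonneg _) hβ.le⟩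
  have hmgf : ProbabilityTheory.mgf (fun E => dot E (extDeriv a)) (gaussianSector N L β) =
      ProbabilityTheory.mgf id (ProbabilityTheory.gaussianReal 0 variance) := by
    funext t
    rw [← Complex.ofReal_inj, ← ProbabilityTheory.complexMGF_ofReal, complexMGF_gaussianSector,
      integral_gaussWeight_ofReal hβ, mul_div_cancel_right₀ _ (sectorIntegral_ne_zero hβ),
      ProbabilityTheory.mgf_id_gaussianReal, Complex.ofReal_exp]
    congr 2
    change t ^ 2 * _ / (2 * β) = 0 * t + dot (extDeriv a) (extDeriv a) / β * t ^ 2 / 2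
    field_simp
    ring
  have hz := ProbabilityTheory.eqOn_complexMGF_of_mgf hmgf (x := z)
    (by simp [integrableExpSet_gaussianSector hβ])
  rw [complexMGF_gaussianSector, div_eq_iff (sectorIntegral_ne_zero hβ),
    ProbabilityTheory.complexMGF_id_gaussianReal] at hz
  rw [hz]
  congr 2
  change z * (0 : ℝ) + (dot (extDeriv a) (extDeriv a) / β : ℝ) * z ^ 2 / 2 = _
  push_cast
  ring

end Gaussian

/-! ### Wilson loops and framings -/

section Contours

variable {N : ℕ} {L : Lattice}

lemma Contour.tangent_cons (b : OrientedLink N L) (γ : Contour N L) (x : Site N L) (μ : Fin 4) :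
    Contour.tangent (b :: γ) x μ = γ.tangent x μ +
      ((if b = ⟨x, μ, true⟩ then 1 else 0) -
        if b = ⟨x.shift (vec {μ}), μ, false⟩ then 1 else 0) := by
  simp only [Contour.tangent, List.count_cons, beq_iff_eq]
  split_ifs <;> push_cast <;> ring

/-- The image of a contour under a bijection of sites, link by link. -/
def Contour.image {L' : Lattice} (e : Site N L ≃ Site N L') (γ : Contour N L) : Contour N L' :=
  γ.map fun b => ⟨e b.site, b.dir, b.positive⟩

lemma Contour.tangent_image {L' : Lattice} {e : Site N L ≃ Site N L'}
    (he : ∀ x v, e (x.shift v) = (e x).shift v) (γ : Contour N L) (x : Site N L) (μ : Fin 4) :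
    (γ.image e).tangent (e x) μ = γ.tangent x μ := by
  have hinj : Function.Injective fun b : OrientedLink N L =>
      (⟨e b.site, b.dir, b.positive⟩ : OrientedLink N L') := by
    rintro ⟨y, ν, c⟩ ⟨y', ν', c'⟩ h
    simpa using h
  have hcount (y : Site N L) (c : Bool) : (γ.image e).count ⟨e y, μ, c⟩ = γ.count ⟨y, μ, c⟩ :=
    List.count_map_of_injective γ _ hinj ⟨y, μ, c⟩
  rw [Contour.tangent, Contour.tangent, ← he, hcount, hcount]

variable [NeZero N]

lemma linkValue_eq_sum (A : Form N L 1 ℝ) (b : OrientedLink N L) :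
    linkValue A b = ∑ x, ∑ μ, ((((if b = ⟨x, μ, true⟩ then 1 else 0) -
      if b = ⟨x.shift (vec {μ}), μ, false⟩ then 1 else 0 : ℤ) : ℝ) * A.coeff x {μ}) := by
  obtain ⟨y, ν, c⟩ := b
  have hend (x : Site N L) (μ : Fin 4) : y = x.shift (vec {μ}) ↔ y.shift (-vec {μ}) = x := by
    constructor <;> rintro rfl <;> simp
  cases c
  · simp only [linkValue, OrientedLink.mk.injEq, Bool.false_eq_true, and_false, and_true, if_false,
      hend, zero_sub, Int.cast_neg, Int.cast_ite, Int.cast_one, Int.cast_zero, neg_mul, ite_mul,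
      one_mul, zero_mul, Finset.sum_neg_distrib, neg_inj]
    rw [Finset.sum_comm, Finset.sum_eq_single_of_mem ν (Finset.mem_univ _) fun μ _ hμ => ?_]
    · simp only [and_true, Finset.sum_ite_eq, Finset.mem_univ, if_true]
    · simp only [hμ.symm, and_false, if_false, Finset.sum_const_zero]
  · simp only [linkValue, OrientedLink.mk.injEq, Bool.true_eq_false, and_false, and_true, if_false,
      if_true, sub_zero, Int.cast_ite, Int.cast_one, Int.cast_zero, ite_mul, one_mul, zero_mul,
      ite_and, Finset.sum_ite_irrel, Finset.sum_const_zero, Finset.sum_ite_eq, Finset.mem_univ]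

lemma sum_linkValue (A : Form N L 1 ℝ) (γ : Contour N L) :
    (γ.map (linkValue A)).sum = ∑ x, ∑ μ, (γ.tangent x μ : ℝ) * A.coeff x {μ} := by
  induction γ with
  | nil => simp [Contour.tangent]
  | cons b γ ih =>
    rw [List.map_cons, List.sum_cons, ih, linkValue_eq_sum]
    simp only [Contour.tangent_cons, Int.cast_add, add_mul, Finset.sum_add_distrib]
    exact add_comm _ _

omit [NeZero N] in
lemma wilson_eq_exp_sum (q : ℤ) (A : Form N L 1 ℝ) (γ : Contour N L) :
    wilson q A γ = Complex.exp (Complex.I * q * ((γ.map (linkValue A)).sum : ℝ)) := by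
  induction γ with
  | nil => simp [wilson]
  | cons b γ ih =>
    rw [wilson] at ih
    rw [wilson, List.map_cons, List.prod_cons, ih, List.map_cons, List.sum_cons, ← Complex.exp_add]
    congr 1
    push_cast
    ring

end Contours

section Framings

variable {N : ℕ} {L : Lattice}

lemma Site.F_shift (x : Site N L) (v : Fin 4 → ZMod N) : (x.shift v).F = x.F.shift v := by
  ext μ
  exact add_right_comm _ _ _

/-- The map `F` (`s = true`) or `F̃` (`s = false`), which displaces the magnetic part of a loop
from its electric part. -/
def framingMap (N : ℕ) (L : Lattice) (s : Bool) : Site N L ≃ Site N L.flip :=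
  if s then Site.F else (Site.shiftEquiv (-vec Finset.univ)).trans Site.F

lemma framingMap_shift (s : Bool) (x : Site N L) (v : Fin 4 → ZMod N) :
    framingMap N L s (x.shift v) = (framingMap N L s x).shift v := by
  cases s
  · change ((x.shift v).shift _).F = (x.shift _).F.shift v
    rw [← Site.F_shift, Site.shift_shift, Site.shift_shift, add_comm]
  · exact Site.F_shift x v

/-- The base point of the dual cube of the link `(x, μ)`, as seen with the framing `s`, is
`x + framingShift s μ`. -/
def framingShift (s : Bool) (μ : Fin 4) : Fin 4 → ZMod N :=
  if s then vec {μ} else -vec {μ}ᶜ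

lemma neg_vec_univ_add_vec (S : Finset (Fin 4)) :
    (-vec Finset.univ + vec S : Fin 4 → ZMod N) = -vec Sᶜ := by
  rw [← Finset.union_compl S, vec_union disjoint_compl_right]
  abel

lemma shuffleSign_singleton_compl (K : Type) [CommRing K] (μ : Fin 4) :
    shuffleSign K {μ} {μ}ᶜ = -shuffleSign K {μ}ᶜ {μ} := by
  rw [shuffleSign_singleton_swap (by simp), Finset.card_compl, Finset.card_singleton,
    Fintype.card_fin]
  ring

lemma coeff_magneticField (s : Bool) (Am : Form N L 3 ℝ) (x : Site N L) (μ : Fin 4) :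
    (magneticField Am).coeff (framingMap N L s x) {μ} =
      shuffleSign ℝ {μ}ᶜ {μ} * Am.coeff (x.shift (framingShift s μ)) {μ}ᶜ := by
  rw [Form.coeff_of_card _ _ _ (Finset.card_singleton μ), magneticField, Finset.sum_singleton]
  congr 2
  cases s
  · change ((Site.F.symm (x.shift _).F).shift _) = x.shift (-vec {μ}ᶜ)
    rw [Equiv.symm_apply_apply, Site.shift_shift, neg_vec_univ_add_vec]
  · change (Site.F.symm x.F).shift _ = x.shift (vec {μ})
    rw [Equiv.symm_apply_apply]

/-- The contour `γ` bounds a surface to which `l` is dual, with respect to the framing `s`. -/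
def Bounds (s : Bool) (l : Form N L 2 ℤ) (γ : Contour N L) : Prop :=
  ∀ x μ, γ.tangent x μ =
    shuffleSign ℤ {μ}ᶜ {μ} * (extDeriv l).coeff (x.shift (framingShift s μ)) {μ}ᶜ

lemma IsSeifert.bounds {l : Form N L 2 ℤ} {γ : Contour N L} (h : IsSeifert l γ) :
    Bounds true l γ := by
  intro x μ
  have hx := h x μ
  rw [shuffleSign_singleton_compl, neg_mul, neg_inj] at hx
  exact hx.symm

lemma IsSeifert.bounds_F {γ : Contour N Lattice.primal} {l : Form N Lattice.primal 2 ℤ}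
    (h : IsSeifert l γ) :
    Bounds false (transport (vec Finset.univ) Lattice.primal.flip l) γ.F := by
  intro x μ
  obtain ⟨y, rfl⟩ := Site.F.surjective x
  have hcarry : y.F.coord = y.coord := add_zero _
  have hsite : (⟨(y.F.shift (-vec {μ}ᶜ)).coord + vec Finset.univ⟩ : Site N Lattice.primal) =
      y.shift (vec {μ}) := by
    ext1
    simp only [Site.shift, hcarry]
    rw [← neg_vec_univ_add_vec]
    abel
  have htangent : γ.F.tangent y.F μ = γ.tangent y μ :=
    γ.tangent_image (e := Site.F) Site.F_shift y μ
  rw [htangent, h.bounds y μ, extDeriv_transport, coeff_transport]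
  exact congrArg (fun z => shuffleSign ℤ {μ}ᶜ {μ} * (extDeriv l).coeff z {μ}ᶜ) hsite.symm

end Framings

section LoopValues

variable {N : ℕ} [NeZero N] {L : Lattice} {K : Type} [CommRing K]

lemma sum_powersetCard_one_univ (φ : Finset (Fin 4) → K) :
    ∑ S ∈ Finset.powersetCard 1 (Finset.univ : Finset (Fin 4)), φ S = ∑ μ, φ {μ} := by
  rw [Finset.powersetCard_one, Finset.sum_map]
  rfl

lemma sum_powersetCard_three_univ (φ : Finset (Fin 4) → K) :
    ∑ S ∈ Finset.powersetCard 3 (Finset.univ : Finset (Fin 4)), φ S = ∑ μ, φ {μ}ᶜ := by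
  have hcompl : Finset.powersetCard 3 (Finset.univ : Finset (Fin 4)) =
      Finset.univ.image fun μ : Fin 4 => ({μ}ᶜ : Finset (Fin 4)) := by decide
  rw [hcompl, Finset.sum_image fun μ _ ν _ h => by simpa using h]

lemma dot_eq_sum_compl (f g : Form N L 3 K) :
    dot f g = ∑ μ, ∑ x, f.coeff x {μ}ᶜ * g.coeff x {μ}ᶜ := by
  simp only [dot_eq, sum_powersetCard_three_univ]
  exact Finset.sum_comm

lemma total_cup_one_three (A : Form N L 1 K) (g : Form N L 3 K) :
    total (cup A g) = ∑ μ, shuffleSign K {μ} {μ}ᶜ *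
      ∑ x, A.coeff x {μ} * g.coeff (x.shift (vec {μ})) {μ}ᶜ := by
  refine (total_eq _).trans ?_
  rw [sum_coeff_cup A g (Finset.card_fin 4), sum_powersetCard_one_univ]
  rfl

lemma total_cup_three_one (g : Form N L 3 K) (A : Form N L 1 K) :
    total (cup g A) = ∑ μ, shuffleSign K {μ}ᶜ {μ} *
      ∑ x, A.coeff x {μ} * g.coeff (x.shift (-vec {μ}ᶜ)) {μ}ᶜ := by
  refine (total_eq _).trans ?_
  rw [sum_coeff_cup g A (Finset.card_fin 4), sum_powersetCard_three_univ]
  refine Finset.sum_congr rfl fun μ _ => ?_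
  rw [← Finset.compl_eq_univ_sdiff, compl_compl, correlation, ← sum_shift _ (-vec {μ}ᶜ)]
  simp only [Site.shift_shift, neg_add_cancel, Site.shift_zero, mul_comm]

lemma pairing_extDeriv (s : Bool) (A : Form N L 1 K) (g : Form N L 2 K) :
    pairing s (extDeriv A) g = -∑ μ, shuffleSign K {μ}ᶜ {μ} *
      ∑ x, A.coeff x {μ} * (extDeriv g).coeff (x.shift (framingShift s μ)) {μ}ᶜ := by
  cases s
  · rw [pairing_false, total_cup_extDeriv_right, total_cup_three_one]
    rfl
  · rw [pairing_true, total_cup_extDeriv_left, total_cup_one_three]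
    simp only [shuffleSign_singleton_compl, neg_mul, Finset.sum_neg_distrib]
    rfl

variable {s : Bool} {l : Form N L 2 ℤ} {γ : Contour N L}

lemma Bounds.sum_tangent_mul (h : Bounds s l γ) (φ : Site N L → Fin 4 → ℝ) :
    ∑ x, ∑ μ, (γ.tangent x μ : ℝ) * φ x μ = ∑ μ, shuffleSign ℝ {μ}ᶜ {μ} *
      ∑ x, φ x μ * (extDeriv l.toReal).coeff (x.shift (framingShift s μ)) {μ}ᶜ := by
  simp only [h _ _, Int.cast_mul, intCast_shuffleSign, extDeriv_toReal, Form.coeff_toReal,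
    Finset.mul_sum]
  rw [Finset.sum_comm]
  exact Finset.sum_congr rfl fun μ _ => Finset.sum_congr rfl fun x _ => by ring

lemma Bounds.wilson_electric (h : Bounds s l γ) (q : ℤ) (A : Form N L 1 ℝ) :
    wilson q A γ = Complex.exp (-(Complex.I * q * (pairing s (extDeriv A) l.toReal : ℝ))) := by
  rw [wilson_eq_exp_sum, sum_linkValue, h.sum_tangent_mul, pairing_extDeriv]
  push_cast
  ring_nf

lemma Bounds.wilson_magnetic (h : Bounds s l γ) (q : ℤ) (Am : Form N L 3 ℝ) :
    wilson q (magneticField Am) (γ.image (framingMap N L s)) =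
      Complex.exp (Complex.I * q * (dot Am (extDeriv l).toReal : ℝ)) := by
  rw [wilson_eq_exp_sum, sum_linkValue, ← Equiv.sum_comp (framingMap N L s)]
  simp only [Contour.tangent_image (framingMap_shift s), coeff_magneticField]
  rw [h.sum_tangent_mul, ← extDeriv_toReal, dot_eq_sum_compl]
  congr 4
  funext μ
  rw [← sum_shift (fun x => Am.coeff x {μ}ᶜ * (extDeriv l.toReal).coeff x {μ}ᶜ)
    (framingShift s μ), Finset.mul_sum]
  refine Finset.sum_congr rfl fun x _ => ?_
  linear_combination (Am.coeff (x.shift (framingShift s μ)) {μ}ᶜ *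
    (extDeriv l.toReal).coeff (x.shift (framingShift s μ)) {μ}ᶜ) *
    shuffleSign_mul_self (K := ℝ) {μ}ᶜ {μ}

end LoopValues

/-! ### Integration over the magnetic gauge field -/

section MagneticIntegral

variable {N : ℕ} [NeZero N] {L : Lattice} (s : Bool) (β θ : ℝ) (p qe qm : ℤ)

/-- The expectation value of a dyonic loop with either framing: `evDyonic` for `s = true` and
`evDualDyonic` for `s = false`. -/
def framedEv (γ : Contour N L) : ℂ :=
  (∫ Ae, ∫ Am, ∑' n : Form N L 2 ℤ,
    boltzmann β θ p (framedCharge s Ae n) Ae Am n *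
      (wilson qe Ae γ * wilson qm (magneticField Am) (γ.image (framingMap N L s)))
      ∂(gaugeMeasure N L 3) ∂(gaugeMeasure N L 1)) / partitionFunction N L β θ

lemma framedEv_true (γ : Contour N L) : framedEv true β θ p qe qm γ = evDyonic β θ p qe qm γ :=
  rfl

lemma framedEv_false (γ : Contour N L) :
    framedEv false β θ p qe qm γ = evDualDyonic β θ p qe qm γ :=
  rfl

variable (l : Form N L 2 ℤ)

/-- The weight of a field configuration together with an electric loop bounded by the surface
dual to `l`, without the constraint on the monopoles. -/
def electricWeight (A : Form N L 1 ℝ) (n : Form N L 2 ℤ) : ℂ :=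
  Complex.exp (-(β / 2 * dot (fieldStrength A n) (fieldStrength A n) : ℝ) -
    Complex.I * (θ * framedCharge s A n + p * Real.pi * (pontryagin n : ℤ) +
      qe * pairing s (extDeriv A) l.toReal : ℝ))

/-- The integrand that is left after the integration over `Aᵐ`, which forces the monopole world
lines `dn` to be `q_m` times the loop. -/
def electricTerm (A : Form N L 1 ℝ) (n : Form N L 2 ℤ) : ℂ :=
  open Classical in
  if extDeriv n = qm • extDeriv l then electricWeight s β θ p qe l A n else 0

/-- The integral over `Aᵉ` that is left after the integration over `Aᵐ`. -/
def electricIntegral : ℂ :=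
  ∫ A, ∑' n : Form N L 2 ℤ, electricTerm s β θ p qe qm l A n ∂gaugeMeasure N L 1

lemma norm_electricWeight (A : Form N L 1 ℝ) (n : Form N L 2 ℤ) :
    ‖electricWeight s β θ p qe l A n‖ =
      ‖gaussWeight β 0 0 (extDeriv A + (2 * Real.pi) • n.toReal)‖ := by
  rw [norm_gaussWeight, electricWeight, Complex.norm_exp, fieldStrength_eq]
  congr 1
  simp

lemma norm_electricTerm_le (A : Form N L 1 ℝ) (n : Form N L 2 ℤ) :
    ‖electricTerm s β θ p qe qm l A n‖ ≤
      ‖gaussWeight β 0 0 (extDeriv A + (2 * Real.pi) • n.toReal)‖ := by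
  rw [electricTerm]
  split_ifs
  · exact (norm_electricWeight s β θ p qe l A n).le
  · simp

variable {s β l}

lemma dot_bdry_fieldStrength (A : Form N L 1 ℝ) (Am : Form N L 3 ℝ) (n : Form N L 2 ℤ) :
    dot (bdry Am) (fieldStrength A n) = -(2 * Real.pi * dot Am (extDeriv n).toReal) := by
  rw [dot_bdry_two, fieldStrength_eq, extDeriv_add, extDeriv_extDeriv, zero_add, extDeriv_smul,
    extDeriv_toReal, dot_smul_right]

lemma boltzmann_mul_wilson {γ : Contour N L} (h : Bounds s l γ) (A : Form N L 1 ℝ)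
    (Am : Form N L 3 ℝ) (n : Form N L 2 ℤ) :
    boltzmann β θ p (framedCharge s A n) A Am n *
        (wilson qe A γ * wilson qm (magneticField Am) (γ.image (framingMap N L s))) =
      electricWeight s β θ p qe l A n *
        Complex.exp (Complex.I * (dot Am (qm • extDeriv l - extDeriv n).toReal : ℝ)) := by
  have hconstraint : (qm • extDeriv l - extDeriv n).toReal =
      (qm : ℝ) • (extDeriv l).toReal + (-1 : ℝ) • (extDeriv n).toReal := by
    funext c
    simp [Form.toReal]
    ring
  have hpi : (Real.pi : ℂ) ≠ 0 := by exact_mod_cast Real.pi_ne_zero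
  rw [h.wilson_electric, h.wilson_magnetic, boltzmann, electricWeight, ← Complex.exp_add,
    ← Complex.exp_add, ← Complex.exp_add, dot_bdry_fieldStrength, hconstraint, dot_add_right,
    dot_smul_right, dot_smul_right]
  congr 1
  push_cast
  field_simp
  ring

lemma integral_boltzmann_mul_wilson (hβ : 0 < β) {γ : Contour N L} (h : Bounds s l γ)
    (A : Form N L 1 ℝ) :
    ∫ Am, ∑' n : Form N L 2 ℤ, boltzmann β θ p (framedCharge s A n) A Am n *
      (wilson qe A γ * wilson qm (magneticField Am) (γ.image (framingMap N L s)))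
      ∂(gaugeMeasure N L 3) = ∑' n : Form N L 2 ℤ, electricTerm s β θ p qe qm l A n := by
  simp only [boltzmann_mul_wilson θ p qe qm h]
  have hsum := hasSum_integral_gauge (r := 3)
    (Φ := fun n Am => electricWeight s β θ p qe l A n *
      Complex.exp (Complex.I * (dot Am (qm • extDeriv l - extDeriv n).toReal : ℝ)))
    (fun n => by
      have : Continuous fun Am : Form N L 3 ℝ => dot Am (qm • extDeriv l - extDeriv n).toReal :=
        continuous_dot continuous_id continuous_const
      fun_prop)
    ((gaussianBounded_gaussWeight hβ (0 : Form N L 2 ℝ) 0).summable A)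
    (fun Am _ n => by simp [norm_electricWeight, Complex.norm_exp])
  rw [← hsum.tsum_eq]
  refine tsum_congr fun n => ?_
  rw [integral_const_mul, integral_exp_dot, electricTerm]
  simp only [sub_eq_zero, eq_comm (a := qm • extDeriv l)]
  split_ifs <;> simp

lemma framedCharge_of_closed (s : Bool) (A : Form N L 1 ℝ) {n : Form N L 2 ℤ}
    (hn : extDeriv n = 0) : framedCharge s A n = chargeZero (fieldStrength A n) := by
  have hcup : total (cupOne (fieldStrength A n) (extDeriv n.toReal)) = 0 := by
    simpa [extDeriv_toReal_eq_zero hn] using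
      total_cupOne_smul_right 0 (fieldStrength A n) (0 : Form N L 3 ℝ)
  rw [framedCharge_eq, chargeZero, hcup, pairing_true, mul_zero, add_zero]

lemma partitionFunction_eq (s : Bool) (β : ℝ) (l : Form N L 2 ℤ) :
    partitionFunction N L β θ = electricIntegral s β θ 0 0 0 l := by
  rw [partitionFunction, electricIntegral]
  congr 1
  funext A
  refine tsum_congr fun n => ?_
  rw [electricTerm]
  simp only [zero_smul]
  refine if_ctx_congr Iff.rfl (fun hn => ?_) fun _ => rfl
  rw [electricWeight, framedCharge_of_closed s A hn]
  congr 1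
  push_cast
  ring

lemma framedEv_eq (hβ : 0 < β) {γ : Contour N L} (h : Bounds s l γ) :
    framedEv s β θ p qe qm γ =
      electricIntegral s β θ p qe qm l / electricIntegral s β θ 0 0 0 l := by
  rw [framedEv, partitionFunction_eq θ s β l, electricIntegral, electricIntegral]
  simp only [integral_boltzmann_mul_wilson θ p qe qm hβ h]

end MagneticIntegral

/-! ### The complex coupling -/

section Coupling

/-- The complex coupling `τ = θ / 2π + 2π i β`, on which Poisson summation acts as `τ ↦ -1 / τ` and
the shift of `θ` by `2π` as `τ ↦ τ + 1`. -/
def coupling (β θ : ℝ) : ℂ := (θ / (2 * Real.pi) : ℝ) + (2 * Real.pi * β : ℝ) * Complex.I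

lemma dualBeta_pos {β : ℝ} (hβ : 0 < β) (θ : ℝ) : 0 < dualBeta β θ := by
  have := Real.pi_pos
  rw [dualBeta]
  positivity

lemma normSq_coupling (β θ : ℝ) : Complex.normSq (coupling β θ) =
    (2 * Real.pi * β) ^ 2 + (θ / (2 * Real.pi)) ^ 2 := by
  rw [coupling, Complex.normSq_add_mul_I, add_comm]

lemma coupling_dual (β θ : ℝ) :
    coupling (dualBeta β θ) (dualTheta β θ) = -(coupling β θ)⁻¹ := by
  rw [Complex.inv_def, normSq_coupling]
  simp only [coupling, dualBeta, dualTheta, map_add, map_mul, Complex.conj_ofReal, Complex.conj_I]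
  push_cast
  ring

lemma coupling_add_two_pi (β θ : ℝ) : coupling β (θ + 2 * Real.pi) = coupling β θ + 1 := by
  have hpi : (Real.pi : ℂ) ≠ 0 := by exact_mod_cast Real.pi_ne_zero
  simp only [coupling]
  push_cast
  field_simp
  ring

lemma coupling_injective {β β' θ θ' : ℝ} (h : coupling β θ = coupling β' θ') :
    β = β' ∧ θ = θ' := by
  have hpi := Real.pi_ne_zero
  have him := congrArg Complex.im h
  have hre := congrArg Complex.re h
  simp only [coupling, Complex.add_re, Complex.add_im, Complex.ofReal_re, Complex.ofReal_im,
    Complex.re_ofReal_mul, Complex.im_ofReal_mul, Complex.I_re, Complex.I_im, mul_zero, mul_one,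
    add_zero, zero_add] at hre him
  field_simp at hre him
  exact ⟨him, hre⟩

lemma coupling_ne_zero {β : ℝ} (hβ : 0 < β) (θ : ℝ) : coupling β θ ≠ 0 := by
  have := Real.pi_pos
  rw [← Complex.normSq_pos, normSq_coupling]
  positivity

lemma dual_add_two_pi_iterate_three {β θ β₁ θ₁ β₂ θ₂ : ℝ} (hβ : 0 < β)
    (hβ₁ : β₁ = dualBeta β θ) (hθ₁ : θ₁ = dualTheta β θ + 2 * Real.pi)
    (hβ₂ : β₂ = dualBeta β₁ θ₁) (hθ₂ : θ₂ = dualTheta β₁ θ₁ + 2 * Real.pi) :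
    dualBeta β₂ θ₂ = β ∧ dualTheta β₂ θ₂ + 2 * Real.pi = θ := by
  have hne := coupling_ne_zero hβ θ
  have hne₁ := coupling_ne_zero (hβ₁ ▸ dualBeta_pos hβ θ) θ₁
  have h₁ : coupling β₁ θ₁ = 1 - (coupling β θ)⁻¹ := by
    rw [hβ₁, hθ₁, coupling_add_two_pi, coupling_dual]
    ring
  have h₂ : coupling β₂ θ₂ = 1 - (coupling β₁ θ₁)⁻¹ := by
    rw [hβ₂, hθ₂, coupling_add_two_pi, coupling_dual]
    ring
  have hτ : coupling β₁ θ₁ * coupling β θ = coupling β θ - 1 := by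
    rw [h₁]
    field_simp
  have hτ₂ : coupling β₂ θ₂ = -(coupling β₁ θ₁ * coupling β θ)⁻¹ := by
    rw [h₂]
    field_simp
    linear_combination hτ
  refine coupling_injective ?_
  rw [coupling_add_two_pi, coupling_dual, hτ₂, inv_neg, inv_inv, neg_neg]
  linear_combination hτ

/-- The energy `|q_e + q_m τ|² / 2β` of a dyonic loop, in units of `(P_∂ l)²`. -/
def selfEnergy (β θ : ℝ) (qe qm : ℤ) : ℝ :=
  Complex.normSq (qe + qm * coupling β θ) / (2 * β)

lemma selfEnergy_eq {β : ℝ} (hβ : 0 < β) (θ : ℝ) (qe qm : ℤ) : selfEnergy β θ qe qm =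
    β / 2 * (2 * Real.pi * qm) ^ 2 + (qe + θ * qm / (2 * Real.pi)) ^ 2 / (2 * β) := by
  rw [selfEnergy, Complex.normSq_apply]
  simp only [coupling, Complex.add_re, Complex.add_im, Complex.mul_re, Complex.mul_im,
    Complex.ofReal_re, Complex.ofReal_im, Complex.intCast_re, Complex.intCast_im, Complex.I_re,
    Complex.I_im]
  field_simp
  ring

lemma selfEnergy_dual {β : ℝ} (hβ : 0 < β) (θ : ℝ) (qe qm : ℤ) :
    selfEnergy (dualBeta β θ) (dualTheta β θ) qm (-qe) = selfEnergy β θ qe qm := by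
  have hne := coupling_ne_zero hβ θ
  have hcharge : (qm : ℂ) + ((-qe : ℤ) : ℂ) * coupling (dualBeta β θ) (dualTheta β θ) =
      (qe + qm * coupling β θ) / coupling β θ := by
    rw [coupling_dual]
    push_cast
    field_simp
    ring
  have hnormSq := (Complex.normSq_pos.mpr hne).ne'
  rw [selfEnergy, selfEnergy, hcharge, Complex.normSq_div, dualBeta, ← normSq_coupling]
  field_simp

lemma selfEnergy_shiftTheta (β θ : ℝ) (qe qm : ℤ) :
    selfEnergy β (θ + 2 * Real.pi) (qe - qm) qm = selfEnergy β θ qe qm := by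
  rw [selfEnergy, selfEnergy, coupling_add_two_pi]
  congr 2
  push_cast
  ring

lemma selfEnergy_neg (β θ : ℝ) (qe qm : ℤ) :
    selfEnergy β θ (-qe) (-qm) = selfEnergy β θ qe qm := by
  rw [selfEnergy, selfEnergy, ← Complex.normSq_neg]
  congr 2
  push_cast
  ring

lemma selfEnergy_zero (β θ : ℝ) : selfEnergy β θ 0 0 = 0 := by
  simp [selfEnergy]

end Coupling

section FramingPhase

variable {N : ℕ} [NeZero N] {L : Lattice}

/-- The phase of a dyonic loop that does not depend on the fluctuating fields. -/
def framingPhase (s : Bool) (θ : ℝ) (p qe qm : ℤ) (l : Form N L 2 ℤ) : ℂ :=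
  Complex.exp (-(Complex.I * (θ * (framingSign s * qm ^ 2 * uOf l / 2) +
    p * Real.pi * (qm ^ 2 * vOf l) + 2 * Real.pi * qe * qm * crossPairing l s : ℝ)))

variable (l : Form N L 2 ℤ)

lemma framingPhase_zero (s : Bool) (θ : ℝ) : framingPhase s θ 0 0 0 l = 1 := by
  simp [framingPhase]

lemma framingPhase_false (θ : ℝ) (p qe qm : ℤ) : framingPhase false θ p qe qm l =
    framingPhase true θ p qe qm l *
      Complex.exp (2 * Real.pi * Complex.I * uOf l * (qe + θ / (2 * Real.pi) * qm) * qm) := by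
  obtain ⟨z, hz⟩ := exists_int_crossPairing l
  have hpi : (Real.pi : ℂ) ≠ 0 := by exact_mod_cast Real.pi_ne_zero
  rw [framingPhase, framingPhase, ← Complex.exp_add, Complex.exp_eq_exp_iff_exists_int, hz]
  refine ⟨-(qe * qm * z), ?_⟩
  simp only [framingSign, Bool.false_eq_true, if_false, if_true]
  push_cast
  field_simp
  ring

lemma neg_one_zpow_eq_exp (k : ℤ) :
    (-1 : ℂ) ^ k = Complex.exp (Complex.I * Real.pi * k) := by
  rw [← Complex.exp_pi_mul_I, ← Complex.exp_int_mul]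
  congr 1
  ring

lemma framingPhase_shiftTheta (s : Bool) (θ : ℝ) (p qe qm : ℤ) :
    (-1) ^ (qm ^ 2 * vOf l) * framingPhase s (θ + 2 * Real.pi) p (qe - qm) qm l *
      Complex.exp (Complex.I * Real.pi *
        (qm ^ 2 * (flux l.toReal).wedge (flux l.toReal) : ℝ)) = framingPhase s θ p qe qm l := by
  obtain ⟨z, hz⟩ := exists_int_crossPairing l
  rw [neg_one_zpow_eq_exp, framingPhase, framingPhase, ← Complex.exp_add, ← Complex.exp_add,
    Complex.exp_eq_exp_iff_exists_int, wedge_flux_toReal]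
  refine ⟨qm ^ 2 * vOf l - if s then qm ^ 2 * z else 0, ?_⟩
  cases s <;> simp only [framingSign, Bool.false_eq_true, if_false, if_true, hz] <;>
    push_cast <;> ring

lemma framingPhase_poisson (s : Bool) (β θ : ℝ) (p qe qm : ℤ) :
    Complex.exp ((if s then -1 else 1) * (Complex.I * θ * uOf l * qm ^ 2 / 2 +
        Complex.I * dualTheta β θ * uOf l * qe ^ 2 / 2)
      - Complex.I * p * Real.pi * vOf l * (qm ^ 2 + qe ^ 2)) *
      framingPhase (!s) (dualTheta β θ) p qm (-qe) l =
      framingPhase s θ p qe qm l * Complex.exp (-(2 * Real.pi * Complex.I *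
        (qe * qm * (flux l.toReal).wedge (flux l.toReal) : ℝ))) := by
  obtain ⟨z, hz⟩ := exists_int_crossPairing l
  rw [framingPhase, framingPhase, ← Complex.exp_add, ← Complex.exp_add,
    Complex.exp_eq_exp_iff_exists_int, wedge_flux_toReal]
  refine ⟨qe * qm * (vOf l - z) - p * qe ^ 2 * vOf l, ?_⟩
  cases s <;> simp only [framingSign, Bool.false_eq_true, if_false, if_true, Bool.not_false,
    Bool.not_true, hz] <;> push_cast <;> ring

lemma framingPhase_neg (s : Bool) (θ : ℝ) (p qe qm : ℤ) :
    framingPhase s θ p (-qe) (-qm) l = framingPhase s θ p qe qm l := by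
  rw [framingPhase, framingPhase]
  congr 1
  push_cast
  ring

end FramingPhase

/-! ### Evaluation of the electric integral -/

section MonopoleSector

variable {N : ℕ} [NeZero N] {L : Lattice}

lemma exactPart_add (f g : Form N L 2 ℝ) : exactPart (f + g) = exactPart f + exactPart g := by
  have hmean : meanForm (f + g) = meanForm f + meanForm g := by
    funext c
    simp [meanForm, Finset.sum_add_distrib, mul_add]
  rw [exactPart, exactPart, exactPart, hmean]
  abel

lemma exactPart_of_flux_eq_zero {f : Form N L 2 ℝ} (hf : flux f = 0) : exactPart f = f := by
  have hmean : meanForm f = 0 := by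
    apply eq_zero_of_dot_self
    rw [dot_meanForm_left, flux_meanForm, hf]
    simp [Flux.inner]
  rw [exactPart, hmean, sub_zero]

variable (qm : ℤ) (l : Form N L 2 ℤ)

/-- The integer forms `n` with `dn = q_m dl`, parametrized by the fluxes of `n - q_m l` and a
fluxless remainder. -/
def monopoleConfig (x : Flux ℤ × fluxless N L) : Form N L 2 ℤ :=
  qm • l + fluxForm N L x.1 + x.2.1

lemma extDeriv_monopoleConfig (x : Flux ℤ × fluxless N L) :
    extDeriv (monopoleConfig qm l x) = qm • extDeriv l := by
  rw [monopoleConfig, extDeriv_add, extDeriv_add, extDeriv_smul, extDeriv_fluxForm, x.2.2.1,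
    add_zero, add_zero]

lemma monopoleConfig_injective : Function.Injective (monopoleConfig qm l) := by
  intro x y h
  simp only [monopoleConfig, add_assoc, add_right_inj] at h
  have hflux : x.1 = y.1 := by
    have hreal := congrArg (fun n => flux (Form.toReal n)) h
    simp only [toReal_add, flux_add, flux_fluxForm, x.2.2.2, y.2.2.2, add_zero] at hreal
    exact Flux.toReal_injective hreal
  rw [hflux, add_right_inj] at h
  exact Prod.ext hflux (Subtype.ext h)

lemma exists_monopoleConfig_eq {n : Form N L 2 ℤ} (hn : extDeriv n = qm • extDeriv l) :
    ∃ x, monopoleConfig qm l x = n := by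
  have hclosed : extDeriv (n - qm • l) = 0 := by
    rw [extDeriv_sub, extDeriv_smul, hn]
    exact sub_self _
  obtain ⟨m, hm⟩ := exists_flux_eq_toReal hclosed
  have hreal : (n - qm • l - fluxForm N L m).toReal =
      (n - qm • l).toReal + (-1 : ℝ) • (fluxForm N L m).toReal := by
    funext c
    simp [Form.toReal]
    ring
  have hfluxless : n - qm • l - fluxForm N L m ∈ fluxless N L := by
    refine ⟨by rw [extDeriv_sub, hclosed, extDeriv_fluxForm, sub_zero], ?_⟩
    rw [hreal, flux_add, flux_smul, hm, flux_fluxForm]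
    simp
  exact ⟨(m, ⟨_, hfluxless⟩), by simp [monopoleConfig]⟩

/-- The closed field `Fᵉ - 2π q_m P_∂ l` of the configuration `n = monopoleConfig qm l x`. -/
def closedField (A : Form N L 1 ℝ) (x : Flux ℤ × fluxless N L) : Form N L 2 ℝ :=
  (2 * Real.pi) • ((qm : ℝ) • closedPart l + (fluxForm N L x.1).toReal) +
    (extDeriv A + (2 * Real.pi) • x.2.1.toReal)

lemma extDeriv_smul_closedPart_add_fluxForm (m : Flux ℤ) :
    extDeriv ((2 * Real.pi) • ((qm : ℝ) • closedPart l + (fluxForm N L m).toReal)) = 0 := by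
  rw [extDeriv_smul, extDeriv_add, extDeriv_smul, extDeriv_closedPart,
    extDeriv_toReal_eq_zero (extDeriv_fluxForm m)]
  simp

lemma extDeriv_closedField (A : Form N L 1 ℝ) (x : Flux ℤ × fluxless N L) :
    extDeriv (closedField qm l A x) = 0 := by
  rw [closedField, extDeriv_add, extDeriv_smul_closedPart_add_fluxForm, extDeriv_add,
    extDeriv_extDeriv, extDeriv_smul, extDeriv_toReal_eq_zero x.2.2.1]
  simp

lemma fieldStrength_monopoleConfig (A : Form N L 1 ℝ) (x : Flux ℤ × fluxless N L) :
    fieldStrength A (monopoleConfig qm l x) =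
      (2 * Real.pi * qm) • projBdry l.toReal + closedField qm l A x := by
  rw [fieldStrength_eq, monopoleConfig, toReal_add, toReal_add, toReal_smul, closedField]
  conv_lhs => rw [toReal_eq_projBdry_add_closedPart l]
  module

lemma flux_closedField (A : Form N L 1 ℝ) (x : Flux ℤ × fluxless N L) :
    flux (closedField qm l A x) =
      (2 * Real.pi) • (x.1.toReal + (qm : ℝ) • flux l.toReal) := by
  rw [closedField, flux_add, flux_add, flux_smul, flux_smul, flux_add, flux_smul,
    flux_closedPart, flux_fluxForm, flux_extDeriv, x.2.2.2]
  module

lemma exactPart_closedField {qm : ℤ} {l : Form N L 2 ℤ} (A : Form N L 1 ℝ) {b : Form N L 1 ℝ}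
    {x : Flux ℤ × fluxless N L}
    (hb : exactPart ((2 * Real.pi) • ((qm : ℝ) • closedPart l + (fluxForm N L x.1).toReal)) =
      extDeriv b) :
    exactPart (closedField qm l A x) =
      extDeriv (A + b) + (2 * Real.pi) • x.2.1.toReal := by
  have hfluxless : flux (extDeriv A + (2 * Real.pi) • x.2.1.toReal) = 0 := by
    rw [flux_add, flux_extDeriv, flux_smul, x.2.2.2]
    simp
  rw [closedField, exactPart_add, hb, exactPart_of_flux_eq_zero hfluxless, extDeriv_add]
  abel

end MonopoleSector

section Evaluation

variable {N : ℕ} [NeZero N] {L : Lattice} {s : Bool} {β : ℝ} (θ : ℝ) (p qe qm : ℤ)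
  (l : Form N L 2 ℤ)

lemma pairing_extDeriv_toReal (A : Form N L 1 ℝ) (n : Form N L 2 ℤ) :
    pairing s (extDeriv A) l.toReal =
      pairing s (fieldStrength A n) l.toReal - 2 * Real.pi * (pairing s n l : ℤ) := by
  rw [fieldStrength_eq, pairing_add_left, pairing_smul_left, pairing_toReal]
  ring

lemma electricWeight_monopoleConfig {J : Form N L 2 ℝ}
    (hJ : ∀ f, pairing s f (projBdry l.toReal) = dot f J) (A : Form N L 1 ℝ) {b : Form N L 1 ℝ}
    {x : Flux ℤ × fluxless N L}
    (hb : exactPart ((2 * Real.pi) • ((qm : ℝ) • closedPart l + (fluxForm N L x.1).toReal)) =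
      extDeriv b) :
    electricWeight s β θ p qe l A (monopoleConfig qm l x) =
      Complex.exp (-(β / 2 * (2 * Real.pi * qm) ^ 2 * normSq l) : ℝ) *
        framingPhase s θ p qe qm l * fluxThetaTerm β θ qe qm (flux l.toReal) x.1 *
        gaussWeight β J (((-(qe + θ * qm / (2 * Real.pi)) : ℝ) : ℂ) * Complex.I)
          (extDeriv (A + b) + (2 * Real.pi) • x.2.1.toReal) := by
  have hF := fieldStrength_monopoleConfig qm l A x
  have hf := extDeriv_closedField qm l A x
  have hdot := dot_field_self l qm hf
  have hcharge := framedCharge_field l qm s A _ hf hF (extDeriv_monopoleConfig qm l x)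
  have hpairing := pairing_field_toReal l qm s hf
  rw [← hF, exactPart_closedField A hb, flux_closedField, Flux.inner_smul_smul] at hdot
  rw [hJ, exactPart_closedField A hb, flux_closedField, Flux.wedge_smul_left,
    Flux.wedge_smul_right] at hcharge
  rw [← hF, hJ, exactPart_closedField A hb, flux_closedField, Flux.wedge_smul_left] at hpairing
  obtain ⟨k, hk⟩ : ∃ k, pontryagin (monopoleConfig qm l x) = qm ^ 2 * vOf l + 2 * k := by
    rw [monopoleConfig, add_assoc]
    exact exists_pontryagin_smul_add_of_closed l qm
      (by rw [extDeriv_add, extDeriv_fluxForm, x.2.2.1, add_zero])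
  rw [electricWeight, pairing_extDeriv_toReal l A (monopoleConfig qm l x), hpairing, hcharge, hk,
    hdot, framingPhase, fluxThetaTerm, gaussWeight, ← Complex.exp_add, ← Complex.exp_add,
    ← Complex.exp_add, Complex.exp_eq_exp_iff_exists_int]
  refine ⟨qe * pairing s (monopoleConfig qm l x) l - p * k, ?_⟩
  have hpi : (Real.pi : ℂ) ≠ 0 := by exact_mod_cast Real.pi_ne_zero
  push_cast
  field_simp
  ring

lemma continuous_pairing_left (g : Form N L 2 ℝ) : Continuous fun f => pairing s f g :=
  ({ toFun := fun f => pairing s f g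
     map_add' := fun f f' => pairing_add_left s f f' g
     map_smul' := fun a f => pairing_smul_left s a f g } :
    Form N L 2 ℝ →ₗ[ℝ] ℝ).continuous_of_finiteDimensional

lemma continuous_pairing_self : Continuous fun f : Form N L 2 ℝ => pairing true f f := by
  simp only [pairing_true, total_cup_eq_dot_rightStar]
  refine continuous_dot continuous_id (continuous_pi fun c => continuous_const.mul ?_)
  unfold Form.coeff
  split_ifs
  · exact continuous_apply _
  · exact continuous_const

lemma continuous_total_cupOne (h : Form N L 3 ℝ) :
    Continuous fun f : Form N L 2 ℝ => total (cupOne f h) :=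
  ({ toFun := fun f => total (cupOne f h)
     map_add' := fun f f' => total_cupOne_add_left f f' h
     map_smul' := fun a f => total_cupOne_smul_left a f h } :
    Form N L 2 ℝ →ₗ[ℝ] ℝ).continuous_of_finiteDimensional

lemma continuous_electricTerm (n : Form N L 2 ℤ) :
    Continuous fun A : Form N L 1 ℝ => electricTerm s β θ p qe qm l A n := by
  have hd := continuous_extDeriv (N := N) (L := L) 1
  have hF : Continuous fun A : Form N L 1 ℝ => fieldStrength A n := hd.add continuous_const
  have hdot := continuous_dot hF hF
  have hcup := continuous_pairing_self.comp hF
  have hcupOne := (continuous_total_cupOne (extDeriv n.toReal)).comp hF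
  have hloop := (continuous_pairing_left (s := s) l.toReal).comp hd
  simp only [Function.comp_def] at hcup hcupOne hloop
  unfold electricTerm electricWeight
  simp only [framedCharge_eq]
  split_ifs
  · fun_prop
  · exact continuous_const

lemma hasSum_integral_electricTerm (hβ : 0 < β) :
    HasSum (fun n => ∫ A, electricTerm s β θ p qe qm l A n ∂gaugeMeasure N L 1)
      (electricIntegral s β θ p qe qm l) := by
  obtain ⟨b, hsummable, hb⟩ :=
    (gaussianBounded_gaussWeight hβ (0 : Form N L 2 ℝ) 0).exists_box_bound
  exact hasSum_integral_gauge (continuous_electricTerm θ p qe qm l) hsummable fun A hA n =>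
    (norm_electricTerm_le s β θ p qe qm l A n).trans (hb A hA n)

lemma electricIntegral_eq_tsum_monopoleConfig (hβ : 0 < β) :
    electricIntegral s β θ p qe qm l = ∑' (m : Flux ℤ) (e : fluxless N L),
      ∫ A, electricWeight s β θ p qe l A (monopoleConfig qm l (m, e)) ∂gaugeMeasure N L 1 := by
  have hsum := hasSum_integral_electricTerm (s := s) θ p qe qm l hβ
  have hzero : ∀ n ∉ Set.range (monopoleConfig qm l),
      ∫ A, electricTerm s β θ p qe qm l A n ∂gaugeMeasure N L 1 = 0 := by
    intro n hn
    have hconstraint : ¬ extDeriv n = qm • extDeriv l :=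
      fun h => hn (exists_monopoleConfig_eq qm l h)
    simp only [electricTerm, if_neg hconstraint, integral_zero]
  have hinj := monopoleConfig_injective qm l
  rw [← hsum.tsum_eq, ← hinj.tsum_eq (Function.support_subset_iff'.mpr hzero)]
  refine ((hinj.summable_iff hzero).mpr hsum.summable).tsum_prod.trans ?_
  simp only [Function.comp_apply, electricTerm, extDeriv_monopoleConfig, if_true]

theorem electricIntegral_eq (hβ : 0 < β) : electricIntegral s β θ p qe qm l =
    Complex.exp (-(selfEnergy β θ qe qm * normSq l) : ℝ) * framingPhase s θ p qe qm l *
      fluxTheta β θ qe qm (flux l.toReal) * sectorIntegral N L β := by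
  obtain ⟨B, hB⟩ := projBdry_mem l.toReal
  obtain ⟨a, ha, hnorm⟩ := exists_pairing_bdry_eq_dot_extDeriv s B
  rw [← hB] at ha hnorm
  choose b hb using fun m : Flux ℤ =>
    exists_exactPart_eq (extDeriv_smul_closedPart_add_fluxForm qm l m)
  have hsector : ∀ m : Flux ℤ, ∑' e : fluxless N L,
      ∫ A, electricWeight s β θ p qe l A (monopoleConfig qm l (m, e)) ∂gaugeMeasure N L 1 =
        Complex.exp (-(selfEnergy β θ qe qm * normSq l) : ℝ) * framingPhase s θ p qe qm l *
          fluxThetaTerm β θ qe qm (flux l.toReal) m * sectorIntegral N L β := by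
    intro m
    have hweight := fun (e : fluxless N L) A => electricWeight_monopoleConfig (β := β)
      θ p qe qm l ha A (x := (m, e)) (hb m)
    have hexponent : Complex.exp (-(selfEnergy β θ qe qm * normSq l) : ℝ) =
        Complex.exp (-(β / 2 * (2 * Real.pi * qm) ^ 2 * normSq l) : ℝ) *
          Complex.exp (((-(qe + θ * qm / (2 * Real.pi)) : ℝ) * Complex.I) ^ 2 *
            (normSq l / β : ℝ) / 2) := by
      rw [selfEnergy_eq hβ, ← Complex.exp_add, mul_pow _ Complex.I, Complex.I_sq]
      congr 1
      push_cast
      ring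
    simp only [hweight, integral_const_mul, tsum_mul_left]
    rw [(gaussianBounded_gaussWeight hβ _ _).tsum_integral_extDeriv_add, integral_gaussWeight hβ,
      hnorm, ← normSq, hexponent]
    ring
  rw [electricIntegral_eq_tsum_monopoleConfig θ p qe qm l hβ]
  simp only [hsector, tsum_mul_right, tsum_mul_left, fluxTheta]

end Evaluation

/-! ### Duality of the expectation values -/

section LoopFormula

variable {N : ℕ} [NeZero N] {L : Lattice}

/-- The closed form of the expectation value of a dyonic loop with the framing `s` that bounds the
surface dual to `l`. -/
def loopFormula (s : Bool) (β θ : ℝ) (p qe qm : ℤ) (l : Form N L 2 ℤ) : ℂ :=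
  Complex.exp (-(selfEnergy β θ qe qm * normSq l) : ℝ) * framingPhase s θ p qe qm l *
    (fluxTheta β θ qe qm (flux l.toReal) / fluxTheta β θ 0 0 (flux l.toReal))

theorem framedEv_eq_loopFormula {s : Bool} {β : ℝ} (hβ : 0 < β) (θ : ℝ) (p qe qm : ℤ)
    {l : Form N L 2 ℤ} {γ : Contour N L} (h : Bounds s l γ) :
    framedEv s β θ p qe qm γ = loopFormula s β θ p qe qm l := by
  rw [framedEv_eq θ p qe qm hβ h, electricIntegral_eq θ p qe qm l hβ,
    electricIntegral_eq θ 0 0 0 l hβ, mul_div_mul_right _ _ (sectorIntegral_ne_zero hβ),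
    framingPhase_zero, selfEnergy_zero, zero_mul, neg_zero, Complex.ofReal_zero, Complex.exp_zero,
    one_mul, one_mul, mul_div_assoc, loopFormula]

lemma loopFormula_transport (s : Bool) (β θ : ℝ) (p qe qm : ℤ) (v : Fin 4 → ZMod N)
    (L' : Lattice) (l : Form N L 2 ℤ) :
    loopFormula s β θ p qe qm (transport v L' l) = loopFormula s β θ p qe qm l := by
  rw [loopFormula, loopFormula, framingPhase, framingPhase, normSq_transport,
    crossPairing_transport, vOf_transport, uOf_transport, toReal_transport, flux_transport]

variable (l : Form N L 2 ℤ)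

lemma loopFormula_false (β θ : ℝ) (p qe qm : ℤ) : loopFormula false β θ p qe qm l =
    loopFormula true β θ p qe qm l *
      Complex.exp (2 * Real.pi * Complex.I * uOf l * (qe + θ / (2 * Real.pi) * qm) * qm) := by
  rw [loopFormula, loopFormula, framingPhase_false]
  ring

lemma loopFormula_shiftTheta (s : Bool) (β θ : ℝ) (p qe qm : ℤ) :
    (-1) ^ (qm ^ 2 * vOf l) * loopFormula s β (θ + 2 * Real.pi) p (qe - qm) qm l =
      loopFormula s β θ p qe qm l := by
  have hvacuum : fluxTheta β (θ + 2 * Real.pi) 0 0 (flux l.toReal) =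
      fluxTheta β θ 0 0 (flux l.toReal) := by
    simpa using fluxTheta_shift β θ 0 0 (flux l.toReal)
  rw [loopFormula, loopFormula, hvacuum, fluxTheta_shift, selfEnergy_shiftTheta,
    ← framingPhase_shiftTheta l s θ p qe qm]
  ring

lemma loopFormula_poisson (s : Bool) {β : ℝ} (hβ : 0 < β) (θ : ℝ) (p qe qm : ℤ) :
    Complex.exp ((if s then -1 else 1) * (Complex.I * θ * uOf l * qm ^ 2 / 2 +
        Complex.I * dualTheta β θ * uOf l * qe ^ 2 / 2)
      - Complex.I * p * Real.pi * vOf l * (qm ^ 2 + qe ^ 2)) *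
      loopFormula (!s) (dualBeta β θ) (dualTheta β θ) p qm (-qe) l =
      loopFormula s β θ p qe qm l := by
  have hfactor : (poissonFactor β θ : ℂ) ^ 3 ≠ 0 :=
    pow_ne_zero 3 (Complex.ofReal_ne_zero.mpr (poissonFactor_ne_zero hβ θ))
  have hpoisson := fluxTheta_poisson hβ (dualBeta_pos hβ θ)
  have hvacuum : fluxTheta β θ 0 0 (flux l.toReal) = (poissonFactor β θ : ℂ) ^ 3 *
      fluxTheta (dualBeta β θ) (dualTheta β θ) 0 0 (flux l.toReal) := by
    simpa using hpoisson 0 0 (flux l.toReal)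
  rw [loopFormula, loopFormula, hvacuum, hpoisson, mul_div_mul_left _ _ hfactor, selfEnergy_dual hβ,
    mul_div_assoc (Complex.exp _)]
  linear_combination Complex.exp (-(selfEnergy β θ qe qm * normSq l) : ℝ) *
    (fluxTheta (dualBeta β θ) (dualTheta β θ) qm (-qe) (flux l.toReal) /
      fluxTheta (dualBeta β θ) (dualTheta β θ) 0 0 (flux l.toReal)) *
      framingPhase_poisson l s β θ p qe qm

lemma loopFormula_neg (s : Bool) (β θ : ℝ) (p qe qm : ℤ) :
    loopFormula s β θ p (-qe) (-qm) l = loopFormula s β θ p qe qm l := by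
  rw [loopFormula, loopFormula, framingPhase_neg, selfEnergy_neg, fluxTheta_neg]

end LoopFormula

section LoopExpressions

variable {N : ℕ} [NeZero N] {γ : Contour N Lattice.primal} {l : Form N Lattice.primal 2 ℤ}

lemma IsSeifert.evDyonic_eq (h : IsSeifert l γ) {β : ℝ} (hβ : 0 < β) (θ : ℝ) (p qe qm : ℤ) :
    evDyonic β θ p qe qm γ = loopFormula true β θ p qe qm l := by
  rw [← framedEv_true, framedEv_eq_loopFormula hβ θ p qe qm h.bounds]

lemma IsSeifert.evDualDyonic_eq (h : IsSeifert l γ) {β : ℝ} (hβ : 0 < β) (θ : ℝ)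
    (p qe qm : ℤ) : evDualDyonic β θ p qe qm γ.F = loopFormula false β θ p qe qm l := by
  rw [← framedEv_false, framedEv_eq_loopFormula hβ θ p qe qm h.bounds_F, loopFormula_transport]

lemma IsSeifert.value_eq (h : IsSeifert l γ) (p : ℤ) {s : LoopExpr} (hs : 0 < s.β) :
    s.value γ p = s.c * loopFormula s.framed s.β s.θ p s.qe s.qm l := by
  rw [LoopExpr.value]
  split_ifs with hf
  · rw [h.evDyonic_eq hs, hf]
  · rw [h.evDualDyonic_eq hs, Bool.eq_false_iff.mpr hf]

lemma IsSeifert.value_poisson (h : IsSeifert l γ) (p : ℤ) {s : LoopExpr} (hs : 0 < s.β) :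
    (s.poisson (uOf l) (vOf l) p).value γ p = s.value γ p := by
  have hdual : 0 < (s.poisson (uOf l) (vOf l) p).β := dualBeta_pos hs s.θ
  rw [h.value_eq p hs, h.value_eq p hdual, ← loopFormula_poisson l s.framed hs, ← mul_assoc]
  rfl

lemma IsSeifert.value_shiftTheta (h : IsSeifert l γ) (p : ℤ) {s : LoopExpr} (hs : 0 < s.β) :
    (s.shiftTheta (vOf l)).value γ p = s.value γ p := by
  have hshift : 0 < (s.shiftTheta (vOf l)).β := hs
  rw [h.value_eq p hs, h.value_eq p hshift, ← loopFormula_shiftTheta l s.framed, ← mul_assoc]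
  rfl

lemma LoopExpr.shiftTheta_poisson_iterate_pos (u : ℝ) (v p : ℤ) {s : LoopExpr} (hs : 0 < s.β)
    (j : ℕ) : 0 < ((LoopExpr.shiftTheta v ∘ LoopExpr.poisson u v p)^[j] s).β := by
  induction j with
  | zero => exact hs
  | succ j ih =>
    rw [Function.iterate_succ_apply']
    exact dualBeta_pos ih _

lemma LoopExpr.shiftTheta_poisson_iterate_three (u : ℝ) (v p qe qm : ℤ) {β : ℝ} (hβ : 0 < β)
    (θ : ℝ) : (LoopExpr.shiftTheta v ∘ LoopExpr.poisson u v p)^[3] ⟨true, qe, qm, β, θ, 1⟩ =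
      ⟨false, -qe, -qm, β, θ,
        Complex.exp (-(2 * Real.pi * Complex.I * u * (qe + θ / (2 * Real.pi) * qm) * qm))⟩ := by
  obtain ⟨hβ₃, hθ₃⟩ := dual_add_two_pi_iterate_three hβ (θ := θ) rfl rfl rfl rfl
  have hpi : (Real.pi : ℂ) ≠ 0 := by exact_mod_cast Real.pi_ne_zero
  simp only [Function.iterate_succ, Function.iterate_zero, Function.comp_apply, id_eq,
    LoopExpr.shiftTheta, LoopExpr.poisson, LoopExpr.mk.injEq]
  refine ⟨rfl, by ring, by ring, hβ₃, hθ₃, ?_⟩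
  simp only [eq_sub_of_add_eq hθ₃, Bool.not_true, Bool.not_false, if_true,
    Bool.false_eq_true, if_false, neg_one_zpow_eq_exp, ← Complex.exp_add, one_mul]
  rw [Complex.exp_eq_exp_iff_exists_int]
  refine ⟨v * (qm ^ 2 + qe ^ 2 + qm * qe) - 2 * p * v * (qm ^ 2 + qe ^ 2 + qm * qe), ?_⟩
  push_cast
  field_simp
  ring

end LoopExpressions

end LatticeMaxwell

end

theorem mainTheorem5 (N : ℕ) [NeZero N] (β θ : ℝ) (hβ : 0 < β) (p qe qm : ℤ)
    (γ : Contour N Lattice.primal) (l : Form N Lattice.primal 2 ℤ) (hl : IsSeifert l γ) :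
    -- the relation between the two framings
    evDualDyonic β θ p qe qm γ.F =
      evDyonic β θ p qe qm γ *
        Complex.exp (2 * Real.pi * Complex.I * uOf l * (qe + θ / (2 * Real.pi) * qm) * qm) ∧
    -- it is obtained by alternating Poisson summation and the theta-shift three times
    (let P : LoopExpr → LoopExpr := LoopExpr.poisson (uOf l) (vOf l) p
     let T : LoopExpr → LoopExpr := LoopExpr.shiftTheta (vOf l)
     let s₀ : LoopExpr := ⟨true, qe, qm, β, θ, 1⟩
     (∀ j < 3, ((P ((T ∘ P)^[j] s₀)).value γ p = ((T ∘ P)^[j] s₀).value γ p ∧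
        (T (P ((T ∘ P)^[j] s₀))).value γ p = (P ((T ∘ P)^[j] s₀)).value γ p)) ∧
     (T ∘ P)^[3] s₀ = ⟨false, -qe, -qm, β, θ,
        Complex.exp (-(2 * Real.pi * Complex.I * uOf l * (qe + θ / (2 * Real.pi) * qm) * qm))⟩ ∧
     evDualDyonic β θ p (-qe) (-qm) γ.F = evDualDyonic β θ p qe qm γ.F) := by
  refine ⟨?_, fun j _ => ?_, LoopExpr.shiftTheta_poisson_iterate_three _ _ _ _ _ hβ θ, ?_⟩
  · rw [hl.evDyonic_eq hβ, hl.evDualDyonic_eq hβ, loopFormula_false]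
  · have hpos := LoopExpr.shiftTheta_poisson_iterate_pos (uOf l) (vOf l) p
      (s := ⟨true, qe, qm, β, θ, 1⟩) hβ j
    exact ⟨hl.value_poisson p hpos, hl.value_shiftTheta p (dualBeta_pos hpos _)⟩
  · rw [hl.evDualDyonic_eq hβ, hl.evDualDyonic_eq hβ, loopFormula_neg]
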